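/- **Setting.** There are $N+1$ risk-neutral agents. A contest is a vector of prizes $0=v_0\le v_1\le\dots\le v_N$ with $v_0<v_N$; $\mathcal V$ denotes the set of contests, viewed as a convex set in the coordinates $(v_1,\dots,v_N)\in\mathbb R^N$. An agent who outperforms exactly $r$ of the $N$ other agents receives $v_r$, ties being broken uniformly at random. Let $\mathcal F$ be the set of continuous $c:[0,\infty)\to[0,\infty)$ with $c(0)=0$, $c$ differentiable with $c'(x)>0$ for all $x>0$, and $c(x)\to\infty$ as $x\to\infty$. Let $\theta_1>\dots>\theta_K>0$ $(K\ge 1)$, let $c\in\mathcal F$, and let $p_1,\dots,p_K>0$ with $\sum_k p_k=1$. Types are private and independent across agents; an agent is of type $k$ with probability $p_k$, and effort $x\ge0$ costs type $k$ the amount $c_k(x)=\theta_k c(x)$. In a symmetric Bayes–Nash equilibrium each type $k$ draws its effort from a probability distribution $\sigma_k$ on $[0,\infty)$, and $\sigma_k$-almost every effort maximizes type $k$'s expected payoff (expected prize minus cost) when all other agents use $\sigma$. Put $P_k=p_1+\dots+p_k$, $H^n_m(t)=\binom nm t^m(1-t)^{n-m}$, $H^n_{\ge m}=\sum_{i=m}^n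 H^n_i$, and $$\alpha_m=\frac1{N+1}\Big[\frac1{\theta_K}-\sum_{k=1}^{K-1}\big(H^{N+1}_{\ge m}(P_k)+(N-m)H^{N+1}_m(P_k)\big)\Big(\frac1{\theta_{k+1}}-\frac1{\theta_k}\Big)\Big]$$ (the marginal effect of prize $m$ on expected equilibrium effort when $c(x)=x$). Let $m,m'\in\{1,\dots,N\}$ with $m>m'$. **Theorem.** Every contest $v\in\mathcal V$ has exactly one symmetric equilibrium. Let $\mathbb E[X](v)=\sum_k p_k\int x\,d\sigma_k(x)$ be the expected equilibrium effort of an agent and $u_K(v)$ the equilibrium utility of the most efficient type $K$. Derivatives at $v\in\mathcal V$ are taken within $\mathcal V$ (one-sided where necessary), and for a function that is differentiable within $\mathcal V$ at $v$, $\partial/\partial v_m$ denotes the value of its derivative on the $m$-th unit vector. Then $u_K$ is differentiable at every $v\in\mathcal V$, and $$\frac{\partial u_K}{\partial v_m}-\frac{\partial u_K}{\partial v_{m'}}\le 0\iff \sum_{k=1}^{K-1}\big(H^N_m(P_k)-H^N_{m'}(P_k)\big)\Big(\frac1{\theta_{k+1}}-\frac1{\theta_k}\Big)\le0 .$$ Suppose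 that $m=N$ or that the inequality on the right holds. For $v\in\mathcal V$ and $\varepsilon\ge0$ let $v^\varepsilon$ be obtained from $v$ by adding $\varepsilon$ to $v_m$ and subtracting $\varepsilon$ from $v_{m'}$. 1. If $\alpha_m-\alpha_{m'}\ge0$ and $c$ is concave, then for every contest $v\in\mathcal V$, $\mathbb E[X]$ is differentiable at $v$, $$\frac{\partial\mathbb E[X]}{\partial v_m}-\frac{\partial\mathbb E[X]}{\partial v_{m'}}\ge0,$$ and $\mathbb E[X](v^\varepsilon)\ge\mathbb E[X](v)$ for all $\varepsilon\ge 0$ with $v^\varepsilon\in\mathcal V$. 2. If $\alpha_m-\alpha_{m'}\le0$ and $c$ is convex, then for every contest $v\in\mathcal V$, $\mathbb E[X](v^\varepsilon)\le\mathbb E[X](v)$ for all $\varepsilon\ge 0$ with $v^\varepsilon\in\mathcal V$, and $$\frac{\partial\mathbb E[X]}{\partial v_m}-\frac{\partial\mathbb E[X]}{\partial v_{m'}}\le0$$ in the following sense. (a) If $v_{m'}>0$, then $\mathbb E[X]$ is differentiable at $v$ within the set of contests $w$ such that $w_r=0$ whenever $v_r=0$ (which is all of $\mathcal V$ if $v_1>0$),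 and the inequality holds for this derivative. (b) If $\mathbb E[X]$ is differentiable at $v$ within $\mathcal V$, the inequality holds for this derivative; and it is differentiable at every $v\in\mathcal V$ if the right derivative of $c$ at $0$ is positive. -/

import Mathlib

namespace Contest

open MeasureTheory

/-- The class `𝓕` of cost functions. A cost function is a map on `[0, ∞)`; it is represented by a
function on `ℝ` whose values at negative arguments are never used. -/
structure IsCost (c : ℝ → ℝ) : Prop where
  zero : c 0 = 0
  continuousOn : ContinuousOn c (Set.Ici 0)
  differentiableAt : ∀ x, 0 < x → DifferentiableAt ℝ c x
  deriv_pos : ∀ x, 0 < x → 0 < deriv c x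
  tendsto : Filter.Tendsto c Filter.atTop Filter.atTop

/-- The set `𝓥` of contests `0 = v₀ ≤ v₁ ≤ ⋯ ≤ v_N` with `v₀ < v_N`, for `N + 1` agents. The prize
`v₀ = 0` is left out of the coordinates, so `v i` is the prize `v_{i+1}`. -/
def contests (N : ℕ) : Set (Fin N → ℝ) :=
  {v | (∀ i, 0 ≤ v i) ∧ Monotone v ∧ ∃ i, 0 < v i}

/-- The prize `v_r` of an agent who outperforms exactly `r` of the `N` other agents. -/
def prize {N : ℕ} (v : Fin N → ℝ) : ℕ → ℝ
  | 0 => 0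
  | r + 1 => if h : r < N then v ⟨r, h⟩ else 0

open Classical in
/-- The number of opponents whose effort is below `x`. -/
noncomputable def numBelow {N : ℕ} (x : ℝ) (y : Fin N → ℝ) : ℕ :=
  (Finset.univ.filter fun i => y i < x).card

open Classical in
/-- The number of opponents whose effort is exactly `x`. -/
noncomputable def numTied {N : ℕ} (x : ℝ) (y : Fin N → ℝ) : ℕ :=
  (Finset.univ.filter fun i => y i = x).card

/-- The expected prize of an agent with effort `x` when the opponents' efforts are `y`. Ties are
broken uniformly at random: with `a` opponents below and `b` tied, the agent ends up outperforming
`a, a + 1, …, a + b` opponents with equal probability. -/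
noncomputable def award {N : ℕ} (v : Fin N → ℝ) (x : ℝ) (y : Fin N → ℝ) : ℝ :=
  (∑ i ∈ Finset.range (numTied x y + 1), prize v (numBelow x y + i)) / (numTied x y + 1)

/-- The distribution of the effort of an agent whose type `k` is drawn with probability `p k` and
who, as type `k`, draws the effort from `σ k`. -/
noncomputable def effortLaw {L : ℕ} (p : Fin (L + 1) → ℝ)
    (σ : Fin (L + 1) → ProbabilityMeasure ℝ) : Measure ℝ :=
  ∑ k, ENNReal.ofReal (p k) • (σ k : Measure ℝ)

/-- The expected payoff of an agent of type `k` with effort `x`, when types are independent and each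
of the `N` opponents uses the (mixed) strategy `σ`. -/
noncomputable def payoff {N L : ℕ} (cost : Fin (L + 1) → ℝ → ℝ) (p : Fin (L + 1) → ℝ)
    (v : Fin N → ℝ) (σ : Fin (L + 1) → ProbabilityMeasure ℝ) (k : Fin (L + 1)) (x : ℝ) : ℝ :=
  (∫ y, award v x y ∂(Measure.pi fun _ : Fin N => effortLaw p σ)) - cost k x

/-- `σ` is a symmetric (mixed) Bayes–Nash equilibrium: for every type, almost every effort that the
type chooses is a nonnegative effort which maximizes the type's expected payoff. -/
def IsSymmetricEquilibrium {N L : ℕ} (cost : Fin (L + 1) → ℝ → ℝ) (p : Fin (L + 1) → ℝ)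
    (v : Fin N → ℝ) (σ : Fin (L + 1) → ProbabilityMeasure ℝ) : Prop :=
  ∀ k, ∀ᵐ x ∂(σ k : Measure ℝ),
    0 ≤ x ∧ ∀ y, 0 ≤ y → payoff cost p v σ k y ≤ payoff cost p v σ k x

/-- The symmetric equilibrium of the contest `v` (an arbitrary strategy if there is none). -/
noncomputable def equilibrium {N L : ℕ} (cost : Fin (L + 1) → ℝ → ℝ) (p : Fin (L + 1) → ℝ)
    (v : Fin N → ℝ) : Fin (L + 1) → ProbabilityMeasure ℝ :=
  Classical.epsilon fun σ => IsSymmetricEquilibrium cost p v σ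

/-- Expected equilibrium effort `𝔼[X]` of an arbitrary agent in the contest `v`. -/
noncomputable def expectedEffort {N L : ℕ} (cost : Fin (L + 1) → ℝ → ℝ) (p : Fin (L + 1) → ℝ)
    (v : Fin N → ℝ) : ℝ :=
  ∑ k, p k * ∫ x, x ∂(equilibrium cost p v k : Measure ℝ)

/-- Equilibrium utility `u_k` of type `k` in the contest `v`. -/
noncomputable def equilibriumUtility {N L : ℕ} (cost : Fin (L + 1) → ℝ → ℝ)
    (p : Fin (L + 1) → ℝ) (k : Fin (L + 1)) (v : Fin N → ℝ) : ℝ :=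
  ∫ x, payoff cost p v (equilibrium cost p v) k x ∂(equilibrium cost p v k : Measure ℝ)

/-- The derivative at `v`, in the coordinate `i`, of a function on the set `S` of contests. -/
noncomputable def partialWithin {N : ℕ} (f : (Fin N → ℝ) → ℝ) (S : Set (Fin N → ℝ))
    (v : Fin N → ℝ) (i : Fin N) : ℝ :=
  fderivWithin ℝ f S v (Pi.single i 1)

/-- The contests that have prize zero wherever `v` has prize zero. -/
def zeroFace {N : ℕ} (v : Fin N → ℝ) : Set (Fin N → ℝ) :=
  {w | w ∈ contests N ∧ ∀ i, v i = 0 → w i = 0}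

/-- Move the amount `ε` from the prize with index `i'` to the prize with index `i`. -/
noncomputable def transfer {N : ℕ} (v : Fin N → ℝ) (i' i : Fin N) (ε : ℝ) : Fin N → ℝ :=
  v + ε • (Pi.single i 1 - Pi.single i' 1)

/-- `P_k`, the probability that an agent has one of the types up to `k`. -/
noncomputable def cumProb {L : ℕ} (p : Fin (L + 1) → ℝ) (k : Fin (L + 1)) : ℝ :=
  ∑ j ∈ Finset.Iic k, p j

/-- `H^n_m(t)`, the probability of exactly `m` successes in `n` trials of success rate `t`. -/
noncomputable def binom (n m : ℕ) (t : ℝ) : ℝ :=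
  (n.choose m : ℝ) * t ^ m * (1 - t) ^ (n - m)

/-- `H^n_{≥ m}(t)`, the probability of at least `m` successes. -/
noncomputable def binomTail (n m : ℕ) (t : ℝ) : ℝ :=
  ∑ i ∈ Finset.Icc m n, binom n i t

/-- The marginal effect `α_m` of prize `m` on expected effort under linear costs `θ_k x`. -/
noncomputable def alpha (N : ℕ) {L : ℕ} (θ p : Fin (L + 1) → ℝ) (m : ℕ) : ℝ :=
  1 / ((N : ℝ) + 1) * (1 / θ (Fin.last L) -
    ∑ k : Fin L,
      (binomTail (N + 1) m (cumProb p k.castSucc)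
        + ((N : ℝ) - m) * binom (N + 1) m (cumProb p k.castSucc))
      * (1 / θ k.succ - 1 / θ k.castSucc))

/-- `∑_{k<K} (H^N_m(P_k) - H^N_{m'}(P_k)) (1/θ_{k+1} - 1/θ_k)`. -/
noncomputable def utilityShift (N : ℕ) {L : ℕ} (θ p : Fin (L + 1) → ℝ) (m' m : ℕ) : ℝ :=
  ∑ k : Fin L, (binom N m (cumProb p k.castSucc) - binom N m' (cumProb p k.castSucc))
    * (1 / θ k.succ - 1 / θ k.castSucc)

end Contest

/-! ### Type intervals on the quantile scale, and increments weighted by inverse cost factors. -/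

namespace Contest

open MeasureTheory

/-! Everything is expressed through the quantile `t` of the effort distribution of a random agent.
In equilibrium this distribution has no atoms and no gaps, and more efficient types exert more
effort, so type `k` occupies the quantiles between `cut p k` and `cut p (k + 1)`. An agent at
quantile `t` beats each opponent independently with probability `t` and expects the prize `curve v
t`, a combination of binomial probabilities. Type `k` is indifferent on its interval, so there the
cost `c` of effort grows at `1 / θ k` times the rate of `curve v`. Hence the cost at quantile `t` is
`costCurve θ p v t`, which is linear in `v`, and this determines the equilibrium
(`IsSymmetricEquilibrium.unique`, `isSymmetricEquilibrium_strategy`). Expected effort is the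
integral of `invCost c` of this cost (`expectedEffort_eq`). The utility of the most efficient type
is linear in `v`, and summation by parts turns its coefficients into those of `utilityShift`. For
linear cost the same computation gives `alpha` (`integral_sweep_binom`).

Moving `ε` from prize `m'` to prize `m` changes the cost at quantile `t` by `ε` times the sweep of
`H_m - H_{m'}`. This difference falls, rises and falls again, and sweeping with positive weights
keeps that pattern. The assumption on `m` makes the last fall either absent or end at a nonnegative
value, so the change of cost crosses zero once, from below (`exists_crossing_sweep`). The transfer
therefore pushes low efforts down and high efforts up, away from the effort `x₀` at the crossing.
For concave `c` and such movements, the change of cost is at most `c'(x₀)` times the change of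
effort; for convex `c` it is at least that. Integrating over `t` compares `ε (α_m - α_{m'})` with
`c'(x₀)` times the change of expected effort, which settles finite transfers.

Differentiability comes from dominated differentiation of the integral. If `c` is concave, or convex
with positive slope at zero, `invCost c` is Lipschitz on bounded intervals of costs. For other
convex `c` it may be infinitely steep at zero; perturbations that keep zero prizes at zero change
the cost by at most a fixed proportion of itself, and this compensates the steepness
(`differentiableWithinAt_zeroFace`). The inequalities between partial derivatives then follow from
those for finite transfers, by comparing two directions that both point into the set of contests. -/

/-- `cut p n` is the total probability of the first `n` types. -/
noncomputable def cut {L : ℕ} (p : Fin (L + 1) → ℝ) (n : ℕ) : ℝ :=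
  ∑ j : Fin (L + 1), if (j : ℕ) < n then p j else 0

section Cut

variable {L : ℕ} {p : Fin (L + 1) → ℝ}

lemma cut_zero (p : Fin (L + 1) → ℝ) : cut p 0 = 0 := by simp [cut]

lemma cut_succ (p : Fin (L + 1) → ℝ) (k : Fin (L + 1)) : cut p (k + 1) = cut p k + p k := by
  have h : ∀ j : Fin (L + 1), (if (j : ℕ) < (k : ℕ) + 1 then p j else 0)
      = (if (j : ℕ) < (k : ℕ) then p j else 0) + if j = k then p j else 0 := by
    intro j
    rcases lt_trichotomy j k with h | h | h
    · simp [h.ne, Fin.lt_def.1 h, Nat.lt_succ_of_lt (Fin.lt_def.1 h)]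
    · simp [h]
    · have h1 := Fin.lt_def.1 h
      have h2 : ¬ (j : ℕ) < (k : ℕ) + 1 := by omega
      have h3 : ¬ (j : ℕ) < (k : ℕ) := by omega
      simp only [h2, h3, h.ne', if_false, add_zero]
  simp only [cut]
  rw [Finset.sum_congr rfl fun j _ => h j, Finset.sum_add_distrib]
  simp

lemma cut_last (hp : ∑ k, p k = 1) : cut p (L + 1) = 1 := by
  refine Eq.trans ?_ hp
  exact Finset.sum_congr rfl fun j _ => if_pos j.2

lemma cumProb_eq_cut (p : Fin (L + 1) → ℝ) (k : Fin (L + 1)) : cumProb p k = cut p (k + 1) := by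
  rw [cumProb, cut, ← Finset.sum_filter]
  refine Finset.sum_congr (Finset.ext fun j => ?_) fun _ _ => rfl
  rw [Finset.mem_Iic, Finset.mem_filter, Fin.le_def, Nat.lt_succ_iff]
  exact ⟨fun h => ⟨Finset.mem_univ _, h⟩, fun h => h.2⟩

lemma cut_mono (hp : ∀ k, 0 < p k) : Monotone (cut p) := by
  intro a b hab
  refine Finset.sum_le_sum fun j _ => ?_
  split_ifs with h1 h2
  · exact le_rfl
  · omega
  · exact (hp j).le
  · exact le_rfl

lemma cut_nonneg (hp : ∀ k, 0 < p k) (n : ℕ) : 0 ≤ cut p n :=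
  cut_zero p ▸ cut_mono hp (Nat.zero_le n)

lemma cut_le_one (hp : ∀ k, 0 < p k) (hs : ∑ k, p k = 1) {n : ℕ} (hn : n ≤ L + 1) :
    cut p n ≤ 1 :=
  cut_last hs ▸ cut_mono hp hn

lemma cut_lt_succ (hp : ∀ k, 0 < p k) (k : Fin (L + 1)) : cut p k < cut p (k + 1) := by
  rw [cut_succ]; linarith [hp k]

/-- Every level below one lies in the interval of exactly one type. -/
lemma exists_mem_Ico_cut (hs : ∑ k, p k = 1) {t : ℝ} (h0 : 0 ≤ t) (h1 : t < 1) :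
    ∃ k : Fin (L + 1), cut p k ≤ t ∧ t < cut p (k + 1) := by
  classical
  have hex : ∃ n, t < cut p (n + 1) := ⟨L, by rwa [cut_last hs]⟩
  have hle : Nat.find hex ≤ L := Nat.find_min' hex (by rwa [cut_last hs])
  refine ⟨⟨Nat.find hex, by omega⟩, ?_, Nat.find_spec hex⟩
  rcases Nat.eq_zero_or_pos (Nat.find hex) with h | h
  · simpa [h, cut_zero] using h0
  · have := Nat.find_min hex (Nat.sub_one_lt_of_lt h)
    rw [Nat.sub_add_cancel h] at this
    exact not_lt.1 this

end Cut

/-- The increments of `h` on `[0, t]`, where those on the interval of type `j` are weighted by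
`1 / θ j`. -/
noncomputable def sweep {L : ℕ} (θ p : Fin (L + 1) → ℝ) (h : ℝ → ℝ) (t : ℝ) : ℝ :=
  ∑ j : Fin (L + 1), 1 / θ j * (h (min t (cut p (j + 1))) - h (min t (cut p j)))

section Sweep

variable {L : ℕ} {θ p : Fin (L + 1) → ℝ} {h : ℝ → ℝ}

lemma sweep_mul (a : ℝ) (h : ℝ → ℝ) (t : ℝ) :
    sweep θ p (fun x => a * h x) t = a * sweep θ p h t := by
  simp only [sweep, Finset.mul_sum]
  exact Finset.sum_congr rfl fun _ _ => by ring

lemma sweep_sub (h₁ h₂ : ℝ → ℝ) (t : ℝ) :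
    sweep θ p (fun x => h₁ x - h₂ x) t = sweep θ p h₁ t - sweep θ p h₂ t := by
  simp only [sweep, ← Finset.sum_sub_distrib]
  exact Finset.sum_congr rfl fun _ _ => by ring

lemma sweep_neg (h : ℝ → ℝ) (t : ℝ) : sweep θ p (fun x => -h x) t = -sweep θ p h t := by
  simpa using sweep_mul (θ := θ) (p := p) (-1) h t

lemma sweep_sum {ι : Type*} (s : Finset ι) (f : ι → ℝ → ℝ) (t : ℝ) :
    sweep θ p (fun x => ∑ i ∈ s, f i x) t = ∑ i ∈ s, sweep θ p (f i) t := by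
  simp only [sweep, ← Finset.sum_sub_distrib, Finset.mul_sum]
  exact Finset.sum_comm

lemma continuous_sweep (hh : Continuous h) : Continuous (sweep θ p h) := by
  unfold sweep
  fun_prop

lemma sweep_zero (hp : ∀ k, 0 < p k) : sweep θ p h 0 = 0 := by
  refine Finset.sum_eq_zero fun j _ => ?_
  rw [min_eq_left (cut_nonneg hp _), min_eq_left (cut_nonneg hp _)]
  ring

/-- Summation by parts over the types. -/
lemma sum_by_parts (L : ℕ) (w : Fin (L + 1) → ℝ) (a : ℕ → ℝ) :
    ∑ j : Fin (L + 1), w j * (a (j + 1) - a j)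
      = w (Fin.last L) * a (L + 1) - w 0 * a 0
        - ∑ k : Fin L, a (k + 1) * (w k.succ - w k.castSucc) := by
  induction L with
  | zero => simp; ring
  | succ L ih =>
    rw [Fin.sum_univ_castSucc,
      Fin.sum_univ_castSucc fun k : Fin (L + 1) => a (k + 1) * (w k.succ - w k.castSucc)]
    have := ih (fun j => w j.castSucc)
    simp only [Fin.val_castSucc, Fin.val_last, Fin.castSucc_zero, Fin.succ_last,
      Fin.succ_castSucc] at this ⊢
    rw [this]
    ring

/-- Summation by parts moves the weights onto the differences `1 / θ k.succ - 1 / θ k.castSucc`, the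
form in which `alpha` and `utilityShift` are given. -/
lemma sweep_eq (hs : ∑ k, p k = 1) {t : ℝ} (h0 : 0 ≤ t) (h1 : t ≤ 1) (hh : h 0 = 0) :
    sweep θ p h t = 1 / θ (Fin.last L) * h t
      - ∑ k : Fin L, h (min t (cumProb p k.castSucc)) * (1 / θ k.succ - 1 / θ k.castSucc) := by
  have := sum_by_parts L (fun j => 1 / θ j) (fun n => h (min t (cut p n)))
  simp only [cut_zero, min_eq_right h0, hh, cut_last hs, min_eq_left h1, mul_zero,
    sub_zero] at this
  simpa only [sweep, cumProb_eq_cut, Fin.val_castSucc] using this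

/-- Clamping `t` to the interval of type `j` leaves a subtracted term that is free of `t`, so it
cancels when two quantiles are compared. -/
lemma min_cut_sub (hp : ∀ k, 0 < p k) (h : ℝ → ℝ) (t : ℝ) (j : ℕ) :
    h (min t (cut p (j + 1))) - h (min t (cut p j))
      = h (max (cut p j) (min t (cut p (j + 1)))) - h (cut p j) := by
  have hc := cut_mono hp (Nat.le_succ j)
  rcases le_total t (cut p j) with ht | ht
  · rw [min_eq_left ht, min_eq_left (ht.trans hc), max_eq_left ht]
    ring
  · rw [min_eq_right ht, max_eq_right (le_min ht hc)]

lemma sweep_sub_eq (hp : ∀ k, 0 < p k) (s t : ℝ) :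
    sweep θ p h t - sweep θ p h s = ∑ j : Fin (L + 1), 1 / θ j *
      (h (max (cut p j) (min t (cut p (j + 1)))) - h (max (cut p j) (min s (cut p (j + 1))))) := by
  simp only [sweep, ← Finset.sum_sub_distrib]
  refine Finset.sum_congr rfl fun j _ => ?_
  rw [min_cut_sub hp, min_cut_sub hp]
  ring

lemma sum_increments (hp : ∀ k, 0 < p k) (hs : ∑ k, p k = 1) {s t : ℝ}
    (hs' : s ∈ Set.Icc (0 : ℝ) 1) (ht : t ∈ Set.Icc (0 : ℝ) 1) :
    ∑ j : Fin (L + 1),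
      (h (max (cut p j) (min t (cut p (j + 1)))) - h (max (cut p j) (min s (cut p (j + 1)))))
      = h t - h s := by
  have key : ∀ u ∈ Set.Icc (0 : ℝ) 1, ∑ j : Fin (L + 1),
      (h (min u (cut p (j + 1))) - h (min u (cut p j))) = h u - h 0 := by
    intro u hu
    have := sum_by_parts L (fun _ => 1) (fun n => h (min u (cut p n)))
    simpa [cut_zero, cut_last hs, hu.1, hu.2] using this
  have h3 : h t - h s = (h t - h 0) - (h s - h 0) := by ring
  rw [h3, ← key t ht, ← key s hs', ← Finset.sum_sub_distrib]
  refine Finset.sum_congr rfl fun j _ => ?_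
  rw [min_cut_sub hp, min_cut_sub hp]
  ring

/-- A clamped point may leave `[a, b]`, where nothing is known about `h`, but in those cases the two
clamped points coincide. -/
lemma increment_nonneg (hp : ∀ k, 0 < p k) {a b s t : ℝ} (hm : MonotoneOn h (Set.Icc a b))
    (has : a ≤ s) (hst : s ≤ t) (htb : t ≤ b) (j : ℕ) :
    h (max (cut p j) (min s (cut p (j + 1)))) ≤ h (max (cut p j) (min t (cut p (j + 1)))) := by
  have hc := cut_mono hp (Nat.le_succ j)
  rcases le_total (cut p (j + 1)) s with h1 | h1
  · rw [min_eq_right h1, min_eq_right (h1.trans hst)]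
  rcases le_total t (cut p j) with h2 | h2
  · rw [max_eq_left ((min_le_left _ _).trans h2),
      max_eq_left ((min_le_left _ _).trans (hst.trans h2))]
  rw [min_eq_left h1, max_eq_right (le_min h2 hc)]
  refine hm ⟨has.trans (le_max_right _ _), max_le (h2.trans htb) (hst.trans htb)⟩
    ⟨le_min (has.trans hst) (has.trans h1), (min_le_left _ _).trans htb⟩
    (max_le (le_min h2 hc) (le_min hst h1))

lemma one_div_nonneg_of_pos (hθ : ∀ k, 0 < θ k) (k : Fin (L + 1)) : 0 ≤ 1 / θ k :=
  (one_div_pos.2 (hθ k)).le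

lemma monotoneOn_sweep (hθ : ∀ k, 0 < θ k) (hp : ∀ k, 0 < p k) {a b : ℝ}
    (hm : MonotoneOn h (Set.Icc a b)) : MonotoneOn (sweep θ p h) (Set.Icc a b) := by
  intro s hs t ht hst
  rw [← sub_nonneg, sweep_sub_eq hp]
  exact Finset.sum_nonneg fun j _ => mul_nonneg (one_div_nonneg_of_pos hθ j)
    (sub_nonneg.2 (increment_nonneg hp hm hs.1 hst ht.2 j))

lemma antitoneOn_sweep (hθ : ∀ k, 0 < θ k) (hp : ∀ k, 0 < p k) {a b : ℝ}
    (hm : AntitoneOn h (Set.Icc a b)) : AntitoneOn (sweep θ p h) (Set.Icc a b) := by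
  intro s hs t ht hst
  have := monotoneOn_sweep hθ hp (h := fun x => -h x) hm.neg hs ht hst
  rw [sweep_neg, sweep_neg] at this
  linarith

/-- To the right of `cut p k` only types `j ≥ k` contribute, and their weights are at least `1 / θ
k`. Together with the mirror image `sweep_sub_le` this is an equality on the interval of type `k`:
the indifference condition. -/
lemma le_sweep_sub (hθ : ∀ k, 0 < θ k) (hanti : StrictAnti θ) (hp : ∀ k, 0 < p k)
    (hs : ∑ k, p k = 1) (hm : MonotoneOn h (Set.Icc 0 1)) (k : Fin (L + 1)) {s t : ℝ}
    (hks : cut p k ≤ s) (hst : s ≤ t) (ht : t ≤ 1) :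
    1 / θ k * (h t - h s) ≤ sweep θ p h t - sweep θ p h s := by
  have h0 : 0 ≤ s := (cut_nonneg hp _).trans hks
  rw [sweep_sub_eq hp, ← sum_increments (h := h) hp hs ⟨h0, hst.trans ht⟩ ⟨h0.trans hst, ht⟩,
    Finset.mul_sum]
  refine Finset.sum_le_sum fun j _ => ?_
  rcases lt_or_ge j k with hjk | hjk
  · have h1 : cut p (j + 1) ≤ s := (cut_mono hp (Nat.succ_le_of_lt (Fin.lt_def.1 hjk))).trans hks
    rw [min_eq_right h1, min_eq_right (h1.trans hst)]
    simp
  · exact mul_le_mul_of_nonneg_right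
      (one_div_le_one_div_of_le (hθ j) (hanti.antitone hjk))
      (sub_nonneg.2 (increment_nonneg hp hm h0 hst ht j))

lemma sweep_sub_le (hθ : ∀ k, 0 < θ k) (hanti : StrictAnti θ) (hp : ∀ k, 0 < p k)
    (hs : ∑ k, p k = 1) (hm : MonotoneOn h (Set.Icc 0 1)) (k : Fin (L + 1)) {s t : ℝ}
    (h0 : 0 ≤ s) (hst : s ≤ t) (ht : t ≤ cut p (k + 1)) :
    sweep θ p h t - sweep θ p h s ≤ 1 / θ k * (h t - h s) := by
  have h1 : t ≤ 1 := ht.trans (cut_le_one hp hs (by omega))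
  rw [sweep_sub_eq hp, ← sum_increments (h := h) hp hs ⟨h0, hst.trans h1⟩ ⟨h0.trans hst, h1⟩,
    Finset.mul_sum]
  refine Finset.sum_le_sum fun j _ => ?_
  rcases lt_or_ge k j with hjk | hjk
  · have h2 : t ≤ cut p j := ht.trans (cut_mono hp (Nat.succ_le_of_lt (Fin.lt_def.1 hjk)))
    rw [max_eq_left ((min_le_left _ _).trans h2),
      max_eq_left ((min_le_left _ _).trans (hst.trans h2))]
    simp
  · exact mul_le_mul_of_nonneg_right
      (one_div_le_one_div_of_le (hθ k) (hanti.antitone hjk))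
      (sub_nonneg.2 (increment_nonneg hp hm h0 hst h1 j))

lemma strictMonoOn_sweep (hθ : ∀ k, 0 < θ k) (hanti : StrictAnti θ) (hp : ∀ k, 0 < p k)
    (hs : ∑ k, p k = 1) (hm : StrictMonoOn h (Set.Icc 0 1)) :
    StrictMonoOn (sweep θ p h) (Set.Icc 0 1) := by
  intro s hs' t ht hst
  have h1 := le_sweep_sub hθ hanti hp hs hm.monotoneOn 0 (by simpa [cut_zero] using hs'.1)
    hst.le ht.2
  have h2 : 0 < 1 / θ 0 * (h t - h s) :=
    mul_pos (one_div_pos.2 (hθ 0)) (sub_pos.2 (hm hs' ht hst))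
  linarith

/-- Type `k`'s payoff `h - θ k * sweep h` is maximal on the interval of type `k`. -/
lemma sub_mul_sweep_le (hθ : ∀ k, 0 < θ k) (hanti : StrictAnti θ) (hp : ∀ k, 0 < p k)
    (hs : ∑ k, p k = 1) (hm : MonotoneOn h (Set.Icc 0 1)) (k : Fin (L + 1)) {s t : ℝ}
    (hks : cut p k ≤ s) (hsk : s ≤ cut p (k + 1)) (ht : t ∈ Set.Icc (0 : ℝ) 1) :
    h t - θ k * sweep θ p h t ≤ h s - θ k * sweep θ p h s := by
  have hk := hθ k
  have e : θ k * (1 / θ k * (h t - h s)) = h t - h s := by field_simp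
  rcases le_total s t with hst | hst
  · have := mul_le_mul_of_nonneg_left (le_sweep_sub hθ hanti hp hs hm k hks hst ht.2) hk.le
    rw [e] at this
    linarith
  · have := mul_le_mul_of_nonneg_left (sweep_sub_le hθ hanti hp hs hm k ht.1 hst hsk) hk.le
    have e' : θ k * (1 / θ k * (h s - h t)) = h s - h t := by field_simp
    rw [e'] at this
    linarith

end Sweep

end Contest

/-! ### Binomial probabilities: integrals and the single crossing. -/

namespace Contest

open MeasureTheory

section Binom

lemma continuous_binom (n m : ℕ) : Continuous (binom n m) := by
  unfold binom
  fun_prop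

lemma binom_eq_eval (n m : ℕ) (t : ℝ) : binom n m t = (bernsteinPolynomial ℝ n m).eval t := by
  simp [binom, bernsteinPolynomial]

lemma binom_nonneg (n m : ℕ) {t : ℝ} (ht : t ∈ Set.Icc (0 : ℝ) 1) : 0 ≤ binom n m t :=
  mul_nonneg (mul_nonneg (Nat.cast_nonneg _) (pow_nonneg ht.1 _))
    (pow_nonneg (sub_nonneg.2 ht.2) _)

lemma binom_eq_zero_of_lt {n m : ℕ} (h : n < m) (t : ℝ) : binom n m t = 0 := by
  simp [binom, Nat.choose_eq_zero_of_lt h]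

lemma binom_succ_zero (n m : ℕ) : binom n (m + 1) 0 = 0 := by simp [binom]

lemma binom_one (n m : ℕ) : binom n m 1 = if m = n then 1 else 0 := by
  rw [binom_eq_eval, bernsteinPolynomial.eval_at_1]

lemma hasDerivAt_binom_succ (n m : ℕ) (t : ℝ) :
    HasDerivAt (binom (n + 1) (m + 1)) (((n : ℝ) + 1) * (binom n m t - binom n (m + 1) t)) t := by
  have h := (bernsteinPolynomial ℝ (n + 1) (m + 1)).hasDerivAt t
  rw [bernsteinPolynomial.derivative_succ_aux] at h
  have e : binom (n + 1) (m + 1) = fun x => (bernsteinPolynomial ℝ (n + 1) (m + 1)).eval x :=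
    funext fun x => binom_eq_eval _ _ x
  rw [e, binom_eq_eval, binom_eq_eval]
  simpa using h

/-- The derivatives of the summands telescope, and the upper boundary term vanishes. -/
lemma hasDerivAt_binomTail (n m : ℕ) (t : ℝ) :
    HasDerivAt (binomTail (n + 1) (m + 1)) (((n : ℝ) + 1) * binom n m t) t := by
  rcases lt_or_ge n m with hnm | hnm
  · have : binomTail (n + 1) (m + 1) = fun _ => 0 := by
      funext x
      rw [binomTail, Finset.Icc_eq_empty (by omega), Finset.sum_empty]
    rw [this, binom_eq_zero_of_lt hnm, mul_zero]
    exact hasDerivAt_const t 0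
  have e : binomTail (n + 1) (m + 1)
      = fun x => ∑ i ∈ Finset.Ico m (n + 1), binom (n + 1) (i + 1) x := by
    funext x
    rw [binomTail, Finset.sum_Ico_add' (fun i => binom (n + 1) i x) m (n + 1) 1]
    rfl
  rw [e]
  have := HasDerivAt.fun_sum fun i (_ : i ∈ Finset.Ico m (n + 1)) => hasDerivAt_binom_succ n i t
  have h1 := Finset.sum_Ico_sub (fun i => binom n i t) (m := m) (n := n + 1) (by omega)
  rw [binom_eq_zero_of_lt (Nat.lt_succ_self n), zero_sub] at h1
  have h2 : ∑ i ∈ Finset.Ico m (n + 1), ((n : ℝ) + 1) * (binom n i t - binom n (i + 1) t)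
      = ((n : ℝ) + 1) * binom n m t := by
    rw [← Finset.mul_sum, ← neg_neg (binom n m t), ← h1, ← Finset.sum_neg_distrib]
    exact congrArg _ (Finset.sum_congr rfl fun _ _ => by ring)
  rwa [h2] at this

lemma binomTail_zero (n m : ℕ) : binomTail n (m + 1) 0 = 0 := by
  refine Finset.sum_eq_zero fun i hi => ?_
  obtain ⟨j, rfl⟩ : ∃ j, i = j + 1 := ⟨i - 1, by have := (Finset.mem_Icc.1 hi).1; omega⟩
  exact binom_succ_zero n j

lemma binomTail_one {n m : ℕ} (h : m ≤ n) : binomTail n m 1 = 1 := by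
  simp [binomTail, binom_one, h]

lemma integral_binom (n m : ℕ) (x : ℝ) :
    ∫ t in (0 : ℝ)..x, binom n m t = 1 / ((n : ℝ) + 1) * binomTail (n + 1) (m + 1) x := by
  have hn : (n : ℝ) + 1 ≠ 0 := by positivity
  have h := intervalIntegral.integral_eq_sub_of_hasDerivAt (a := 0) (b := x)
    (fun t _ => hasDerivAt_binomTail n m t)
    ((continuous_const.mul (continuous_binom n m)).intervalIntegrable _ _)
  rw [intervalIntegral.integral_const_mul, binomTail_zero, sub_zero] at h
  rw [← h]
  field_simp

lemma integral_comp_min {h : ℝ → ℝ} (hh : Continuous h) {a : ℝ} (h0 : 0 ≤ a) (h1 : a ≤ 1) :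
    ∫ t in (0 : ℝ)..1, h (min t a) = (∫ t in (0 : ℝ)..a, h t) + (1 - a) * h a := by
  have hc : Continuous fun t => h (min t a) := by fun_prop
  rw [← intervalIntegral.integral_add_adjacent_intervals (b := a)
    (hc.intervalIntegrable _ _) (hc.intervalIntegrable _ _)]
  congr 1
  · refine intervalIntegral.integral_congr fun t ht => ?_
    rw [Set.uIcc_of_le h0] at ht
    simp only [min_eq_left ht.2]
  · have : ∫ t in a..1, h (min t a) = ∫ t in a..1, h a := by
      refine intervalIntegral.integral_congr fun t ht => ?_
      rw [Set.uIcc_of_le h1] at ht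
      simp only [min_eq_right ht.1]
    rw [this]
    simp

/-- Source of the coefficients of `alpha`: the part below `a` gives the tail from `m + 1`, and the
constant part `(1 - a) H^N_m(a)` is a multiple of `H^{N+1}_m(a)`. -/
lemma integral_binom_min {N m : ℕ} (hm : m ≤ N) {a : ℝ} (h0 : 0 ≤ a) (h1 : a ≤ 1) :
    ∫ t in (0 : ℝ)..1, binom N m (min t a)
      = 1 / ((N : ℝ) + 1) * (binomTail (N + 1) m a + ((N : ℝ) - m) * binom (N + 1) m a) := by
  have hN : (N : ℝ) + 1 ≠ 0 := by positivity
  have h3 : binomTail (N + 1) m a = binom (N + 1) m a + binomTail (N + 1) (m + 1) a := by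
    rw [binomTail, binomTail, ← Finset.insert_Icc_add_one_left_eq_Icc (by omega),
      Finset.sum_insert (by simp)]
  have h4 : (1 - a) * binom N m a = ((N : ℝ) + 1 - m) / (N + 1) * binom (N + 1) m a := by
    have h5 : ((N.choose m * (N + 1) : ℕ) : ℝ) = ((N + 1).choose m * (N + 1 - m) : ℕ) :=
      congrArg _ (Nat.choose_mul_succ_eq N m)
    obtain ⟨d, rfl⟩ := Nat.exists_eq_add_of_le hm
    have h6 : m + d + 1 - m = d + 1 := by omega
    rw [h6] at h5
    rw [binom, binom, h6, Nat.add_sub_cancel_left]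
    push_cast at h5 hN ⊢
    field_simp
    linear_combination a ^ m * (1 - a) ^ (d + 1) * h5
  rw [integral_comp_min (continuous_binom N m) h0 h1, integral_binom, h4, h3]
  field_simp
  ring

lemma integral_sweep_binom {L : ℕ} {θ p : Fin (L + 1) → ℝ} (hp : ∀ k, 0 < p k)
    (hs : ∑ k, p k = 1) {N m : ℕ} (hm : m + 1 ≤ N) :
    ∫ t in (0 : ℝ)..1, sweep θ p (binom N (m + 1)) t = alpha N θ p (m + 1) := by
  have h1 : ∫ t in (0 : ℝ)..1, sweep θ p (binom N (m + 1)) t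
      = ∫ t in (0 : ℝ)..1, (1 / θ (Fin.last L) * binom N (m + 1) t
        - ∑ k : Fin L, binom N (m + 1) (min t (cumProb p k.castSucc))
          * (1 / θ k.succ - 1 / θ k.castSucc)) := by
    refine intervalIntegral.integral_congr fun t ht => ?_
    rw [Set.uIcc_of_le zero_le_one] at ht
    exact sweep_eq hs ht.1 ht.2 (binom_succ_zero N m)
  have hb := continuous_binom N (m + 1)
  rw [h1, intervalIntegral.integral_sub (by apply Continuous.intervalIntegrable; fun_prop)
      (by apply Continuous.intervalIntegrable; fun_prop),
    intervalIntegral.integral_finsetSum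
      fun k _ => by apply Continuous.intervalIntegrable; fun_prop,
    intervalIntegral.integral_const_mul, integral_binom, binomTail_one (by omega), alpha, mul_sub,
    Finset.mul_sum]
  congr 1
  · ring
  · refine Finset.sum_congr rfl fun k _ => ?_
    rw [intervalIntegral.integral_mul_const, integral_binom_min hm
      (by rw [cumProb_eq_cut]; exact cut_nonneg hp _)
      (by rw [cumProb_eq_cut]; exact cut_le_one hp hs (by simp)), mul_assoc]

end Binom

section Crossing

lemma hasDerivAt_binom {n m : ℕ} (hm : m ≤ n) {t : ℝ} (h0 : 0 < t) (h1 : t < 1) :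
    HasDerivAt (binom n m) (binom n m t * (m - n * t) / (t * (1 - t))) t := by
  have h := (((hasDerivAt_id' t).pow m).const_mul (n.choose m : ℝ)).mul
    (((hasDerivAt_id' t).const_sub 1).pow (n - m))
  refine h.congr_deriv ?_
  obtain ⟨d, rfl⟩ := Nat.exists_eq_add_of_le hm
  have h2 : 1 - t ≠ 0 := by linarith
  rw [Nat.add_sub_cancel_left, binom, Nat.add_sub_cancel_left]
  simp only [Pi.pow_apply]
  -- The derivatives of the two powers contain truncated exponents, so zero exponents are treated
  -- apart.
  rcases m with _ | m <;> rcases d with _ | d <;> push_cast <;> field_simp <;> ring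

/-- The sign of the derivative of `binom N (m + e) - binom N m` on `(0, 1)`. -/
noncomputable def slopeSign (N m e : ℕ) (t : ℝ) : ℝ :=
  (N.choose (m + e) : ℝ) * t ^ e * ((m + e : ℕ) - N * t)
    + (N.choose m : ℝ) * (1 - t) ^ e * (N * t - m)

lemma continuous_slopeSign (N m e : ℕ) : Continuous (slopeSign N m e) := by
  unfold slopeSign
  fun_prop

lemma hasDerivAt_binom_sub {N m e : ℕ} (h : m + e ≤ N) {t : ℝ} (h0 : 0 < t) (h1 : t < 1) :
    HasDerivAt (fun t => binom N (m + e) t - binom N m t)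
      (t ^ m * (1 - t) ^ (N - (m + e)) / (t * (1 - t)) * slopeSign N m e t) t := by
  refine ((hasDerivAt_binom h h0 h1).sub
    (hasDerivAt_binom ((Nat.le_add_right m e).trans h) h0 h1)).congr_deriv ?_
  obtain ⟨d, rfl⟩ := Nat.exists_eq_add_of_le h
  have h2 : m + e + d - m = e + d := by omega
  rw [slopeSign, binom, binom, Nat.add_sub_cancel_left, h2]
  ring

/-- Left of `m / N` the sign is that of `C(N, m + e) (t / (1 - t))^e (m + e - N t) / (m - N t) -
C(N, m)`, which increases in `t`, so once nonnegative it stays so. The proof clears the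
denominators; `k3`, `k4` and `k5` are the monotone factors. -/
lemma slopeSign_nonneg_of_le {N m e : ℕ} {s t : ℝ} (h0 : 0 ≤ s) (hst : s ≤ t)
    (ht1 : t ≤ 1) (ht : N * t < m) (h : 0 ≤ slopeSign N m e s) : 0 ≤ slopeSign N m e t := by
  unfold slopeSign at h ⊢
  have hu : s ^ e ≤ t ^ e := pow_le_pow_left₀ h0 hst e
  have hw : (1 - t) ^ e ≤ (1 - s) ^ e := pow_le_pow_left₀ (by linarith) (by linarith) e
  have hu0 : 0 ≤ t ^ e := pow_nonneg (h0.trans hst) e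
  have hN : (N : ℝ) * s ≤ N * t := mul_le_mul_of_nonneg_left hst (Nat.cast_nonneg N)
  have hE : (0 : ℝ) ≤ e := Nat.cast_nonneg e
  have hC1 : (0 : ℝ) ≤ N.choose (m + e) := Nat.cast_nonneg _
  have hC2 : (0 : ℝ) ≤ N.choose m := Nat.cast_nonneg _
  push_cast at h ⊢
  generalize s ^ e = u at *
  generalize t ^ e = u' at *
  generalize (1 - s) ^ e = w at *
  generalize (1 - t) ^ e = w' at *
  generalize (N.choose (m + e) : ℝ) = C1 at *
  generalize (N.choose m : ℝ) = C2 at *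
  by_contra! hlt
  have hx : (0 : ℝ) < m - N * s := by linarith
  have hy : (0 : ℝ) < m - N * t := by linarith
  have k1 := mul_lt_mul_of_pos_right hlt hx
  have k2 := mul_nonneg h hy.le
  have k3 : 0 ≤ C2 * (w - w') * ((m - N * s) * (m - N * t)) :=
    mul_nonneg (mul_nonneg hC2 (sub_nonneg.2 hw)) (mul_pos hx hy).le
  have k4 : 0 ≤ C1 * (u' - u) * ((m + e - N * s) * (m - N * t)) :=
    mul_nonneg (mul_nonneg hC1 (sub_nonneg.2 hu)) (mul_nonneg (by linarith) hy.le)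
  have k5 : 0 ≤ C1 * u' * (e * (N * t - N * s)) :=
    mul_nonneg (mul_nonneg hC1 hu0) (mul_nonneg hE (by linarith))
  linarith

/-- Right of `(m + e) / N` the sign is that of `C(N, m) - C(N, m + e) (t / (1 - t))^e (N t - m - e)
/ (N t - m)`, which decreases in `t`, so nonnegativity passes to the left. -/
lemma slopeSign_nonneg_of_ge {N m e : ℕ} {s t : ℝ} (h0 : 0 ≤ s) (hst : s ≤ t)
    (ht1 : t ≤ 1) (hs : (m + e : ℕ) < N * s) (h : 0 ≤ slopeSign N m e t) :
    0 ≤ slopeSign N m e s := by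
  unfold slopeSign at h ⊢
  have hu : s ^ e ≤ t ^ e := pow_le_pow_left₀ h0 hst e
  have hw : (1 - t) ^ e ≤ (1 - s) ^ e := pow_le_pow_left₀ (by linarith) (by linarith) e
  have hu0 : 0 ≤ s ^ e := pow_nonneg h0 e
  have hN : (N : ℝ) * s ≤ N * t := mul_le_mul_of_nonneg_left hst (Nat.cast_nonneg N)
  have hE : (0 : ℝ) ≤ e := Nat.cast_nonneg e
  have hC1 : (0 : ℝ) ≤ N.choose (m + e) := Nat.cast_nonneg _
  have hC2 : (0 : ℝ) ≤ N.choose m := Nat.cast_nonneg _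
  push_cast at h hs ⊢
  generalize s ^ e = u at *
  generalize t ^ e = u' at *
  generalize (1 - s) ^ e = w at *
  generalize (1 - t) ^ e = w' at *
  generalize (N.choose (m + e) : ℝ) = C1 at *
  generalize (N.choose m : ℝ) = C2 at *
  by_contra! hlt
  have hx : (0 : ℝ) < N * t - m := by linarith
  have hy : (0 : ℝ) < N * s - m := by linarith
  have k1 := mul_lt_mul_of_pos_right hlt hx
  have k2 := mul_nonneg h hy.le
  have k3 : 0 ≤ C2 * (w - w') * ((N * s - m) * (N * t - m)) :=
    mul_nonneg (mul_nonneg hC2 (sub_nonneg.2 hw)) (mul_pos hy hx).le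
  have k4 : 0 ≤ C1 * (u' - u) * ((N * t - m - e) * (N * s - m)) :=
    mul_nonneg (mul_nonneg hC1 (sub_nonneg.2 hu)) (mul_nonneg (by linarith) hy.le)
  have k5 : 0 ≤ C1 * u * (e * (N * t - N * s)) :=
    mul_nonneg (mul_nonneg hC1 hu0) (mul_nonneg hE (by linarith))
  linarith

/-- `binom N (m + e) - binom N m` falls, rises and falls again; it does not fall again if
`m + e = N`. -/
lemma binom_sub_pieces {N m e : ℕ} (hm : 0 < m) (he : 0 < e) (h : m + e ≤ N) :
    ∃ a b : ℝ, 0 < a ∧ a ≤ b ∧ b ≤ 1 ∧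
      AntitoneOn (fun t => binom N (m + e) t - binom N m t) (Set.Icc 0 a) ∧
      MonotoneOn (fun t => binom N (m + e) t - binom N m t) (Set.Icc a b) ∧
      AntitoneOn (fun t => binom N (m + e) t - binom N m t) (Set.Icc b 1) ∧
      (m + e = N → b = 1) := by
  have hN : (0 : ℝ) < N := by exact_mod_cast (by omega : 0 < N)
  have hmN : ((m + e : ℕ) : ℝ) ≤ N := by exact_mod_cast h
  -- The stretch on which the difference rises; `hconn` shows that it is an interval, and its ends
  -- are the required `a` and `b`.
  set S : Set ℝ := {t | t ∈ Set.Icc (0 : ℝ) 1 ∧ 0 ≤ slopeSign N m e t} with hS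
  have hSc : IsClosed S := isClosed_Icc.inter
    (isClosed_le continuous_const (continuous_slopeSign N m e))
  -- Between the modes `m / N` and `(m + e) / N` the first probability still rises while the second
  -- already falls.
  have hmid : ∀ t ∈ Set.Icc (0 : ℝ) 1, (m : ℝ) ≤ N * t → N * t ≤ (m + e : ℕ) → t ∈ S := by
    intro t ht h1 h2
    exact ⟨ht, add_nonneg
      (mul_nonneg (mul_nonneg (Nat.cast_nonneg _) (pow_nonneg ht.1 _)) (sub_nonneg.2 h2))
      (mul_nonneg (mul_nonneg (Nat.cast_nonneg _) (pow_nonneg (sub_nonneg.2 ht.2) _))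
        (sub_nonneg.2 h1))⟩
  have hne : S.Nonempty := by
    refine ⟨((m + e : ℕ) : ℝ) / N, hmid _ ⟨by positivity, (div_le_one hN).2 hmN⟩ ?_ ?_⟩ <;>
      rw [mul_div_cancel₀ _ hN.ne']
    exact_mod_cast Nat.le_add_right m e
  have hbb : BddBelow S := ⟨0, fun t ht => ht.1.1⟩
  have hba : BddAbove S := ⟨1, fun t ht => ht.1.2⟩
  have ha := hSc.csInf_mem hne hbb
  have hb := hSc.csSup_mem hne hba
  have h0S : (0 : ℝ) ∉ S := by
    intro h0
    have h1 := h0.2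
    have h2 : 0 < N.choose m := Nat.choose_pos (by omega)
    have h3 : (0 : ℝ) < (N.choose m : ℝ) * m := by positivity
    simp only [slopeSign, zero_pow he.ne', mul_zero, sub_zero, zero_mul, one_pow, mul_one,
      zero_add, zero_sub] at h1
    linarith
  have ha0 : 0 < sInf S := lt_of_le_of_ne ha.1.1 fun h0 => h0S (h0 ▸ ha)
  have hconn : ∀ t ∈ Set.Icc (sInf S) (sSup S), t ∈ S := by
    intro t ht
    have ht01 : t ∈ Set.Icc (0 : ℝ) 1 := ⟨ha0.le.trans ht.1, ht.2.trans hb.1.2⟩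
    rcases lt_or_ge (N * t) m with h1 | h1
    · exact ⟨ht01, slopeSign_nonneg_of_le ha.1.1 ht.1 ht01.2 h1 ha.2⟩
    rcases lt_or_ge ((m + e : ℕ) : ℝ) (N * t) with h2 | h2
    · exact ⟨ht01, slopeSign_nonneg_of_ge ht01.1 ht.2 hb.1.2 h2 hb.2⟩
    · exact hmid t ht01 h1 h2
  have hcont : Continuous fun t => binom N (m + e) t - binom N m t :=
    (continuous_binom _ _).sub (continuous_binom _ _)
  have hfac : ∀ t : ℝ, 0 < t → t < 1 →
      0 < t ^ m * (1 - t) ^ (N - (m + e)) / (t * (1 - t)) := by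
    intro t h0 h1
    have := sub_pos.2 h1
    positivity
  have hneg : ∀ t : ℝ, 0 < t → t < 1 → t ∉ S →
      deriv (fun t => binom N (m + e) t - binom N m t) t ≤ 0 := by
    intro t h0 h1 htS
    rw [(hasDerivAt_binom_sub h h0 h1).deriv]
    refine mul_nonpos_of_nonneg_of_nonpos (hfac t h0 h1).le ?_
    by_contra! h2
    exact htS ⟨⟨h0.le, h1.le⟩, h2.le⟩
  have hab : sInf S ≤ sSup S := csInf_le_csSup hne hbb hba
  have ha1 := ha.1.2
  have hb1 := hb.1.2
  refine ⟨sInf S, sSup S, ha0, hab, hb1, ?_, ?_, ?_, ?_⟩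
  · refine antitoneOn_of_deriv_nonpos (convex_Icc _ _) hcont.continuousOn ?_ ?_ <;>
      rw [interior_Icc]
    · exact fun t ht => (hasDerivAt_binom_sub h ht.1
        (ht.2.trans_le ha1)).differentiableAt.differentiableWithinAt
    · exact fun t ht => hneg t ht.1 (ht.2.trans_le ha1)
        fun hmem => absurd (csInf_le hbb hmem) (not_le.2 ht.2)
  · refine monotoneOn_of_deriv_nonneg (convex_Icc _ _) hcont.continuousOn ?_ ?_ <;>
      rw [interior_Icc]
    · exact fun t ht => (hasDerivAt_binom_sub h (ha0.trans ht.1)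
        (ht.2.trans_le hb1)).differentiableAt.differentiableWithinAt
    · intro t ht
      rw [(hasDerivAt_binom_sub h (ha0.trans ht.1) (ht.2.trans_le hb1)).deriv]
      exact mul_nonneg (hfac t (ha0.trans ht.1) (ht.2.trans_le hb1)).le
        (hconn t ⟨ht.1.le, ht.2.le⟩).2
  · refine antitoneOn_of_deriv_nonpos (convex_Icc _ _) hcont.continuousOn ?_ ?_ <;>
      rw [interior_Icc]
    · exact fun t ht => (hasDerivAt_binom_sub h ((ha0.trans_le hab).trans ht.1)
        ht.2).differentiableAt.differentiableWithinAt
    · exact fun t ht => hneg t ((ha0.trans_le hab).trans ht.1) ht.2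
        fun hmem => absurd (le_csSup hba hmem) (not_le.2 ht.1)
  · intro hNe
    refine le_antisymm hb1 (le_csSup hba ⟨⟨zero_le_one, le_rfl⟩, ?_⟩)
    -- At `t = 1` the first term vanishes because `m + e = N`, the second because `e > 0`.
    simp [slopeSign, hNe, zero_pow he.ne']

/-- A function which falls, rises and falls again, from zero to a nonnegative value, crosses zero
once, from below. -/
lemma exists_crossing {D : ℝ → ℝ} (hD : Continuous D) (h0 : D 0 = 0) {a b : ℝ} (ha : 0 < a)
    (hab : a ≤ b) (hb : b ≤ 1) (h1 : AntitoneOn D (Set.Icc 0 a)) (h2 : MonotoneOn D (Set.Icc a b))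
    (h3 : AntitoneOn D (Set.Icc b 1)) (h4 : b = 1 ∨ 0 ≤ D 1) :
    ∃ t₀ : ℝ, 0 < t₀ ∧ t₀ ≤ 1 ∧ (∀ t ∈ Set.Icc 0 t₀, D t ≤ 0) ∧ ∀ t ∈ Set.Ioc t₀ 1, 0 ≤ D t := by
  have hneg : ∀ t ∈ Set.Icc 0 a, D t ≤ 0 := fun t ht =>
    h0 ▸ h1 ⟨le_rfl, ha.le⟩ ht ht.1
  have haD := hneg a ⟨ha.le, le_rfl⟩
  rcases lt_or_ge (D b) 0 with hb0 | hb0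
  -- No crossing occurs here: the function is nonpositive throughout, and `t₀ = 1` leaves the second
  -- claim empty.
  · have hb1 : b = 1 := h4.resolve_right fun h => absurd
      (h.trans (h3 ⟨le_rfl, hb⟩ ⟨hb, le_rfl⟩ hb)) (not_le.2 hb0)
    subst hb1
    refine ⟨1, one_pos, le_rfl, fun t ht => ?_, fun t ht => ?_⟩
    · rcases le_total t a with hta | hta
      · exact hneg t ⟨ht.1, hta⟩
      · exact (h2 ⟨hta, ht.2⟩ ⟨hab, le_rfl⟩ ht.2).trans hb0.le
    · exact absurd ht.1 (not_lt.2 ht.2)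
  · obtain ⟨t₀, ht₀, hz⟩ := intermediate_value_Icc hab hD.continuousOn ⟨haD, hb0⟩
    refine ⟨t₀, ha.trans_le ht₀.1, ht₀.2.trans hb, fun t ht => ?_, fun t ht => ?_⟩
    · rcases le_total t a with hta | hta
      · exact hneg t ⟨ht.1, hta⟩
      · exact hz ▸ h2 ⟨hta, ht.2.trans ht₀.2⟩ ht₀ ht.2
    · rcases le_total t b with htb | htb
      · exact hz ▸ h2 ht₀ ⟨ht₀.1.trans ht.1.le, htb⟩ ht.1.le
      · rcases h4 with h4 | h4
        · have : t = b := le_antisymm (h4 ▸ ht.2) htb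
          rwa [this]
        · exact h4.trans (h3 ⟨htb, ht.2⟩ ⟨hb, le_rfl⟩ ht.2)

end Crossing

end Contest

/-! ### Expected prize and equilibrium cost as functions of the quantile. -/

namespace Contest

open MeasureTheory

/-- The expected prize of an agent who outperforms each opponent with probability `t`. -/
noncomputable def curve {N : ℕ} (v : Fin N → ℝ) (t : ℝ) : ℝ :=
  ∑ i : Fin N, v i * binom N (i + 1) t

/-- The equilibrium cost `c x` of the effort `x` at the quantile `t` of the effort distribution. -/
noncomputable def costCurve {N L : ℕ} (θ p : Fin (L + 1) → ℝ) (v : Fin N → ℝ) (t : ℝ) : ℝ :=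
  sweep θ p (curve v) t

section Curve

variable {N : ℕ} {v : Fin N → ℝ}

lemma continuous_curve (v : Fin N → ℝ) : Continuous (curve v) :=
  continuous_finsetSum _ fun _ _ => continuous_const.mul (continuous_binom _ _)

lemma curve_zero (v : Fin N → ℝ) : curve v 0 = 0 :=
  Finset.sum_eq_zero fun i _ => by rw [binom_succ_zero, mul_zero]

/-- Summation by parts expresses the slope through the prize gaps, which are nonnegative for
contests. -/
lemma hasDerivAt_curve {n : ℕ} (v : Fin (n + 1) → ℝ) (t : ℝ) :
    HasDerivAt (curve v) (((n : ℝ) + 1) * (v 0 * binom n 0 t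
      + ∑ k : Fin n, binom n (k + 1) t * (v k.succ - v k.castSucc))) t := by
  have h : HasDerivAt (curve v) (∑ i : Fin (n + 1), v i *
      (((n : ℝ) + 1) * (binom n i t - binom n (i + 1) t))) t :=
    HasDerivAt.fun_sum fun i _ => (hasDerivAt_binom_succ n i t).const_mul (v i)
  refine h.congr_deriv ?_
  have h2 := sum_by_parts n v (fun j => binom n j t)
  rw [binom_eq_zero_of_lt (Nat.lt_succ_self n)] at h2
  have h3 : ∑ i : Fin (n + 1), v i * (((n : ℝ) + 1) * (binom n i t - binom n (i + 1) t))
      = ((n : ℝ) + 1) * -∑ i : Fin (n + 1), v i * (binom n (i + 1) t - binom n i t) := by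
    rw [← Finset.sum_neg_distrib, Finset.mul_sum]
    exact Finset.sum_congr rfl fun _ _ => by ring
  rw [h3, h2]
  ring

/-- A lower bound common to all `m`, so that in `strictMonoOn_curve` the prize gaps can be added up
to the top prize, which is positive. -/
lemma pow_mul_pow_le_binom {n m : ℕ} (hm : m ≤ n) {t : ℝ} (ht : t ∈ Set.Icc (0 : ℝ) 1) :
    t ^ n * (1 - t) ^ n ≤ binom n m t := by
  have h1 : (1 : ℝ) ≤ n.choose m := by exact_mod_cast Nat.choose_pos hm
  have h2 : 0 ≤ 1 - t := sub_nonneg.2 ht.2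
  have h3 : t ^ n ≤ t ^ m := pow_le_pow_of_le_one ht.1 ht.2 hm
  have h4 : (1 - t) ^ n ≤ (1 - t) ^ (n - m) :=
    pow_le_pow_of_le_one h2 (by linarith [ht.1]) (Nat.sub_le n m)
  have h5 : t ^ m ≤ (n.choose m : ℝ) * t ^ m := le_mul_of_one_le_left (pow_nonneg ht.1 m) h1
  exact mul_le_mul (h3.trans h5) h4 (pow_nonneg h2 n)
    (mul_nonneg (Nat.cast_nonneg _) (pow_nonneg ht.1 m))

lemma strictMonoOn_curve (hv : v ∈ contests N) : StrictMonoOn (curve v) (Set.Icc 0 1) := by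
  obtain ⟨h0, hmono, i₀, hi₀⟩ := hv
  obtain _ | n := N
  · exact i₀.elim0
  refine strictMonoOn_of_deriv_pos (convex_Icc 0 1) (continuous_curve v).continuousOn ?_
  rw [interior_Icc]
  intro t ht
  have ht' : t ∈ Set.Icc (0 : ℝ) 1 := ⟨ht.1.le, ht.2.le⟩
  rw [(hasDerivAt_curve v t).deriv]
  have hlast : 0 < v (Fin.last n) := hi₀.trans_le (hmono (Fin.le_last i₀))
  have htel := sum_by_parts n v (fun _ => 1)
  simp only [sub_self, mul_zero, Finset.sum_const_zero, mul_one, one_mul] at htel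
  have hδ : 0 < t ^ n * (1 - t) ^ n :=
    mul_pos (pow_pos ht.1 n) (pow_pos (sub_pos.2 ht.2) n)
  have h1 : t ^ n * (1 - t) ^ n * v (Fin.last n) ≤ v 0 * binom n 0 t
      + ∑ k : Fin n, binom n (k + 1) t * (v k.succ - v k.castSucc) := by
    have h2 : v (Fin.last n) = v 0 + ∑ k : Fin n, (v k.succ - v k.castSucc) := by linarith
    rw [h2, mul_add, Finset.mul_sum]
    refine add_le_add ?_ (Finset.sum_le_sum fun k _ => ?_)
    · rw [mul_comm]
      exact mul_le_mul_of_nonneg_left (pow_mul_pow_le_binom (Nat.zero_le n) ht') (h0 0)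
    · exact mul_le_mul_of_nonneg_right (pow_mul_pow_le_binom k.2 ht')
        (sub_nonneg.2 (hmono Fin.castSucc_lt_succ.le))
  have h3 : 0 < t ^ n * (1 - t) ^ n * v (Fin.last n) := mul_pos hδ hlast
  have : (0 : ℝ) < (n : ℝ) + 1 := by positivity
  exact mul_pos this (h3.trans_le h1)

lemma mul_binom_le_curve (hv : v ∈ contests N) (i : Fin N) {t : ℝ} (ht : t ∈ Set.Icc (0 : ℝ) 1) :
    v i * binom N (i + 1) t ≤ curve v t :=
  Finset.single_le_sum (f := fun i : Fin N => v i * binom N (i + 1) t)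
    (fun i _ => mul_nonneg (hv.1 i) (binom_nonneg _ _ ht)) (Finset.mem_univ i)

end Curve

section CostCurve

variable {N L : ℕ} {θ p : Fin (L + 1) → ℝ} {v : Fin N → ℝ}

lemma costCurve_eq_sum (v : Fin N → ℝ) (t : ℝ) :
    costCurve θ p v t = ∑ i : Fin N, v i * sweep θ p (binom N (i + 1)) t := by
  have : curve v = fun t => ∑ i : Fin N, v i * binom N (i + 1) t := rfl
  rw [costCurve, this, sweep_sum]
  exact Finset.sum_congr rfl fun i _ => sweep_mul _ _ _

lemma continuous_costCurve (v : Fin N → ℝ) : Continuous (costCurve θ p v) :=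
  continuous_sweep (continuous_curve v)

lemma costCurve_zero (hp : ∀ k, 0 < p k) (v : Fin N → ℝ) : costCurve θ p v 0 = 0 :=
  sweep_zero hp

lemma strictMonoOn_costCurve (hθ : ∀ k, 0 < θ k) (hanti : StrictAnti θ) (hp : ∀ k, 0 < p k)
    (hs : ∑ k, p k = 1) (hv : v ∈ contests N) :
    StrictMonoOn (costCurve θ p v) (Set.Icc 0 1) :=
  strictMonoOn_sweep hθ hanti hp hs (strictMonoOn_curve hv)

lemma costCurve_nonneg (hθ : ∀ k, 0 < θ k) (hanti : StrictAnti θ) (hp : ∀ k, 0 < p k)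
    (hs : ∑ k, p k = 1) (hv : v ∈ contests N) {t : ℝ} (ht : t ∈ Set.Icc (0 : ℝ) 1) :
    0 ≤ costCurve θ p v t := by
  rw [← costCurve_zero (θ := θ) hp v]
  exact (strictMonoOn_costCurve hθ hanti hp hs hv).monotoneOn ⟨le_rfl, zero_le_one⟩ ht ht.1

lemma costCurve_pos (hθ : ∀ k, 0 < θ k) (hanti : StrictAnti θ) (hp : ∀ k, 0 < p k)
    (hs : ∑ k, p k = 1) (hv : v ∈ contests N) {t : ℝ} (h0 : 0 < t) (h1 : t ≤ 1) :
    0 < costCurve θ p v t := by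
  rw [← costCurve_zero (θ := θ) hp v]
  exact strictMonoOn_costCurve hθ hanti hp hs hv ⟨le_rfl, zero_le_one⟩ ⟨h0.le, h1⟩ h0

lemma costCurve_transfer (v : Fin N → ℝ) (i' i : Fin N) (ε t : ℝ) :
    costCurve θ p (transfer v i' i ε) t = costCurve θ p v t
      + ε * (sweep θ p (binom N (i + 1)) t - sweep θ p (binom N (i' + 1)) t) := by
  simp only [costCurve_eq_sum, transfer, Pi.add_apply, Pi.smul_apply, Pi.sub_apply, smul_eq_mul,
    add_mul, Finset.sum_add_distrib]
  congr 1
  simp only [mul_assoc, ← Finset.mul_sum, sub_mul, Finset.sum_sub_distrib]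
  simp [Pi.single_apply]

/-- The marginal costs `sweep (binom N (i + 1))` are controlled by the cost curve of a contest with
a positive prize at `i`. -/
lemma exists_abs_sweep_binom_le (hθ : ∀ k, 0 < θ k) (hanti : StrictAnti θ) (hp : ∀ k, 0 < p k)
    (hs : ∑ k, p k = 1) (hv : v ∈ contests N) {i : Fin N} (hi : 0 < v i) :
    ∃ C, 0 ≤ C ∧ ∀ t ∈ Set.Icc (0 : ℝ) 1,
      |sweep θ p (binom N (i + 1)) t| ≤ C * costCurve θ p v t := by
  -- Each increment in the sweep is a difference of two values, each at most `curve v t / v i`;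
  -- hence the doubled `1 / v i`.
  set w := ∑ j : Fin (L + 1), 1 / θ j * (1 / v i + 1 / v i) with hw
  have hw0 : 0 ≤ w := Finset.sum_nonneg fun j _ =>
    mul_nonneg (one_div_nonneg_of_pos hθ j) (by positivity)
  refine ⟨w * θ 0, mul_nonneg hw0 (hθ 0).le, fun t ht => ?_⟩
  -- The smallest weight is `1 / θ 0`, that of the least efficient type.
  have h1 : curve v t ≤ θ 0 * costCurve θ p v t := by
    have := le_sweep_sub (h := curve v) hθ hanti hp hs (strictMonoOn_curve hv).monotoneOn 0
      (s := 0) (t := t) (by simp [cut_zero]) ht.1 ht.2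
    rw [curve_zero, sweep_zero hp, sub_zero, sub_zero, one_div_mul_eq_div,
      div_le_iff₀ (hθ 0)] at this
    rw [mul_comm]
    exact this
  have h2 : ∀ s ∈ Set.Icc 0 t, |binom N (i + 1) s| ≤ 1 / v i * curve v t := by
    intro s hs'
    have hs1 : s ∈ Set.Icc (0 : ℝ) 1 := ⟨hs'.1, hs'.2.trans ht.2⟩
    rw [abs_of_nonneg (binom_nonneg _ _ hs1), one_div_mul_eq_div, le_div_iff₀ hi, mul_comm]
    exact (mul_binom_le_curve hv i hs1).trans
      ((strictMonoOn_curve hv).monotoneOn hs1 ht hs'.2)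
  have h3 : |sweep θ p (binom N (i + 1)) t| ≤ w * curve v t := by
    rw [hw, Finset.sum_mul]
    refine (Finset.abs_sum_le_sum_abs _ _).trans (Finset.sum_le_sum fun j _ => ?_)
    rw [abs_mul, abs_of_nonneg (one_div_nonneg_of_pos hθ j), mul_assoc, add_mul]
    refine mul_le_mul_of_nonneg_left ((abs_sub _ _).trans (add_le_add ?_ ?_))
      (one_div_nonneg_of_pos hθ j)
    · exact h2 _ ⟨le_min ht.1 (cut_nonneg hp _), min_le_left _ _⟩
    · exact h2 _ ⟨le_min ht.1 (cut_nonneg hp _), min_le_left _ _⟩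
  calc _ ≤ w * curve v t := h3
    _ ≤ w * (θ 0 * costCurve θ p v t) := mul_le_mul_of_nonneg_left h1 hw0
    _ = _ := by ring

/-- Positive weights preserve the fall-rise-fall pattern. At `t = 1` the sweep equals a nonnegative
multiple of `H_m(1) - H_{m'}(1) ≥ 0` minus `utilityShift`, so the assumption makes the end value
nonnegative; for `m = N` there is no second fall. -/
lemma exists_crossing_sweep (hθ : ∀ k, 0 < θ k) (hp : ∀ k, 0 < p k) (hs : ∑ k, p k = 1)
    {i' i : Fin N} (hi : i' < i)
    (h : (i : ℕ) + 1 = N ∨ utilityShift N θ p (i' + 1) (i + 1) ≤ 0) :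
    ∃ t₀ : ℝ, 0 < t₀ ∧ t₀ ≤ 1 ∧
      (∀ t ∈ Set.Icc 0 t₀,
        sweep θ p (binom N (i + 1)) t - sweep θ p (binom N (i' + 1)) t ≤ 0) ∧
      ∀ t ∈ Set.Ioc t₀ 1,
        0 ≤ sweep θ p (binom N (i + 1)) t - sweep θ p (binom N (i' + 1)) t := by
  have hlt := Fin.lt_def.1 hi
  have hiN := i.2
  obtain ⟨e, he⟩ := Nat.exists_eq_add_of_lt hlt
  obtain ⟨a, b, ha, hab, hb, h1, h2, h3, h4⟩ :=
    binom_sub_pieces (N := N) (m := i' + 1) (e := e + 1) (by omega) (by omega) (by omega)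
  have hie : (i' : ℕ) + 1 + (e + 1) = i + 1 := by omega
  rw [hie] at h1 h2 h3 h4
  have hD : ∀ t, sweep θ p (binom N (i + 1)) t - sweep θ p (binom N (i' + 1)) t
      = sweep θ p (fun t => binom N (i + 1) t - binom N (i' + 1) t) t :=
    fun t => (sweep_sub _ _ t).symm
  simp only [hD]
  refine exists_crossing (continuous_sweep ((continuous_binom _ _).sub (continuous_binom _ _)))
    (sweep_zero hp) ha hab hb (antitoneOn_sweep hθ hp h1) (monotoneOn_sweep hθ hp h2)
    (antitoneOn_sweep hθ hp h3) (h.imp h4 fun hu => ?_)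
  rw [sweep_eq hs zero_le_one le_rfl (by simp only [binom_succ_zero, sub_self])]
  have hmin : ∀ k : Fin L, min 1 (cumProb p k.castSucc) = cumProb p k.castSucc := fun k =>
    min_eq_right (by
      rw [cumProb_eq_cut]
      exact cut_le_one hp hs (by simp))
  simp only [hmin]
  have h5 : 0 ≤ binom N (i + 1) 1 - binom N (i' + 1) 1 := by
    rw [binom_one, binom_one, if_neg (show (i' : ℕ) + 1 ≠ N by omega), sub_zero]
    split_ifs <;> norm_num
  exact sub_nonneg.2 (hu.trans (mul_nonneg (one_div_nonneg_of_pos hθ _) h5))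

/-- The payoff of the most efficient type at the highest effort. -/
lemma curve_one_sub (hθ : ∀ k, 0 < θ k) (hp : ∀ k, 0 < p k) (hs : ∑ k, p k = 1)
    (v : Fin N → ℝ) :
    curve v 1 - θ (Fin.last L) * costCurve θ p v 1
      = ∑ i : Fin N, v i * (θ (Fin.last L) * ∑ k : Fin L, binom N (i + 1) (cumProb p k.castSucc)
          * (1 / θ k.succ - 1 / θ k.castSucc)) := by
  have hmin : ∀ k : Fin L, min 1 (cumProb p k.castSucc) = cumProb p k.castSucc := fun k =>
    min_eq_right (by
      rw [cumProb_eq_cut]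
      exact cut_le_one hp hs (by simp))
  have hl := (hθ (Fin.last L)).ne'
  rw [costCurve_eq_sum, curve, Finset.mul_sum, ← Finset.sum_sub_distrib]
  refine Finset.sum_congr rfl fun i _ => ?_
  rw [sweep_eq hs zero_le_one le_rfl (binom_succ_zero N i)]
  simp only [hmin]
  generalize ∑ k : Fin L, binom N (i + 1) (cumProb p k.castSucc)
    * (1 / θ k.succ - 1 / θ k.castSucc) = z
  field_simp
  ring

end CostCurve

end Contest

/-! ### The inverse of the cost function. -/

namespace Contest

open MeasureTheory

/-- The inverse of a cost function, extended by the identity to negative arguments. -/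
noncomputable def invCost (c : ℝ → ℝ) : ℝ → ℝ :=
  Function.invFun fun x => c (max x 0) + min x 0

namespace IsCost

variable {c : ℝ → ℝ}

lemma strictMonoOn (hc : IsCost c) : StrictMonoOn c (Set.Ici 0) := by
  refine strictMonoOn_of_deriv_pos (convex_Ici 0) hc.continuousOn fun x hx => ?_
  rw [interior_Ici] at hx
  exact hc.deriv_pos x hx

lemma continuous_comp_max (hc : IsCost c) : Continuous fun x => c (max x 0) :=
  hc.continuousOn.comp_continuous (by fun_prop) fun x => le_max_right x 0

/-- Continuing `c` by the identity on negative numbers gives an increasing bijection of the whole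
line, so its inverse is continuous with no boundary case at zero. -/
lemma exists_orderIso (hc : IsCost c) : ∃ e : ℝ ≃o ℝ, ∀ x, e x = c (max x 0) + min x 0 := by
  have hmono : StrictMono fun x => c (max x 0) + min x 0 := by
    intro x y hxy
    have h1 : c (max x 0) ≤ c (max y 0) := hc.strictMonoOn.monotoneOn (le_max_right x 0)
      (le_max_right y 0) (max_le_max_right 0 hxy.le)
    rcases lt_or_ge x 0 with hx | hx
    · have h2 : min x 0 < min y 0 := by
        rw [min_eq_left hx.le]
        exact lt_min hxy hx
      exact add_lt_add_of_le_of_lt h1 h2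
    · have hy := hx.trans hxy.le
      simp only [max_eq_left hx, max_eq_left hy, min_eq_right hx, min_eq_right hy, add_zero]
      exact hc.strictMonoOn hx hy hxy
  have hcont : Continuous fun x => c (max x 0) + min x 0 :=
    hc.continuous_comp_max.add (by fun_prop)
  have htop : Filter.Tendsto (fun x => c (max x 0) + min x 0) Filter.atTop Filter.atTop := by
    refine hc.tendsto.congr' ?_
    filter_upwards [Filter.eventually_ge_atTop (0 : ℝ)] with x hx
    simp [hx]
  have hbot : Filter.Tendsto (fun x => c (max x 0) + min x 0) Filter.atBot Filter.atBot := by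
    refine Filter.tendsto_id.congr' ?_
    filter_upwards [Filter.eventually_le_atBot (0 : ℝ)] with x hx
    simp [hx, hc.zero]
  exact ⟨hmono.orderIsoOfSurjective _ (hcont.surjective htop hbot), fun _ => rfl⟩

lemma exists_orderIso_symm (hc : IsCost c) :
    ∃ e : ℝ ≃o ℝ, (∀ x, e x = c (max x 0) + min x 0) ∧ ∀ y, invCost c y = e.symm y := by
  obtain ⟨e, he⟩ := hc.exists_orderIso
  refine ⟨e, he, fun y => ?_⟩
  have h1 : (fun x => c (max x 0) + min x 0) = e := funext fun x => (he x).symm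
  rw [invCost, h1]
  conv_lhs => rw [← e.apply_symm_apply y]
  exact Function.leftInverse_invFun e.injective _

lemma strictMono_invCost (hc : IsCost c) : StrictMono (invCost c) := by
  obtain ⟨e, -, h⟩ := hc.exists_orderIso_symm
  rw [funext h]
  exact e.symm.strictMono

lemma continuous_invCost (hc : IsCost c) : Continuous (invCost c) := by
  obtain ⟨e, -, h⟩ := hc.exists_orderIso_symm
  rw [funext h]
  exact e.symm.continuous

lemma invCost_cost (hc : IsCost c) {x : ℝ} (hx : 0 ≤ x) : invCost c (c x) = x := by
  obtain ⟨e, he, h⟩ := hc.exists_orderIso_symm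
  have : e x = c x := by simp [he, hx]
  rw [h, ← this, e.symm_apply_apply]

lemma invCost_zero (hc : IsCost c) : invCost c 0 = 0 := by
  conv_lhs => rw [← hc.zero]
  exact hc.invCost_cost le_rfl

lemma invCost_nonneg (hc : IsCost c) {y : ℝ} (hy : 0 ≤ y) : 0 ≤ invCost c y :=
  hc.invCost_zero ▸ hc.strictMono_invCost.monotone hy

lemma invCost_pos (hc : IsCost c) {y : ℝ} (hy : 0 < y) : 0 < invCost c y :=
  hc.invCost_zero ▸ hc.strictMono_invCost hy

lemma cost_invCost (hc : IsCost c) {y : ℝ} (hy : 0 ≤ y) : c (invCost c y) = y := by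
  obtain ⟨e, he, h⟩ := hc.exists_orderIso_symm
  have h0 := hc.invCost_nonneg hy
  have : e (invCost c y) = c (invCost c y) := by simp [he, h0]
  rw [← this, h, e.apply_symm_apply]

lemma nonneg (hc : IsCost c) {x : ℝ} (hx : 0 ≤ x) : 0 ≤ c x := by
  rw [← hc.zero]
  exact hc.strictMonoOn.monotoneOn Set.self_mem_Ici hx hx

lemma differentiableAt_invCost (hc : IsCost c) {y : ℝ} (hy : 0 < y) :
    DifferentiableAt ℝ (invCost c) y := by
  have hx := hc.invCost_pos hy
  have h := (hc.differentiableAt _ hx).hasDerivAt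
  refine (h.of_local_left_inverse hc.continuous_invCost.continuousAt
    (hc.deriv_pos _ hx).ne' ?_).differentiableAt
  filter_upwards [lt_mem_nhds hy] with z hz
  exact hc.cost_invCost hz.le

end IsCost

end Contest

/-! ### The expected prize against random opponents. -/

namespace Contest

open MeasureTheory

section Award

variable {N : ℕ} {v : Fin N → ℝ}

lemma prize_succ (v : Fin N → ℝ) (i : Fin N) : prize v (i + 1) = v i := by
  simp [prize]

lemma prize_mono (hv : v ∈ contests N) {r s : ℕ} (hrs : r ≤ s) (hs : s ≤ N) :
    prize v r ≤ prize v s := by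
  rcases r with _ | r
  · rcases s with _ | s
    · exact le_rfl
    · rw [show prize v (s + 1) = v ⟨s, hs⟩ from prize_succ v ⟨s, hs⟩]
      exact hv.1 _
  · obtain ⟨s, rfl⟩ : ∃ s', s = s' + 1 := ⟨s - 1, by omega⟩
    rw [show prize v (r + 1) = v ⟨r, by omega⟩ from prize_succ v ⟨r, by omega⟩,
      show prize v (s + 1) = v ⟨s, hs⟩ from prize_succ v ⟨s, hs⟩]
    exact hv.2.1 (by simpa [Fin.le_def] using hrs)

lemma prize_zero (v : Fin N → ℝ) : prize v 0 = 0 := rfl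

lemma prize_last_pos (hv : v ∈ contests N) : 0 < prize v N := by
  obtain ⟨i, hi⟩ := hv.2.2
  rw [← prize_succ v i] at hi
  exact hi.trans_le (prize_mono hv i.2 le_rfl)

lemma numBelow_add_numTied_le (x : ℝ) (y : Fin N → ℝ) : numBelow x y + numTied x y ≤ N := by
  classical
  rw [numBelow, numTied, ← Finset.card_union_of_disjoint]
  · simpa using Finset.card_le_univ (α := Fin N) _
  · rw [Finset.disjoint_filter]
    exact fun i _ h => h.ne

lemma numBelow_add_numTied_le_numBelow {x x' : ℝ} (h : x < x') (y : Fin N → ℝ) :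
    numBelow x y + numTied x y ≤ numBelow x' y := by
  classical
  rw [numBelow, numTied, numBelow, ← Finset.card_union_of_disjoint]
  · refine Finset.card_le_card fun i hi => ?_
    rcases Finset.mem_union.1 hi with hi | hi
    · exact Finset.mem_filter.2 ⟨Finset.mem_univ i, (Finset.mem_filter.1 hi).2.trans h⟩
    · exact Finset.mem_filter.2 ⟨Finset.mem_univ i, (Finset.mem_filter.1 hi).2.trans_lt h⟩
  · rw [Finset.disjoint_filter]
    exact fun i _ h => h.ne

lemma award_le (hv : v ∈ contests N) (x : ℝ) (y : Fin N → ℝ) :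
    award v x y ≤ prize v (numBelow x y + numTied x y) := by
  rw [award, div_le_iff₀ (by positivity)]
  have h : ∀ i ∈ Finset.range (numTied x y + 1),
      prize v (numBelow x y + i) ≤ prize v (numBelow x y + numTied x y) := fun i hi =>
    prize_mono hv (by have := Finset.mem_range.1 hi; omega) (numBelow_add_numTied_le x y)
  have := Finset.sum_le_card_nsmul _ _ _ h
  rw [Finset.card_range, nsmul_eq_mul, mul_comm] at this
  exact_mod_cast this

lemma le_award (hv : v ∈ contests N) (x : ℝ) (y : Fin N → ℝ) :
    prize v (numBelow x y) ≤ award v x y := by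
  rw [award, le_div_iff₀ (by positivity)]
  have h : ∀ i ∈ Finset.range (numTied x y + 1),
      prize v (numBelow x y) ≤ prize v (numBelow x y + i) := fun i hi =>
    prize_mono hv (Nat.le_add_right _ _) (by
      have := Finset.mem_range.1 hi
      have := numBelow_add_numTied_le x y
      omega)
  have := Finset.card_nsmul_le_sum _ _ _ h
  rw [Finset.card_range, nsmul_eq_mul, mul_comm] at this
  exact_mod_cast this

lemma award_nonneg (hv : v ∈ contests N) (x : ℝ) (y : Fin N → ℝ) : 0 ≤ award v x y :=
  (prize_mono hv (Nat.zero_le _) ((Nat.le_add_right _ _).trans (numBelow_add_numTied_le x y))).trans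
    (le_award hv x y)

lemma award_le_last (hv : v ∈ contests N) (x : ℝ) (y : Fin N → ℝ) : award v x y ≤ prize v N :=
  (award_le hv x y).trans (prize_mono hv (numBelow_add_numTied_le x y) le_rfl)

/-- Every opponent below or tied at `x` is strictly below `x'`, so the best outcome at `x` is no
better than the worst at `x'`. -/
lemma award_mono (hv : v ∈ contests N) {x x' : ℝ} (h : x < x') (y : Fin N → ℝ) :
    award v x y ≤ award v x' y :=
  (award_le hv x y).trans ((prize_mono hv (numBelow_add_numTied_le_numBelow h y)
    ((Nat.le_add_right _ _).trans (numBelow_add_numTied_le x' y))).trans (le_award hv x' y))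

lemma measurable_award (v : Fin N → ℝ) (x : ℝ) : Measurable (award v x) := by
  classical
  have h1 : Measurable fun y : Fin N → ℝ => numBelow x y := by
    simp only [numBelow, Finset.card_filter]
    exact Finset.measurable_sum _ fun i _ => Measurable.ite
      (measurableSet_lt (measurable_pi_apply i) measurable_const) measurable_const measurable_const
  have h2 : Measurable fun y : Fin N → ℝ => numTied x y := by
    simp only [numTied, Finset.card_filter]
    exact Finset.measurable_sum _ fun i _ => Measurable.ite
      (measurableSet_eq_fun (measurable_pi_apply i) measurable_const) measurable_const
      measurable_const
  let g : ℕ × ℕ → ℝ := fun q =>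
    (∑ i ∈ Finset.range (q.2 + 1), prize v (q.1 + i)) / ((q.2 : ℝ) + 1)
  have hg : Measurable g := measurable_of_countable g
  have e : award v x = fun y => g (numBelow x y, numTied x y) := rfl
  rw [e]
  exact hg.comp (h1.prodMk h2)

/-- What an agent gains by overtaking `N` tied opponents. -/
noncomputable def tieGain (v : Fin N → ℝ) : ℝ :=
  prize v N - (∑ i ∈ Finset.range (N + 1), prize v i) / ((N : ℝ) + 1)

lemma tieGain_pos (hv : v ∈ contests N) : 0 < tieGain v := by
  rw [tieGain, sub_pos, div_lt_iff₀ (by positivity)]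
  have h : ∑ i ∈ Finset.range (N + 1), prize v i < ∑ i ∈ Finset.range (N + 1), prize v N :=
    Finset.sum_lt_sum (fun i hi => prize_mono hv (Nat.lt_succ_iff.1 (Finset.mem_range.1 hi)) le_rfl)
      ⟨0, Finset.mem_range.2 (Nat.succ_pos N), prize_last_pos hv⟩
  rw [Finset.sum_const, Finset.card_range, nsmul_eq_mul, mul_comm] at h
  exact_mod_cast h

lemma award_add_tieGain (v : Fin N → ℝ) {x x' : ℝ} (h : x < x') {y : Fin N → ℝ}
    (hy : ∀ i, y i = x) : award v x y + tieGain v = award v x' y := by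
  have h1 : numBelow x y = 0 := by simp [numBelow, hy]
  have h2 : numTied x y = N := by simp [numTied, hy]
  have h3 : numBelow x' y = N := by simp [numBelow, hy, h]
  have h4 : numTied x' y = 0 := by simp [numTied, hy, h.ne]
  simp [award, tieGain, h1, h2, h3, h4]

variable {μ : Measure ℝ} [IsProbabilityMeasure μ]

lemma integrable_award (hv : v ∈ contests N) (x : ℝ) :
    Integrable (award v x) (Measure.pi fun _ : Fin N => μ) :=
  Integrable.of_bound (measurable_award v x).aestronglyMeasurable (prize v N)
    (Filter.Eventually.of_forall fun y => by
      rw [Real.norm_of_nonneg (award_nonneg hv x y)]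
      exact award_le_last hv x y)

/-- Raising the effort never lowers the prize, and it gains `tieGain v` in the event that all
opponents sit exactly at `x`. -/
lemma integral_award_add_le (hv : v ∈ contests N) {x x' : ℝ} (h : x < x') :
    ∫ y, award v x y ∂(Measure.pi fun _ : Fin N => μ) + μ.real {x} ^ N * tieGain v
      ≤ ∫ y, award v x' y ∂(Measure.pi fun _ : Fin N => μ) := by
  set E : Set (Fin N → ℝ) := Set.univ.pi fun _ => {x} with hE
  have hEm : MeasurableSet E := MeasurableSet.univ_pi fun _ => measurableSet_singleton x
  have h1 : ∫ y, E.indicator (fun _ => tieGain v) y ∂(Measure.pi fun _ : Fin N => μ)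
      = μ.real {x} ^ N * tieGain v := by
    rw [integral_indicator_const _ hEm, measureReal_def, hE, Measure.pi_pi]
    simp [measureReal_def]
  have h2 : Integrable (E.indicator fun _ => tieGain v) (Measure.pi fun _ : Fin N => μ) :=
    (integrable_const _).indicator hEm
  rw [← h1, ← integral_add (integrable_award hv x) h2]
  refine integral_mono ((integrable_award hv x).add h2) (integrable_award hv x') fun y => ?_
  by_cases hy : y ∈ E
  · simp only [Set.indicator_of_mem hy]
    exact (award_add_tieGain v h fun i => hy i (Set.mem_univ i)).le
  · simp only [Set.indicator_of_notMem hy, add_zero]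
    exact award_mono hv h y

/-- Without an atom at `x`, an agent with effort `x` outperforms each opponent independently with
probability `μ (Iio x)`. -/
lemma integral_award_eq_curve (v : Fin N → ℝ) {x : ℝ} (hx : μ {x} = 0) :
    ∫ y, award v x y ∂(Measure.pi fun _ : Fin N => μ) = curve v (μ.real (Set.Iio x)) := by
  classical
  set F := μ.real (Set.Iio x) with hF
  -- The product of `f S i (y i)` over `i` indicates that exactly the opponents in `S` are below
  -- `x`; independence then factorizes its integral.
  let f : Finset (Fin N) → Fin N → ℝ → ℝ := fun S i =>
    if i ∈ S then (Set.Iio x).indicator (fun _ => 1) else (Set.Ici x).indicator (fun _ => 1)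
  have hf_int : ∀ S i, ∫ z, f S i z ∂μ = if i ∈ S then F else 1 - F := by
    intro S i
    by_cases h : i ∈ S
    · simp only [f, h, if_true, integral_indicator_const _ measurableSet_Iio, smul_eq_mul, mul_one]
      rfl
    · simp only [f, h, if_false, integral_indicator_const _ measurableSet_Ici, smul_eq_mul, mul_one]
      rw [← Set.compl_Iio, probReal_compl_eq_one_sub measurableSet_Iio]
  have hf_integrable : ∀ S i, Integrable (f S i) μ := by
    intro S i
    by_cases h : i ∈ S
    · simpa only [f, h, if_true] using (integrable_const (1 : ℝ)).indicator measurableSet_Iio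
    · simpa only [f, h, if_false] using (integrable_const (1 : ℝ)).indicator measurableSet_Ici
  have h1 : ∀ᵐ y ∂(Measure.pi fun _ : Fin N => μ), award v x y
      = ∑ S ∈ (Finset.univ : Finset (Fin N)).powerset, prize v S.card * ∏ i, f S i (y i) := by
    have hne : ∀ᵐ y ∂(Measure.pi fun _ : Fin N => μ), ∀ i, y i ≠ x := by
      rw [ae_all_iff]
      intro i
      have : ∀ᵐ z ∂μ, z ≠ x := by
        rw [ae_iff]
        simpa using hx
      exact (Measure.tendsto_eval_ae_ae (μ := fun _ : Fin N => μ) (i := i)).eventually this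
    filter_upwards [hne] with y hy
    have h0 : numTied x y = 0 := by simp [numTied, hy]
    have hprod : ∀ S : Finset (Fin N), ∏ i, f S i (y i)
        = if S = Finset.univ.filter (fun i => y i < x) then 1 else 0 := by
      intro S
      split_ifs with hS
      · subst hS
        refine Finset.prod_eq_one fun i _ => ?_
        by_cases hi : y i < x
        · simp [f, hi]
        · simp [f, hi, not_lt.1 hi]
      · have : ∃ i, ¬ (i ∈ S ↔ y i < x) := by
          by_contra! hall
          exact hS (Finset.ext fun i => by simp [hall i])
        obtain ⟨i, hi⟩ := this
        refine Finset.prod_eq_zero (Finset.mem_univ i) ?_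
        by_cases h : i ∈ S
        · have : ¬ y i < x := fun h' => hi ⟨fun _ => h', fun _ => h⟩
          simp [f, h, this]
        · have : y i < x := by
            by_contra h'
            exact hi ⟨fun h'' => absurd h'' h, fun h'' => absurd h'' h'⟩
          simp [f, h, this]
    simp only [hprod, mul_ite, mul_one, mul_zero]
    rw [Finset.sum_ite_eq' _ (Finset.univ.filter fun i => y i < x), if_pos (by simp)]
    simp only [award, h0, numBelow]
    simp
  have h2 : ∀ S : Finset (Fin N), ∏ i, (if i ∈ S then F else 1 - F)
      = F ^ S.card * (1 - F) ^ (N - S.card) := by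
    intro S
    rw [Finset.prod_ite, Finset.prod_const, Finset.prod_const]
    congr 2
    · simp
    · have : Finset.univ.filter (fun i => i ∉ S) = Sᶜ := by ext; simp
      rw [this, Finset.card_compl, Fintype.card_fin]
  rw [integral_congr_ae h1, integral_finsetSum]
  · simp only [integral_const_mul, integral_fintype_prod_eq_prod, hf_int, h2]
    rw [Finset.sum_powerset_apply_card
      (fun r => prize v r * (F ^ r * (1 - F) ^ (N - r))), Finset.card_univ, Fintype.card_fin,
      Finset.sum_range_succ', Finset.sum_range]
    simp only [prize_zero, zero_mul, smul_zero, add_zero, prize_succ, curve]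
    refine Finset.sum_congr rfl fun i _ => ?_
    rw [binom, nsmul_eq_mul]
    ring
  · intro S _
    exact (Integrable.fintype_prod fun i => hf_integrable S i).const_mul _

end Award

end Contest

/-! ### Uniqueness: an equilibrium is determined by its cost curve. -/

namespace Contest

open MeasureTheory ProbabilityTheory Filter Topology

section EffortLaw

variable {L : ℕ} {p : Fin (L + 1) → ℝ} {σ : Fin (L + 1) → ProbabilityMeasure ℝ}

lemma effortLaw_apply (p : Fin (L + 1) → ℝ) (σ : Fin (L + 1) → ProbabilityMeasure ℝ) (s : Set ℝ) :
    effortLaw p σ s = ∑ k, ENNReal.ofReal (p k) * (σ k : Measure ℝ) s := by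
  simp [effortLaw]

lemma isProbabilityMeasure_effortLaw (hp : ∀ k, 0 < p k) (hs : ∑ k, p k = 1) :
    IsProbabilityMeasure (effortLaw p σ) := by
  constructor
  simp only [effortLaw_apply, measure_univ, mul_one]
  rw [← ENNReal.ofReal_sum_of_nonneg fun k _ => (hp k).le, hs, ENNReal.ofReal_one]

lemma effortLaw_real (hp : ∀ k, 0 < p k) (s : Set ℝ) :
    (effortLaw p σ).real s = ∑ k, p k * (σ k : Measure ℝ).real s := by
  rw [measureReal_def, effortLaw_apply, ENNReal.toReal_sum fun k _ =>
    ENNReal.mul_ne_top ENNReal.ofReal_ne_top (measure_ne_top _ _)]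
  refine Finset.sum_congr rfl fun k _ => ?_
  rw [ENNReal.toReal_mul, ENNReal.toReal_ofReal (hp k).le, measureReal_def]

lemma ae_effortLaw {P : ℝ → Prop} (h : ∀ k, ∀ᵐ x ∂(σ k : Measure ℝ), P x) :
    ∀ᵐ x ∂(effortLaw p σ), P x := by
  rw [ae_iff, effortLaw_apply]
  exact Finset.sum_eq_zero fun k _ => by rw [ae_iff.1 (h k), mul_zero]

lemma apply_eq_zero_of_effortLaw (hp : ∀ k, 0 < p k) {s : Set ℝ} (h : effortLaw p σ s = 0)
    (k : Fin (L + 1)) : (σ k : Measure ℝ) s = 0 := by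
  rw [effortLaw_apply, Finset.sum_eq_zero_iff] at h
  exact (mul_eq_zero.1 (h k (Finset.mem_univ k))).resolve_left
    (ENNReal.ofReal_pos.2 (hp k)).ne'

/-- The distribution function of an atomless measure is continuous. -/
lemma continuous_cdf_of_forall_singleton {μ : Measure ℝ} [IsProbabilityMeasure μ]
    (h : ∀ x, μ {x} = 0) : Continuous (cdf μ) := by
  rw [continuous_iff_continuousAt]
  intro x
  rw [(monotone_cdf μ).continuousAt_iff_leftLim_eq_rightLim, (cdf μ).rightLim_eq]
  have h1 := (cdf μ).measure_singleton x
  rw [measure_cdf, h x, eq_comm, ENNReal.ofReal_eq_zero] at h1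
  exact le_antisymm ((monotone_cdf μ).leftLim_le le_rfl) (by linarith)

end EffortLaw

section Uniqueness

variable {N L : ℕ} {θ p : Fin (L + 1) → ℝ} {c : ℝ → ℝ} {v : Fin N → ℝ}
  {σ : Fin (L + 1) → ProbabilityMeasure ℝ}

/-- At an atom, an arbitrarily small increase of effort gains a fixed amount of expected prize,
while by continuity its extra cost tends to zero. -/
lemma effortLaw_singleton (hp : ∀ k, 0 < p k) (hs : ∑ k, p k = 1)
    (hc : IsCost c) (hv : v ∈ contests N)
    (hσ : IsSymmetricEquilibrium (fun k x => θ k * c x) p v σ) (x : ℝ) :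
    effortLaw p σ {x} = 0 := by
  have := isProbabilityMeasure_effortLaw (σ := σ) hp hs
  by_contra hne
  obtain ⟨k, hk⟩ : ∃ k, (σ k : Measure ℝ) {x} ≠ 0 := by
    by_contra! hall
    exact hne (by simp [effortLaw_apply, hall])
  -- What holds for almost every effort of type `k` holds at a point that this type chooses with
  -- positive probability.
  obtain ⟨hx0, hx⟩ : 0 ≤ x ∧ ∀ y, 0 ≤ y →
      payoff (fun k x => θ k * c x) p v σ k y ≤ payoff (fun k x => θ k * c x) p v σ k x := by
    by_contra hcon
    exact hk (measure_mono_null (Set.singleton_subset_iff.2 hcon) (ae_iff.1 (hσ k)))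
  have hpos : 0 < (effortLaw p σ).real {x} ^ N * tieGain v :=
    mul_pos (pow_pos (ENNReal.toReal_pos hne (measure_ne_top _ _)) N) (tieGain_pos hv)
  have hineq : ∀ y, x < y →
      (effortLaw p σ).real {x} ^ N * tieGain v ≤ θ k * c (max y 0) - θ k * c (max x 0) := by
    intro y hxy
    have h1 := integral_award_add_le (μ := effortLaw p σ) hv hxy
    have h2 := hx y (hx0.trans hxy.le)
    simp only [payoff] at h2
    rw [max_eq_left hx0, max_eq_left (hx0.trans hxy.le)]
    linarith
  have hcont : Continuous fun y => θ k * c (max y 0) - θ k * c (max x 0) :=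
    (hc.continuous_comp_max.const_mul _).sub continuous_const
  have hlim : Tendsto (fun y => θ k * c (max y 0) - θ k * c (max x 0)) (𝓝[>] x) (𝓝 0) := by
    have := hcont.tendsto x
    rw [sub_self] at this
    exact this.mono_left nhdsWithin_le_nhds
  have := ge_of_tendsto hlim (by
    filter_upwards [self_mem_nhdsWithin] with y hy using hineq y hy)
  linarith

lemma payoff_eq (hp : ∀ k, 0 < p k) (hs : ∑ k, p k = 1) (hσ : ∀ x, effortLaw p σ {x} = 0)
    (k : Fin (L + 1)) (x : ℝ) :
    payoff (fun k x => θ k * c x) p v σ k x = curve v (cdf (effortLaw p σ) x) - θ k * c x := by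
  have := isProbabilityMeasure_effortLaw (σ := σ) hp hs
  have h1 : (effortLaw p σ).real (Set.Iio x) = cdf (effortLaw p σ) x := by
    rw [cdf_eq_real, ← Set.Iio_union_right, measureReal_union (by simp) (measurableSet_singleton x),
      measureReal_def _ {x}, hσ x, ENNReal.toReal_zero, add_zero]
  rw [payoff, integral_award_eq_curve v (hσ x), h1]

/-- The efforts that are optimal for type `k` when an effort `x` outperforms each opponent with
probability `F x`. -/
def bestEfforts (θ : Fin (L + 1) → ℝ) (c : ℝ → ℝ) (v : Fin N → ℝ) (F : ℝ → ℝ)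
    (k : Fin (L + 1)) : Set ℝ :=
  {x | 0 ≤ x ∧ ∀ y, 0 ≤ y → curve v (F y) - θ k * c y ≤ curve v (F x) - θ k * c x}

/-- An atomless strategy with distribution function `F` whose efforts are almost surely optimal. -/
structure IsSettled (θ p : Fin (L + 1) → ℝ) (c : ℝ → ℝ) (v : Fin N → ℝ)
    (σ : Fin (L + 1) → ProbabilityMeasure ℝ) (F : ℝ → ℝ) : Prop where
  eq_real : ∀ x, F x = (effortLaw p σ).real (Set.Iic x)
  singleton : ∀ x, effortLaw p σ {x} = 0
  continuous : Continuous F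
  monotone : Monotone F
  le_one : ∀ x, F x ≤ 1
  nonneg : ∀ x, 0 ≤ F x
  tendsto : Tendsto F atTop (𝓝 1)
  ae_best : ∀ k, ∀ᵐ x ∂(σ k : Measure ℝ), x ∈ bestEfforts θ c v F k

lemma IsSymmetricEquilibrium.isSettled (hp : ∀ k, 0 < p k) (hs : ∑ k, p k = 1)
    (hc : IsCost c) (hv : v ∈ contests N)
    (hσ : IsSymmetricEquilibrium (fun k x => θ k * c x) p v σ) :
    IsSettled θ p c v σ (cdf (effortLaw p σ)) := by
  have := isProbabilityMeasure_effortLaw (σ := σ) hp hs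
  have h := effortLaw_singleton hp hs hc hv hσ
  refine ⟨fun x => cdf_eq_real _ x, h, continuous_cdf_of_forall_singleton h, monotone_cdf _,
    cdf_le_one _, cdf_nonneg _, tendsto_cdf_atTop _, fun k => ?_⟩
  filter_upwards [hσ k] with x hx
  simp only [payoff_eq hp hs h] at hx
  exact hx

namespace IsSettled

variable {F : ℝ → ℝ}

lemma isClosed_bestEfforts (hc : IsCost c) (h : IsSettled θ p c v σ F) (k : Fin (L + 1)) :
    IsClosed (bestEfforts θ c v F k) := by
  have hu : Continuous fun x => curve v (F x) - θ k * c (max x 0) :=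
    ((continuous_curve v).comp h.continuous).sub (hc.continuous_comp_max.const_mul _)
  have : bestEfforts θ c v F k = Set.Ici 0 ∩ ⋂ y ∈ Set.Ici (0 : ℝ),
      {x | curve v (F y) - θ k * c y ≤ curve v (F x) - θ k * c (max x 0)} := by
    ext x
    simp only [bestEfforts, Set.mem_ofPred_eq, Set.mem_inter_iff, Set.mem_Ici, Set.mem_iInter]
    refine and_congr_right fun hx => ?_
    rw [max_eq_left hx]
  rw [this]
  exact isClosed_Ici.inter (isClosed_biInter fun y _ => isClosed_le continuous_const hu)

/-- Adding the two optimality conditions gives `(θ k - θ l) * (c x - c y) ≤ 0`. -/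
lemma le_of_mem (hanti : StrictAnti θ) (hc : IsCost c) {k l : Fin (L + 1)} (hkl : k < l)
    {x y : ℝ} (hx : x ∈ bestEfforts θ c v F k) (hy : y ∈ bestEfforts θ c v F l) : x ≤ y := by
  by_contra! hlt
  have h1 := hx.2 y hy.1
  have h2 := hy.2 x hx.1
  have h3 := hc.strictMonoOn hy.1 hx.1 hlt
  have h4 := mul_pos (sub_pos.2 (hanti hkl)) (sub_pos.2 h3)
  linarith

lemma real_Iic_eq_one (hanti : StrictAnti θ) (hc : IsCost c) (h : IsSettled θ p c v σ F)
    {j l : Fin (L + 1)} (hlj : l < j) {x : ℝ} (hx : x ∈ bestEfforts θ c v F j) :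
    (σ l : Measure ℝ).real (Set.Iic x) = 1 := by
  have : ∀ᵐ z ∂(σ l : Measure ℝ), z ∈ Set.Iic x := by
    filter_upwards [h.ae_best l] with z hz using le_of_mem hanti hc hlj hz hx
  rw [measureReal_def, (prob_compl_eq_zero_iff measurableSet_Iic).1 this, ENNReal.toReal_one]

lemma real_Iic_eq_zero (hanti : StrictAnti θ) (hp : ∀ k, 0 < p k) (hc : IsCost c)
    (h : IsSettled θ p c v σ F)
    {j l : Fin (L + 1)} (hjl : j < l) {x : ℝ} (hx : x ∈ bestEfforts θ c v F j) :
    (σ l : Measure ℝ).real (Set.Iic x) = 0 := by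
  have h1 : ∀ᵐ z ∂(σ l : Measure ℝ), z ∉ Set.Iic x := by
    have h2 : ∀ᵐ z ∂(σ l : Measure ℝ), z ≠ x := by
      rw [ae_iff]
      simpa using apply_eq_zero_of_effortLaw hp (h.singleton x) l
    filter_upwards [h.ae_best l, h2] with z hz hzx hle
    exact hzx (le_antisymm hle (le_of_mem hanti hc hjl hx hz))
  rw [ae_iff] at h1
  simp only [not_not, Set.ofPred_mem_eq] at h1
  rw [measureReal_def, h1, ENNReal.toReal_zero]

/-- At an optimal effort of type `j`, the less efficient types lie entirely below and the more
efficient ones above. -/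
lemma eq_cut_add (hanti : StrictAnti θ) (hp : ∀ k, 0 < p k) (hc : IsCost c)
    (h : IsSettled θ p c v σ F) {j : Fin (L + 1)} {x : ℝ} (hx : x ∈ bestEfforts θ c v F j) :
    F x = cut p j + p j * (σ j : Measure ℝ).real (Set.Iic x) := by
  have h1 : ∀ l, p l * (σ l : Measure ℝ).real (Set.Iic x)
      = (if (l : ℕ) < (j : ℕ) then p l else 0)
        + if l = j then p j * (σ j : Measure ℝ).real (Set.Iic x) else 0 := by
    intro l
    rcases lt_trichotomy l j with hl | hl | hl
    · simp [real_Iic_eq_one hanti hc h hl hx, Fin.lt_def.1 hl, hl.ne]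
    · simp [hl]
    · simp [real_Iic_eq_zero hanti hp hc h hl hx, (Fin.lt_def.1 hl).not_gt, hl.ne']
  rw [h.eq_real, effortLaw_real hp, Finset.sum_congr rfl fun l _ => h1 l,
    Finset.sum_add_distrib, cut]
  simp

lemma mem_Icc_cut (hanti : StrictAnti θ) (hp : ∀ k, 0 < p k) (hc : IsCost c)
    (h : IsSettled θ p c v σ F) {j : Fin (L + 1)} {x : ℝ} (hx : x ∈ bestEfforts θ c v F j) :
    cut p j ≤ F x ∧ F x ≤ cut p (j + 1) := by
  rw [h.eq_cut_add hanti hp hc hx, cut_succ]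
  have h1 : (σ j : Measure ℝ).real (Set.Iic x) ≤ 1 := measureReal_le_one
  have h2 : 0 ≤ (σ j : Measure ℝ).real (Set.Iic x) := measureReal_nonneg
  have := hp j
  constructor
  · nlinarith
  · nlinarith

/-- Since `F` grows immediately to the right of `b`, efforts optimal for some type accumulate there.
Near `b` their quantiles lie inside the interval of type `k`, so the type is `k`, and `bestEfforts`
is closed. -/
lemma mem_bestEfforts_of_forall_lt (hanti : StrictAnti θ) (hp : ∀ k, 0 < p k)
    (hs : ∑ k, p k = 1) (hc : IsCost c)
    (h : IsSettled θ p c v σ F) {k : Fin (L + 1)} {b : ℝ} (h1 : cut p k ≤ F b)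
    (h2 : F b < cut p (k + 1)) (h3 : ∀ y, b < y → F b < F y) : b ∈ bestEfforts θ c v F k := by
  have := isProbabilityMeasure_effortLaw (σ := σ) hp hs
  by_contra hb
  have hev' : ∀ᶠ y in 𝓝 b, y ∉ bestEfforts θ c v F k :=
    (h.isClosed_bestEfforts hc k).isOpen_compl.mem_nhds hb
  have hev : ∀ᶠ y in 𝓝 b, y ∉ bestEfforts θ c v F k ∧ F y < cut p (k + 1) :=
    hev'.and
      (h.continuous.continuousAt.eventually_lt continuousAt_const h2)
  obtain ⟨y, hby, hy⟩ := (mem_nhdsGE_iff_exists_Icc_subset (a := b)).1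
    (mem_nhdsWithin_of_mem_nhds hev)
  have hpos : effortLaw p σ (Set.Ioc b y) ≠ 0 := by
    intro h0
    have h4 : F y = F b := by
      rw [h.eq_real, h.eq_real, ← Set.Iic_union_Ioc_eq_Iic (le_of_lt hby),
        measureReal_union (Set.Iic_disjoint_Ioc le_rfl) measurableSet_Ioc, measureReal_def _ (Set.Ioc b y), h0, ENNReal.toReal_zero, add_zero]
    exact (h3 y hby).ne' h4
  have hae : ∀ᵐ z ∂(effortLaw p σ), ∃ j, z ∈ bestEfforts θ c v F j :=
    ae_effortLaw fun j => (h.ae_best j).mono fun z hz => ⟨j, hz⟩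
  obtain ⟨z, hz, j, hj⟩ : ∃ z ∈ Set.Ioc b y, ∃ j, z ∈ bestEfforts θ c v F j := by
    by_contra! hcon
    exact hpos (measure_mono_null (fun z hz => by
      simpa using hcon z hz) (ae_iff.1 hae))
  have hzc := h.mem_Icc_cut hanti hp hc hj
  have hz1 := h3 z hz.1
  have hz2 := hy ⟨hz.1.le, hz.2⟩
  have hjk : j = k := by
    rcases lt_trichotomy j k with hjk | hjk | hjk
    · have := cut_mono hp (Nat.succ_le_of_lt (Fin.lt_def.1 hjk))
      simp only [Nat.succ_eq_add_one] at this
      linarith [hzc.2]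
    · exact hjk
    · have := cut_mono hp (Nat.succ_le_of_lt (Fin.lt_def.1 hjk))
      simp only [Nat.succ_eq_add_one] at this
      linarith [hzc.1, hz2.2]
  exact hz2.1 (hjk ▸ hj)

/-- On a flat stretch of `F`, the right end would be optimal for some type, although `b` wins
equally often at a lower cost. -/
lemma lt_of_lt (hθ : ∀ k, 0 < θ k) (hanti : StrictAnti θ) (hp : ∀ k, 0 < p k)
    (hs : ∑ k, p k = 1) (hc : IsCost c) (h : IsSettled θ p c v σ F) {b y : ℝ} (hb : 0 ≤ b)
    (h1 : F b < 1) (hby : b < y) : F b < F y := by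
  refine lt_of_le_of_ne (h.monotone hby.le) fun heq => ?_
  set S : Set ℝ := {z | F z = F b} with hS
  have hSc : IsClosed S := isClosed_eq h.continuous continuous_const
  have hyS : y ∈ S := heq.symm
  have hbdd : BddAbove S := by
    obtain ⟨w, hw⟩ := (h.tendsto.eventually_const_lt h1).exists
    refine ⟨w, fun z hz => ?_⟩
    by_contra! hlt
    have := h.monotone hlt.le
    rw [show F z = F b from hz] at this
    linarith
  have hb' := hSc.csSup_mem ⟨y, hyS⟩ hbdd
  have hyb := le_csSup hbdd hyS
  set b' := sSup S
  have hFb' : F b' = F b := hb'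
  obtain ⟨k, hk1, hk2⟩ := exists_mem_Ico_cut hs (h.nonneg b) h1
  have hmem : b' ∈ bestEfforts θ c v F k := by
    refine h.mem_bestEfforts_of_forall_lt hanti hp hs hc (hFb' ▸ hk1) (hFb' ▸ hk2) fun z hz => ?_
    refine lt_of_le_of_ne (h.monotone hz.le) fun heq' => ?_
    exact absurd (le_csSup hbdd (show z ∈ S from heq'.symm.trans hFb')) (not_le.2 hz)
  have h2 := hmem.2 b hb
  have h3 := hc.strictMonoOn hb hmem.1 (hby.trans_le hyb)
  rw [hFb'] at h2
  have := mul_lt_mul_of_pos_left h3 (hθ k)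
  linarith

lemma mem_bestEfforts (hθ : ∀ k, 0 < θ k) (hanti : StrictAnti θ) (hp : ∀ k, 0 < p k)
    (hs : ∑ k, p k = 1) (hc : IsCost c) (h : IsSettled θ p c v σ F) {k : Fin (L + 1)} {b : ℝ}
    (hb : 0 ≤ b) (h1 : cut p k ≤ F b) (h2 : F b < cut p (k + 1)) :
    b ∈ bestEfforts θ c v F k :=
  h.mem_bestEfforts_of_forall_lt hanti hp hs hc h1 h2 fun _ hy =>
    h.lt_of_lt hθ hanti hp hs hc hb (h2.trans_le (cut_le_one hp hs (by omega))) hy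

lemma apply_of_neg (h : IsSettled θ p c v σ F) (k : Fin (L + 1)) {x : ℝ} (hx : x < 0) :
    (σ k : Measure ℝ) (Set.Iic x) = 0 := by
  refine measure_mono_null (fun z hz => ?_) (ae_iff.1 (h.ae_best k))
  intro hz'
  exact absurd (hz'.1.trans hz) (not_le.2 hx)

lemma zero_eq_zero (h : IsSettled θ p c v σ F) : F 0 = 0 := by
  rw [h.eq_real, ← Set.Iio_union_right, measureReal_def]
  have h1 : effortLaw p σ (Set.Iio 0) = 0 := by
    have : ∀ᵐ x ∂(effortLaw p σ), 0 ≤ x :=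
      ae_effortLaw fun k => (h.ae_best k).mono fun x hx => hx.1
    rw [ae_iff] at this
    simpa [Set.Iio] using this
  rw [measure_union_null h1 (h.singleton 0), ENNReal.toReal_zero]

/-- Just to the right of each `z`, the efforts are all optimal for one type `k`, so cost increments
are `1 / θ k` times prize increments, which are increments of the sweep. Thus `c - costCurve θ p v ∘
F` has right derivative zero and is constant; `F` itself need not be differentiated. -/
lemma cost_eq_of_forall_lt (hθ : ∀ k, 0 < θ k) (hanti : StrictAnti θ) (hp : ∀ k, 0 < p k)
    (hs : ∑ k, p k = 1) (hc : IsCost c) (hv : v ∈ contests N) (h : IsSettled θ p c v σ F) {x : ℝ}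
    (hx : 0 ≤ x) (h1 : ∀ z, 0 ≤ z → z < x → F z < 1) : c x = costCurve θ p v (F x) := by
  set G : ℝ → ℝ := fun z => c (max z 0) - costCurve θ p v (F z) with hG
  have hGc : Continuous G :=
    hc.continuous_comp_max.sub ((continuous_costCurve v).comp h.continuous)
  have hder : ∀ z ∈ Set.Ico 0 x, HasDerivWithinAt G 0 (Set.Ici z) z := by
    intro z hz
    obtain ⟨k, hk1, hk2⟩ := exists_mem_Ico_cut hs (h.nonneg z) (h1 z hz.1 hz.2)
    have hev : ∀ᶠ y in 𝓝[≥] z, G y = G z := by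
      filter_upwards [self_mem_nhdsWithin, mem_nhdsWithin_of_mem_nhds
        (h.continuous.continuousAt.eventually_lt continuousAt_const hk2)] with y hy hyF
      have hzy : z ≤ y := hy
      have hy0 := hz.1.trans hzy
      have hFzy := h.monotone hzy
      have m1 := h.mem_bestEfforts hθ hanti hp hs hc hz.1 hk1 hk2
      have m2 := h.mem_bestEfforts hθ hanti hp hs hc hy0 (hk1.trans hFzy) hyF
      have e1 := le_antisymm (m1.2 y hy0) (m2.2 z hz.1)
      have hm := (strictMonoOn_curve hv).monotoneOn
      have e2 := le_sweep_sub (h := curve v) hθ hanti hp hs hm k hk1 hFzy (h.le_one y)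
      have e3 := sweep_sub_le (h := curve v) hθ hanti hp hs hm k (h.nonneg z) hFzy
        (le_of_lt hyF)
      have e4 : 1 / θ k * (curve v (F y) - curve v (F z)) = c y - c z := by
        rw [one_div_mul_eq_div, div_eq_iff (hθ k).ne']
        linarith
      simp only [hG, max_eq_left hz.1, max_eq_left hy0, costCurve]
      linarith
    exact (hasDerivWithinAt_const z (Set.Ici z) (G z)).congr_of_eventuallyEq hev rfl
  have := constant_of_has_deriv_right_zero hGc.continuousOn hder x ⟨hx, le_rfl⟩
  simp only [hG, max_eq_left hx, max_self, hc.zero, h.zero_eq_zero, costCurve_zero hp,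
    sub_self] at this
  linarith

/-- The equilibrium distribution of efforts is determined by the cost of effort. -/
lemma costCurve_eq_min (hθ : ∀ k, 0 < θ k) (hanti : StrictAnti θ) (hp : ∀ k, 0 < p k)
    (hs : ∑ k, p k = 1) (hc : IsCost c) (hv : v ∈ contests N) (h : IsSettled θ p c v σ F) {x : ℝ}
    (hx : 0 ≤ x) : costCurve θ p v (F x) = min (c x) (costCurve θ p v 1) := by
  have hmono := (strictMonoOn_costCurve (θ := θ) (p := p) hθ hanti hp hs hv).monotoneOn
  rcases lt_or_eq_of_le (h.le_one x) with hlt | heq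
  · have h1 := h.cost_eq_of_forall_lt hθ hanti hp hs hc hv hx fun z _ hzx =>
      (h.monotone hzx.le).trans_lt hlt
    rw [h1, min_eq_left (hmono ⟨h.nonneg x, h.le_one x⟩ ⟨zero_le_one, le_rfl⟩ hlt.le)]
  · set S : Set ℝ := {z | 0 ≤ z ∧ F z = 1}
    have hSc : IsClosed S := isClosed_Ici.inter (isClosed_eq h.continuous continuous_const)
    have hbdd : BddBelow S := ⟨0, fun z hz => hz.1⟩
    have hmem := hSc.csInf_mem ⟨x, hx, heq⟩ hbdd
    have hle : sInf S ≤ x := csInf_le hbdd ⟨hx, heq⟩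
    have h1 := h.cost_eq_of_forall_lt hθ hanti hp hs hc hv hmem.1 fun z hz hzx =>
      lt_of_le_of_ne (h.le_one z) fun hz1 => absurd (csInf_le hbdd ⟨hz, hz1⟩) (not_le.2 hzx)
    rw [hmem.2] at h1
    rw [heq, min_eq_right]
    rw [← h1]
    exact hc.strictMonoOn.monotoneOn hmem.1 hx hle

/-- The types fill their quantile intervals in order, so the common distribution function `F`
determines the law of each type. -/
lemma mul_real_Iic (hθ : ∀ k, 0 < θ k) (hanti : StrictAnti θ) (hp : ∀ k, 0 < p k)
    (hs : ∑ k, p k = 1) (hc : IsCost c) (h : IsSettled θ p c v σ F) {x : ℝ}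
    (hx : 0 ≤ x) (k : Fin (L + 1)) :
    p k * (σ k : Measure ℝ).real (Set.Iic x)
      = max (cut p k) (min (F x) (cut p (k + 1))) - cut p k := by
  have hck := cut_lt_succ hp k
  rcases lt_or_eq_of_le (h.le_one x) with hlt | heq
  · obtain ⟨j, hj1, hj2⟩ := exists_mem_Ico_cut hs (h.nonneg x) hlt
    have hm := h.mem_bestEfforts hθ hanti hp hs hc hx hj1 hj2
    rcases lt_trichotomy k j with hkj | hkj | hkj
    · have h1 : cut p (k + 1) ≤ F x :=
        (cut_mono hp (Nat.succ_le_of_lt (Fin.lt_def.1 hkj))).trans hj1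
      rw [h.real_Iic_eq_one hanti hc hkj hm, min_eq_right h1, max_eq_right hck.le, cut_succ]
      ring
    · subst hkj
      rw [min_eq_left hj2.le, max_eq_right hj1, h.eq_cut_add hanti hp hc hm]
      ring
    · have h1 : F x ≤ cut p k :=
        hj2.le.trans (cut_mono hp (Nat.succ_le_of_lt (Fin.lt_def.1 hkj)))
      rw [h.real_Iic_eq_zero hanti hp hc hkj hm, max_eq_left ((min_le_left _ _).trans h1)]
      ring
  -- When `F x = 1`, the termwise bounds by `p l` add up to an equality, so each of them is one.
  · have h1 : ∑ l, p l * (σ l : Measure ℝ).real (Set.Iic x) = ∑ l, p l := by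
      rw [← effortLaw_real hp, ← h.eq_real, heq, hs]
    have h2 := (Finset.sum_eq_sum_iff_of_le fun l _ =>
      mul_le_of_le_one_right (hp l).le measureReal_le_one).1 h1 k (Finset.mem_univ k)
    rw [h2, heq, min_eq_right (cut_le_one hp hs (by omega)), max_eq_right hck.le, cut_succ]
    ring

end IsSettled

theorem IsSymmetricEquilibrium.unique (hθ : ∀ k, 0 < θ k) (hanti : StrictAnti θ)
    (hp : ∀ k, 0 < p k) (hs : ∑ k, p k = 1) (hc : IsCost c) (hv : v ∈ contests N)
    {τ : Fin (L + 1) → ProbabilityMeasure ℝ}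
    (hσ : IsSymmetricEquilibrium (fun k x => θ k * c x) p v σ)
    (hτ : IsSymmetricEquilibrium (fun k x => θ k * c x) p v τ) : σ = τ := by
  have h := hσ.isSettled hp hs hc hv
  have h' := hτ.isSettled hp hs hc hv
  funext k
  refine Subtype.ext (Measure.ext_of_Iic (σ k : Measure ℝ) (τ k) fun x => ?_)
  rcases lt_or_ge x 0 with hx | hx
  · exact (h.apply_of_neg k hx).trans (h'.apply_of_neg k hx).symm
  · have hF : cdf (effortLaw p σ) x = cdf (effortLaw p τ) x :=
      (strictMonoOn_costCurve (θ := θ) (p := p) hθ hanti hp hs hv).injOn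
        ⟨h.nonneg x, h.le_one x⟩ ⟨h'.nonneg x, h'.le_one x⟩
        ((h.costCurve_eq_min hθ hanti hp hs hc hv hx).trans
          (h'.costCurve_eq_min hθ hanti hp hs hc hv hx).symm)
    have h1 := h.mul_real_Iic hθ hanti hp hs hc hx k
    rw [hF, ← h'.mul_real_Iic hθ hanti hp hs hc hx k] at h1
    exact (measureReal_eq_measureReal_iff).1 (mul_left_cancel₀ (hp k).ne' h1)

end Uniqueness

end Contest

/-! ### Existence, and integral formulas for effort and utility. -/

namespace Contest

open MeasureTheory ProbabilityTheory Filter Topology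

/-- The equilibrium effort at the quantile `t` of the effort distribution. -/
noncomputable def effortCurve {N L : ℕ} (θ p : Fin (L + 1) → ℝ) (c : ℝ → ℝ) (v : Fin N → ℝ)
    (t : ℝ) : ℝ :=
  invCost c (costCurve θ p v t)

/-- The law of the effort of type `k`, whose quantile is uniform on the interval of type `k`. -/
noncomputable def strategyLaw {N L : ℕ} (θ p : Fin (L + 1) → ℝ) (c : ℝ → ℝ) (v : Fin N → ℝ)
    (k : Fin (L + 1)) : Measure ℝ :=
  ((ENNReal.ofReal (p k))⁻¹ • volume.restrict (Set.Ioc (cut p k) (cut p (k + 1)))).map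
    (effortCurve θ p c v)

section Existence

variable {N L : ℕ} {θ p : Fin (L + 1) → ℝ} {c : ℝ → ℝ} {v : Fin N → ℝ}

lemma continuous_effortCurve (hc : IsCost c) (v : Fin N → ℝ) :
    Continuous (effortCurve θ p c v) :=
  hc.continuous_invCost.comp (continuous_costCurve v)

lemma strictMonoOn_effortCurve (hθ : ∀ k, 0 < θ k) (hanti : StrictAnti θ) (hp : ∀ k, 0 < p k)
    (hs : ∑ k, p k = 1) (hc : IsCost c) (hv : v ∈ contests N) :
    StrictMonoOn (effortCurve θ p c v) (Set.Icc 0 1) :=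
  hc.strictMono_invCost.comp_strictMonoOn (strictMonoOn_costCurve hθ hanti hp hs hv)

lemma effortCurve_zero (hp : ∀ k, 0 < p k) (hc : IsCost c) (v : Fin N → ℝ) :
    effortCurve θ p c v 0 = 0 := by
  rw [effortCurve, costCurve_zero hp, hc.invCost_zero]

lemma effortCurve_nonneg (hθ : ∀ k, 0 < θ k) (hanti : StrictAnti θ) (hp : ∀ k, 0 < p k)
    (hs : ∑ k, p k = 1) (hc : IsCost c) (hv : v ∈ contests N) {t : ℝ}
    (ht : t ∈ Set.Icc (0 : ℝ) 1) : 0 ≤ effortCurve θ p c v t :=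
  hc.invCost_nonneg (costCurve_nonneg hθ hanti hp hs hv ht)

lemma cost_effortCurve (hθ : ∀ k, 0 < θ k) (hanti : StrictAnti θ) (hp : ∀ k, 0 < p k)
    (hs : ∑ k, p k = 1) (hc : IsCost c) (hv : v ∈ contests N) {t : ℝ}
    (ht : t ∈ Set.Icc (0 : ℝ) 1) : c (effortCurve θ p c v t) = costCurve θ p v t :=
  hc.cost_invCost (costCurve_nonneg hθ hanti hp hs hv ht)

lemma isProbabilityMeasure_strategyLaw (hp : ∀ k, 0 < p k) (hc : IsCost c) (v : Fin N → ℝ)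
    (k : Fin (L + 1)) : IsProbabilityMeasure (strategyLaw θ p c v k) := by
  constructor
  rw [strategyLaw, Measure.map_apply (continuous_effortCurve hc v).measurable MeasurableSet.univ]
  simp only [Set.preimage_univ, Measure.smul_apply, Measure.restrict_apply_univ, Real.volume_Ioc,
    smul_eq_mul, cut_succ, add_sub_cancel_left]
  exact ENNReal.inv_mul_cancel (ENNReal.ofReal_pos.2 (hp k)).ne' ENNReal.ofReal_ne_top

/-- The strategy with the laws `strategyLaw`. -/
noncomputable def strategy (hp : ∀ k, 0 < p k) (hc : IsCost c) (θ : Fin (L + 1) → ℝ)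
    (v : Fin N → ℝ) (k : Fin (L + 1)) : ProbabilityMeasure ℝ :=
  ⟨strategyLaw θ p c v k, isProbabilityMeasure_strategyLaw hp hc v k⟩

lemma sum_restrict_Ioc {a : ℕ → ℝ} (ha : Monotone a) (n : ℕ) :
    ∑ j ∈ Finset.range n, (volume : Measure ℝ).restrict (Set.Ioc (a j) (a (j + 1)))
      = volume.restrict (Set.Ioc (a 0) (a n)) := by
  induction n with
  | zero => simp
  | succ n ih =>
    rw [Finset.sum_range_succ, ih, ← Measure.restrict_union (Set.Ioc_disjoint_Ioc_of_le le_rfl)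
      measurableSet_Ioc, Set.Ioc_union_Ioc_eq_Ioc (ha (Nat.zero_le n)) (ha (Nat.le_succ n))]

lemma effortLaw_strategy (hp : ∀ k, 0 < p k) (hs : ∑ k, p k = 1) (hc : IsCost c)
    (v : Fin N → ℝ) : effortLaw p (strategy hp hc θ v)
      = (volume.restrict (Set.Ioc (0 : ℝ) 1)).map (effortCurve θ p c v) := by
  have hX := (continuous_effortCurve (θ := θ) (p := p) hc v).measurable
  have h1 := sum_restrict_Ioc (cut_mono hp) (L + 1)
  rw [cut_zero, cut_last hs, Finset.sum_range] at h1
  ext s hs'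
  rw [effortLaw_apply, ← h1, Measure.map_apply hX hs', Measure.finsetSum_apply]
  refine Finset.sum_congr rfl fun k _ => ?_
  change ENNReal.ofReal (p k) * strategyLaw θ p c v k s = _
  rw [strategyLaw, Measure.map_apply hX hs', Measure.smul_apply, smul_eq_mul, ← mul_assoc,
    ENNReal.mul_inv_cancel (ENNReal.ofReal_pos.2 (hp k)).ne' ENNReal.ofReal_ne_top, one_mul]

lemma effortLaw_strategy_singleton (hθ : ∀ k, 0 < θ k) (hanti : StrictAnti θ) (hp : ∀ k, 0 < p k)
    (hs : ∑ k, p k = 1) (hc : IsCost c) (hv : v ∈ contests N) (x : ℝ) :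
    effortLaw p (strategy hp hc θ v) {x} = 0 := by
  have hX := (continuous_effortCurve (θ := θ) (p := p) hc v).measurable
  rw [effortLaw_strategy hp hs, Measure.map_apply hX (measurableSet_singleton x),
    Measure.restrict_apply (hX (measurableSet_singleton x))]
  refine Set.Subsingleton.measure_zero (fun s hs' t ht => ?_) _
  exact (strictMonoOn_effortCurve hθ hanti hp hs hc hv).injOn ⟨hs'.2.1.le, hs'.2.2⟩
    ⟨ht.2.1.le, ht.2.2⟩ (hs'.1.trans ht.1.symm)

lemma effortLaw_strategy_Iio (hθ : ∀ k, 0 < θ k) (hanti : StrictAnti θ) (hp : ∀ k, 0 < p k)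
    (hs : ∑ k, p k = 1) (hc : IsCost c) (hv : v ∈ contests N) {t : ℝ}
    (ht : t ∈ Set.Icc (0 : ℝ) 1) :
    (effortLaw p (strategy hp hc θ v)).real (Set.Iio (effortCurve θ p c v t)) = t := by
  have hX := (continuous_effortCurve (θ := θ) (p := p) hc v).measurable
  have hm := strictMonoOn_effortCurve (θ := θ) hθ hanti hp hs hc hv
  have h1 : effortCurve θ p c v ⁻¹' Set.Iio (effortCurve θ p c v t) ∩ Set.Ioc 0 1
      = Set.Ioo 0 t := by
    ext s
    constructor
    · rintro ⟨h1, h2⟩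
      exact ⟨h2.1, (hm.lt_iff_lt ⟨h2.1.le, h2.2⟩ ht).1 h1⟩
    · rintro ⟨h1, h2⟩
      have h3 : s ∈ Set.Ioc (0 : ℝ) 1 := ⟨h1, h2.le.trans ht.2⟩
      exact ⟨(hm.lt_iff_lt ⟨h3.1.le, h3.2⟩ ht).2 h2, h3⟩
  rw [measureReal_def, effortLaw_strategy hp hs, Measure.map_apply hX measurableSet_Iio,
    Measure.restrict_apply (hX measurableSet_Iio), h1, Real.volume_Ioo, sub_zero,
    ENNReal.toReal_ofReal ht.1]

lemma payoff_strategy (hθ : ∀ k, 0 < θ k) (hanti : StrictAnti θ) (hp : ∀ k, 0 < p k)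
    (hs : ∑ k, p k = 1) (hc : IsCost c) (hv : v ∈ contests N) (k : Fin (L + 1)) {t : ℝ}
    (ht : t ∈ Set.Icc (0 : ℝ) 1) :
    payoff (fun k x => θ k * c x) p v (strategy hp hc θ v) k (effortCurve θ p c v t)
      = curve v t - θ k * costCurve θ p v t := by
  have := isProbabilityMeasure_effortLaw (σ := strategy hp hc θ v) hp hs
  rw [payoff, integral_award_eq_curve v (effortLaw_strategy_singleton hθ hanti hp hs hc hv _),
    effortLaw_strategy_Iio hθ hanti hp hs hc hv ht, cost_effortCurve hθ hanti hp hs hc hv ht]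

/-- A deviation up to the top effort amounts to choosing another quantile, where `sub_mul_sweep_le`
applies. Above the top effort the expected prize is no higher than at the top and the cost no lower.
-/
lemma payoff_strategy_le (hθ : ∀ k, 0 < θ k) (hanti : StrictAnti θ) (hp : ∀ k, 0 < p k)
    (hs : ∑ k, p k = 1) (hc : IsCost c) (hv : v ∈ contests N) (k : Fin (L + 1)) {t y : ℝ}
    (h1 : cut p k ≤ t) (h2 : t ≤ cut p (k + 1)) (hy : 0 ≤ y) :
    payoff (fun k x => θ k * c x) p v (strategy hp hc θ v) k y
      ≤ curve v t - θ k * costCurve θ p v t := by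
  have := isProbabilityMeasure_effortLaw (σ := strategy hp hc θ v) hp hs
  have hm := (strictMonoOn_curve hv).monotoneOn
  have hopt := fun s (hs' : s ∈ Set.Icc (0 : ℝ) 1) => sub_mul_sweep_le hθ hanti hp hs hm k h1 h2 hs'
  have h11 : (1 : ℝ) ∈ Set.Icc (0 : ℝ) 1 := ⟨zero_le_one, le_rfl⟩
  rcases le_total y (effortCurve θ p c v 1) with hle | hle
  · obtain ⟨s, hs', rfl⟩ := intermediate_value_Icc zero_le_one
      (continuous_effortCurve (θ := θ) (p := p) hc v).continuousOn
      ⟨(effortCurve_zero hp hc v).trans_le hy, hle⟩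
    rw [payoff_strategy hθ hanti hp hs hc hv k hs']
    exact hopt s hs'
  · refine le_trans ?_ (hopt 1 h11)
    rw [payoff, integral_award_eq_curve v (effortLaw_strategy_singleton hθ hanti hp hs hc hv _)]
    have h3 : c (effortCurve θ p c v 1) ≤ c y :=
      hc.strictMonoOn.monotoneOn (effortCurve_nonneg hθ hanti hp hs hc hv h11) hy hle
    rw [cost_effortCurve hθ hanti hp hs hc hv h11] at h3
    exact sub_le_sub (hm ⟨measureReal_nonneg, measureReal_le_one⟩ h11 measureReal_le_one)
      (mul_le_mul_of_nonneg_left h3 (hθ k).le)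

lemma ae_strategy (hp : ∀ k, 0 < p k) (hc : IsCost c) (v : Fin N → ℝ) (k : Fin (L + 1)) :
    ∀ᵐ x ∂(strategy hp hc θ v k : Measure ℝ),
      x ∈ effortCurve θ p c v '' Set.Icc (cut p k) (cut p (k + 1)) := by
  have hX := continuous_effortCurve (θ := θ) (p := p) hc v
  change ∀ᵐ x ∂(strategyLaw θ p c v k), _
  rw [strategyLaw]
  refine (ae_map_iff
    (p := fun x => x ∈ effortCurve θ p c v '' Set.Icc (cut p k) (cut p (k + 1)))
    hX.measurable.aemeasurable (isCompact_Icc.image hX).isClosed.measurableSet).2 ?_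
  refine Measure.ae_smul_measure ?_ _
  filter_upwards [ae_restrict_mem measurableSet_Ioc] with t ht
  exact Set.mem_image_of_mem _ ⟨ht.1.le, ht.2⟩

lemma mem_Icc_of_cut (hp : ∀ k, 0 < p k) (hs : ∑ k, p k = 1) (k : Fin (L + 1)) {t : ℝ}
    (ht : t ∈ Set.Icc (cut p k) (cut p (k + 1))) : t ∈ Set.Icc (0 : ℝ) 1 :=
  ⟨(cut_nonneg hp _).trans ht.1, ht.2.trans (cut_le_one hp hs (by omega))⟩

theorem isSymmetricEquilibrium_strategy (hθ : ∀ k, 0 < θ k) (hanti : StrictAnti θ)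
    (hp : ∀ k, 0 < p k) (hs : ∑ k, p k = 1) (hc : IsCost c) (hv : v ∈ contests N) :
    IsSymmetricEquilibrium (fun k x => θ k * c x) p v (strategy hp hc θ v) := by
  intro k
  filter_upwards [ae_strategy hp hc v k]
  rintro _ ⟨t, ht, rfl⟩
  have ht' := mem_Icc_of_cut hp hs k ht
  refine ⟨effortCurve_nonneg hθ hanti hp hs hc hv ht', fun y hy => ?_⟩
  rw [payoff_strategy hθ hanti hp hs hc hv k ht']
  exact payoff_strategy_le hθ hanti hp hs hc hv k ht.1 ht.2 hy

lemma equilibrium_eq (hθ : ∀ k, 0 < θ k) (hanti : StrictAnti θ)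
    (hp : ∀ k, 0 < p k) (hs : ∑ k, p k = 1) (hc : IsCost c) (hv : v ∈ contests N) :
    equilibrium (fun k x => θ k * c x) p v = strategy hp hc θ v := by
  have h := isSymmetricEquilibrium_strategy hθ hanti hp hs hc hv
  exact IsSymmetricEquilibrium.unique hθ hanti hp hs hc hv (Classical.epsilon_spec ⟨_, h⟩) h

lemma expectedEffort_eq (hθ : ∀ k, 0 < θ k) (hanti : StrictAnti θ)
    (hp : ∀ k, 0 < p k) (hs : ∑ k, p k = 1) (hc : IsCost c) (hv : v ∈ contests N) :
    expectedEffort (fun k x => θ k * c x) p v = ∫ t in (0 : ℝ)..1, effortCurve θ p c v t := by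
  have hX := continuous_effortCurve (θ := θ) (p := p) hc v
  have h1 : ∀ k : Fin (L + 1), p k * ∫ x, x ∂(strategy hp hc θ v k : Measure ℝ)
      = ∫ t in (cut p k)..(cut p (k + 1)), effortCurve θ p c v t := by
    intro k
    change p k * ∫ x, x ∂(strategyLaw θ p c v k) = _
    rw [strategyLaw, integral_map (f := fun x : ℝ => x) hX.measurable.aemeasurable
      measurable_id.aestronglyMeasurable, integral_smul_measure,
      intervalIntegral.integral_of_le (cut_lt_succ hp k).le, ENNReal.toReal_inv,
      ENNReal.toReal_ofReal (hp k).le, smul_eq_mul, mul_inv_cancel_left₀ (hp k).ne']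
  have h2 := intervalIntegral.sum_integral_adjacent_intervals (a := cut p) (n := L + 1)
    (f := effortCurve θ p c v) (μ := volume) fun k _ => hX.intervalIntegrable _ _
  rw [cut_zero, cut_last hs, Finset.sum_range] at h2
  rw [expectedEffort, equilibrium_eq hθ hanti hp hs hc hv, ← h2]
  exact Finset.sum_congr rfl fun k _ => h1 k

/-- The payoff is constant on the type's interval, so it can be read off at the quantile `1`. -/
lemma equilibriumUtility_last (hθ : ∀ k, 0 < θ k) (hanti : StrictAnti θ)
    (hp : ∀ k, 0 < p k) (hs : ∑ k, p k = 1) (hc : IsCost c) (hv : v ∈ contests N) :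
    equilibriumUtility (fun k x => θ k * c x) p (Fin.last L) v
      = curve v 1 - θ (Fin.last L) * costCurve θ p v 1 := by
  rw [equilibriumUtility, equilibrium_eq hθ hanti hp hs hc hv]
  have hm := (strictMonoOn_curve hv).monotoneOn
  have h1 : ∀ᵐ x ∂(strategy hp hc θ v (Fin.last L) : Measure ℝ),
      payoff (fun k x => θ k * c x) p v (strategy hp hc θ v) (Fin.last L) x
        = curve v 1 - θ (Fin.last L) * costCurve θ p v 1 := by
    filter_upwards [ae_strategy hp hc v (Fin.last L)]
    rintro _ ⟨t, ht, rfl⟩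
    have ht' := mem_Icc_of_cut hp hs _ ht
    have h2 : cut p ((Fin.last L : ℕ) + 1) = 1 := cut_last hs
    rw [payoff_strategy hθ hanti hp hs hc hv _ ht']
    exact le_antisymm
      (sub_mul_sweep_le hθ hanti hp hs hm (Fin.last L) (h2 ▸ (cut_lt_succ hp _).le) h2.ge ht')
      (sub_mul_sweep_le hθ hanti hp hs hm (Fin.last L) ht.1 ht.2 ⟨zero_le_one, le_rfl⟩)
  rw [integral_congr_ae h1]
  simp

end Existence

end Contest

/-! ### Supporting slopes of the cost function and finite transfers. -/

namespace Contest

open MeasureTheory Filter Topology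

section Slopes

variable {c : ℝ → ℝ} {x₀ d : ℝ} {S : Set ℝ}

/-- The slope of the chord from `x₀` to `a` lies between `d` and the slope of the chord from `a` to
`b`, so a derivative is needed at `x₀` only. -/
lemma mul_sub_le_of_convexOn (h : ConvexOn ℝ S c) (hx₀ : x₀ ∈ S)
    (hd : HasDerivWithinAt c d S x₀) {a b : ℝ} (ha : a ∈ S) (hb : b ∈ S) (hxa : x₀ ≤ a)
    (hab : a ≤ b) : d * (b - a) ≤ c b - c a := by
  rcases hab.eq_or_lt with rfl | hab
  · simp
  rw [← le_div_iff₀ (sub_pos.2 hab)]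
  rcases hxa.eq_or_lt with rfl | hxa
  · simpa [slope_def_field] using h.le_slope_of_hasDerivWithinAt hx₀ hb hab hd
  · have h1 := h.le_slope_of_hasDerivWithinAt hx₀ ha hxa hd
    rw [slope_def_field] at h1
    exact h1.trans (h.slope_mono_adjacent hx₀ hb hxa hab)

lemma sub_le_mul_of_convexOn (h : ConvexOn ℝ S c) (hx₀ : x₀ ∈ S)
    (hd : HasDerivWithinAt c d S x₀) {a b : ℝ} (ha : a ∈ S) (hb : b ∈ S) (hab : a ≤ b)
    (hbx : b ≤ x₀) : c b - c a ≤ d * (b - a) := by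
  rcases hab.eq_or_lt with rfl | hab
  · simp
  rw [← div_le_iff₀ (sub_pos.2 hab)]
  rcases hbx.eq_or_lt with rfl | hbx
  · simpa [slope_def_field] using h.slope_le_of_hasDerivWithinAt ha hx₀ hab hd
  · have h1 := h.slope_le_of_hasDerivWithinAt hb hx₀ hbx hd
    rw [slope_def_field] at h1
    exact (h.slope_mono_adjacent ha hx₀ hab hbx).trans h1

lemma sub_le_mul_of_concaveOn (h : ConcaveOn ℝ S c) (hx₀ : x₀ ∈ S)
    (hd : HasDerivWithinAt c d S x₀) {a b : ℝ} (ha : a ∈ S) (hb : b ∈ S) (hxa : x₀ ≤ a)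
    (hab : a ≤ b) : c b - c a ≤ d * (b - a) := by
  have := mul_sub_le_of_convexOn h.neg hx₀ hd.neg ha hb hxa hab
  simp only [Pi.neg_apply] at this
  linarith

lemma mul_sub_le_of_concaveOn (h : ConcaveOn ℝ S c) (hx₀ : x₀ ∈ S)
    (hd : HasDerivWithinAt c d S x₀) {a b : ℝ} (ha : a ∈ S) (hb : b ∈ S) (hab : a ≤ b)
    (hbx : b ≤ x₀) : d * (b - a) ≤ c b - c a := by
  have := sub_le_mul_of_convexOn h.neg hx₀ hd.neg ha hb hab hbx
  simp only [Pi.neg_apply] at this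
  linarith

lemma IsCost.hasDerivWithinAt (hc : IsCost c) {x : ℝ} (hx : 0 < x) :
    HasDerivWithinAt c (deriv c x) (Set.Ici 0) x :=
  (hc.differentiableAt x hx).hasDerivAt.hasDerivWithinAt

/-- A lower bound `d` for the chord slopes of `c` is an upper bound `1 / d` for those of its
inverse. -/
lemma IsCost.abs_invCost_sub_le (hc : IsCost c) (hd : 0 < d) {s : Set ℝ}
    (h : ∀ a ∈ s, ∀ b ∈ s, a ≤ b → d * (b - a) ≤ c b - c a) {y z : ℝ} (hy : 0 ≤ y) (hz : 0 ≤ z)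
    (hys : invCost c y ∈ s) (hzs : invCost c z ∈ s) :
    |invCost c y - invCost c z| ≤ 1 / d * |y - z| := by
  rw [one_div_mul_eq_div, le_div_iff₀ hd, mul_comm]
  rcases le_total y z with hyz | hyz
  · have h1 := hc.strictMono_invCost.monotone hyz
    have h2 := h _ hys _ hzs h1
    rw [hc.cost_invCost hy, hc.cost_invCost hz] at h2
    rw [abs_of_nonpos (by linarith), abs_of_nonpos (by linarith)]
    linarith
  · have h1 := hc.strictMono_invCost.monotone hyz
    have h2 := h _ hzs _ hys h1
    rw [hc.cost_invCost hy, hc.cost_invCost hz] at h2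
    rw [abs_of_nonneg (by linarith), abs_of_nonneg (by linarith)]
    linarith

/-- The inverse of a concave cost function is locally Lipschitz. -/
lemma IsCost.exists_lipschitz_of_concaveOn (hc : IsCost c) (h : ConcaveOn ℝ (Set.Ici 0) c)
    (M : ℝ) : ∃ K, 0 ≤ K ∧ ∀ y ∈ Set.Icc 0 M, ∀ z ∈ Set.Icc 0 M,
      |invCost c y - invCost c z| ≤ K * |y - z| := by
  -- By concavity the slope at `X` bounds all chord slopes on `[0, X]` from below; `|M| + 1` keeps
  -- `X` positive for every `M`.
  set X := invCost c (|M| + 1)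
  have hX : 0 < X := hc.invCost_pos (by positivity)
  refine ⟨1 / deriv c X, one_div_nonneg.2 (hc.deriv_pos X hX).le, fun y hy z hz => ?_⟩
  have hle : ∀ y ∈ Set.Icc 0 M, invCost c y ∈ Set.Icc 0 X := fun y hy =>
    ⟨hc.invCost_nonneg hy.1, hc.strictMono_invCost.monotone
      (hy.2.trans ((le_abs_self M).trans (by linarith)))⟩
  exact hc.abs_invCost_sub_le (s := Set.Icc 0 X) (hc.deriv_pos X hX) (fun a ha b hb hab =>
    mul_sub_le_of_concaveOn h hX.le (hc.hasDerivWithinAt hX) ha.1 hb.1 hab hb.2) hy.1 hz.1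
    (hle y hy) (hle z hz)

/-- The inverse of a convex cost function with positive slope at zero is Lipschitz. -/
lemma IsCost.exists_lipschitz_of_convexOn (hc : IsCost c) (h : ConvexOn ℝ (Set.Ici 0) c)
    (h0 : 0 < derivWithin c (Set.Ici 0) 0) (M : ℝ) :
    ∃ K, 0 ≤ K ∧ ∀ y ∈ Set.Icc 0 M, ∀ z ∈ Set.Icc 0 M,
      |invCost c y - invCost c z| ≤ K * |y - z| := by
  have hd := (differentiableWithinAt_of_derivWithin_ne_zero h0.ne').hasDerivWithinAt
  exact ⟨1 / derivWithin c (Set.Ici 0) 0, one_div_nonneg.2 h0.le, fun y hy z hz =>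
    hc.abs_invCost_sub_le (s := Set.Ici 0) h0 (fun a ha b hb hab =>
      mul_sub_le_of_convexOn h Set.self_mem_Ici hd ha hb ha hab) hy.1 hz.1
      (hc.invCost_nonneg hy.1) (hc.invCost_nonneg hz.1)⟩

/-- The inverse of a convex cost function is Lipschitz away from zero. -/
lemma IsCost.abs_invCost_sub_le_of_convexOn (hc : IsCost c) (h : ConvexOn ℝ (Set.Ici 0) c)
    {y₀ y z : ℝ} (h0 : 0 < y₀) (hy : y₀ ≤ y) (hz : y₀ ≤ z) :
    |invCost c y - invCost c z| ≤ invCost c y₀ / y₀ * |y - z| := by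
  have hx := hc.invCost_pos h0
  have hd := hc.hasDerivWithinAt hx
  have hdpos := hc.deriv_pos _ hx
  -- With `c 0 = 0`, convexity gives `c x ≤ c' x * x`; hence `1 / c' x ≤ x / c x`, which is the
  -- stated constant.
  have h1 := sub_le_mul_of_convexOn h hx.le hd Set.self_mem_Ici hx.le hx.le le_rfl
  rw [hc.cost_invCost h0.le, hc.zero, sub_zero, sub_zero] at h1
  refine (hc.abs_invCost_sub_le (s := Set.Ici (invCost c y₀)) hdpos (fun a ha b hb hab =>
    mul_sub_le_of_convexOn h hx.le hd (hx.le.trans ha) (hx.le.trans hb) ha hab)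
    (h0.le.trans hy) (h0.le.trans hz) (hc.strictMono_invCost.monotone hy)
    (hc.strictMono_invCost.monotone hz)).trans (mul_le_mul_of_nonneg_right ?_ (abs_nonneg _))
  rw [div_le_div_iff₀ hdpos h0]
  linarith

end Slopes

section Transfer

variable {N L : ℕ} {θ p : Fin (L + 1) → ℝ} {c : ℝ → ℝ} {v : Fin N → ℝ} {i' i : Fin N} {ε : ℝ}

lemma integral_sweep_sub (hp : ∀ k, 0 < p k) (hs : ∑ k, p k = 1) (i' i : Fin N) :
    ∫ t in (0 : ℝ)..1, (sweep θ p (binom N (i + 1)) t - sweep θ p (binom N (i' + 1)) t)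
      = alpha N θ p (i + 1) - alpha N θ p (i' + 1) := by
  have h : ∀ j : Fin N, IntervalIntegrable (sweep θ p (binom N (j + 1))) volume 0 1 := fun j =>
    (continuous_sweep (continuous_binom _ _)).intervalIntegrable _ _
  rw [intervalIntegral.integral_sub (h i) (h i'), integral_sweep_binom hp hs i.2,
    integral_sweep_binom hp hs i'.2]

lemma integral_mul_effortCurve_sub (hc : IsCost c) (d : ℝ) (v w : Fin N → ℝ) :
    ∫ t in (0 : ℝ)..1, d * (effortCurve θ p c w t - effortCurve θ p c v t)
      = d * ((∫ t in (0 : ℝ)..1, effortCurve θ p c w t)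
        - ∫ t in (0 : ℝ)..1, effortCurve θ p c v t) := by
  rw [intervalIntegral.integral_const_mul, intervalIntegral.integral_sub]
  · exact (continuous_effortCurve hc w).intervalIntegrable _ _
  · exact (continuous_effortCurve hc v).intervalIntegrable _ _

/-- The supporting line of the cost function at a single effort orders the costs of a transfer,
because the transfer moves efforts away from this effort. -/
lemma exists_transfer_slope (hθ : ∀ k, 0 < θ k) (hanti : StrictAnti θ) (hp : ∀ k, 0 < p k)
    (hs : ∑ k, p k = 1) (hc : IsCost c) (hv : v ∈ contests N) (hi : i' < i) (hε : 0 ≤ ε)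
    (h : (i : ℕ) + 1 = N ∨ utilityShift N θ p (i' + 1) (i + 1) ≤ 0) :
    ∃ x₀ : ℝ, 0 < x₀ ∧ ∀ t ∈ Set.Icc (0 : ℝ) 1,
      (effortCurve θ p c (transfer v i' i ε) t ≤ effortCurve θ p c v t ∧
        effortCurve θ p c v t ≤ x₀) ∨
      (x₀ ≤ effortCurve θ p c v t ∧
        effortCurve θ p c v t ≤ effortCurve θ p c (transfer v i' i ε) t) := by
  obtain ⟨t₀, h0, h1, h2, h3⟩ := exists_crossing_sweep hθ hp hs hi h
  have hmono := (strictMonoOn_effortCurve (θ := θ) hθ hanti hp hs hc hv).monotoneOn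
  refine ⟨effortCurve θ p c v t₀, hc.invCost_pos (costCurve_pos hθ hanti hp hs hv h0 h1),
    fun t ht => ?_⟩
  rcases le_or_gt t t₀ with htt | htt
  · refine Or.inl ⟨hc.strictMono_invCost.monotone ?_, hmono ht ⟨h0.le, h1⟩ htt⟩
    rw [costCurve_transfer]
    linarith [mul_nonpos_of_nonneg_of_nonpos hε (h2 t ⟨ht.1, htt⟩)]
  · refine Or.inr ⟨hmono ⟨h0.le, h1⟩ ht htt.le, hc.strictMono_invCost.monotone ?_⟩
    rw [costCurve_transfer]
    linarith [mul_nonneg hε (h3 t ⟨htt, ht.2⟩)]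

lemma cost_effortCurve_transfer (hθ : ∀ k, 0 < θ k) (hanti : StrictAnti θ) (hp : ∀ k, 0 < p k)
    (hs : ∑ k, p k = 1) (hc : IsCost c) (hv : v ∈ contests N)
    (hw : transfer v i' i ε ∈ contests N) {t : ℝ} (ht : t ∈ Set.Icc (0 : ℝ) 1) :
    c (effortCurve θ p c (transfer v i' i ε) t) - c (effortCurve θ p c v t)
      = ε * (sweep θ p (binom N (i + 1)) t - sweep θ p (binom N (i' + 1)) t) := by
  rw [cost_effortCurve hθ hanti hp hs hc hv ht, cost_effortCurve hθ hanti hp hs hc hw ht,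
    costCurve_transfer, add_sub_cancel_left]

/-- For concave `c` the chord slopes are at least `c' x₀` where efforts fall (below `x₀`) and at
most `c' x₀` where they rise (above `x₀`). In both cases the change of cost is at most `c' x₀` times
the change of effort, and the integral of the former is `ε (α_m - α_{m'})`. -/
lemma integral_effortCurve_le_transfer (hθ : ∀ k, 0 < θ k) (hanti : StrictAnti θ)
    (hp : ∀ k, 0 < p k) (hs : ∑ k, p k = 1) (hc : IsCost c) (hcc : ConcaveOn ℝ (Set.Ici 0) c)
    (hv : v ∈ contests N) (hi : i' < i) (hε : 0 ≤ ε) (hw : transfer v i' i ε ∈ contests N)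
    (h : (i : ℕ) + 1 = N ∨ utilityShift N θ p (i' + 1) (i + 1) ≤ 0)
    (hα : 0 ≤ alpha N θ p (i + 1) - alpha N θ p (i' + 1)) :
    ∫ t in (0 : ℝ)..1, effortCurve θ p c v t
      ≤ ∫ t in (0 : ℝ)..1, effortCurve θ p c (transfer v i' i ε) t := by
  obtain ⟨x₀, hx₀, hx⟩ := exists_transfer_slope hθ hanti hp hs hc hv hi hε h
  have hd := hc.deriv_pos x₀ hx₀
  have hder := hc.hasDerivWithinAt hx₀
  have hX : Continuous fun t =>
      deriv c x₀ * (effortCurve θ p c (transfer v i' i ε) t - effortCurve θ p c v t) :=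
    continuous_const.mul ((continuous_effortCurve hc _).sub (continuous_effortCurve hc v))
  have hD : Continuous fun t =>
      ε * (sweep θ p (binom N (i + 1)) t - sweep θ p (binom N (i' + 1)) t) :=
    continuous_const.mul ((continuous_sweep (continuous_binom _ _)).sub
      (continuous_sweep (continuous_binom _ _)))
  have key : ∀ t ∈ Set.Icc (0 : ℝ) 1,
      ε * (sweep θ p (binom N (i + 1)) t - sweep θ p (binom N (i' + 1)) t)
        ≤ deriv c x₀ * (effortCurve θ p c (transfer v i' i ε) t - effortCurve θ p c v t) := by
    intro t ht
    rw [← cost_effortCurve_transfer hθ hanti hp hs hc hv hw ht]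
    have n1 := effortCurve_nonneg hθ hanti hp hs hc hv ht
    have n2 := effortCurve_nonneg hθ hanti hp hs hc hw ht
    rcases hx t ht with ⟨h1, h2⟩ | ⟨h1, h2⟩
    · linarith [mul_sub_le_of_concaveOn hcc hx₀.le hder n2 n1 h1 h2]
    · exact sub_le_mul_of_concaveOn hcc hx₀.le hder n1 n2 h1 h2
  have hint := intervalIntegral.integral_mono_on (μ := volume) zero_le_one
    (hD.intervalIntegrable _ _)
    (hX.intervalIntegrable _ _) key
  rw [intervalIntegral.integral_const_mul, integral_sweep_sub hp hs,
    integral_mul_effortCurve_sub hc] at hint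
  have := nonneg_of_mul_nonneg_right ((mul_nonneg hε hα).trans hint) hd
  linarith

lemma transfer_le_integral_effortCurve (hθ : ∀ k, 0 < θ k) (hanti : StrictAnti θ)
    (hp : ∀ k, 0 < p k) (hs : ∑ k, p k = 1) (hc : IsCost c) (hcc : ConvexOn ℝ (Set.Ici 0) c)
    (hv : v ∈ contests N) (hi : i' < i) (hε : 0 ≤ ε) (hw : transfer v i' i ε ∈ contests N)
    (h : (i : ℕ) + 1 = N ∨ utilityShift N θ p (i' + 1) (i + 1) ≤ 0)
    (hα : alpha N θ p (i + 1) - alpha N θ p (i' + 1) ≤ 0) :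
    ∫ t in (0 : ℝ)..1, effortCurve θ p c (transfer v i' i ε) t
      ≤ ∫ t in (0 : ℝ)..1, effortCurve θ p c v t := by
  obtain ⟨x₀, hx₀, hx⟩ := exists_transfer_slope hθ hanti hp hs hc hv hi hε h
  have hd := hc.deriv_pos x₀ hx₀
  have hder := hc.hasDerivWithinAt hx₀
  have hX : Continuous fun t =>
      deriv c x₀ * (effortCurve θ p c (transfer v i' i ε) t - effortCurve θ p c v t) :=
    continuous_const.mul ((continuous_effortCurve hc _).sub (continuous_effortCurve hc v))
  have hD : Continuous fun t =>
      ε * (sweep θ p (binom N (i + 1)) t - sweep θ p (binom N (i' + 1)) t) :=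
    continuous_const.mul ((continuous_sweep (continuous_binom _ _)).sub
      (continuous_sweep (continuous_binom _ _)))
  have key : ∀ t ∈ Set.Icc (0 : ℝ) 1,
      deriv c x₀ * (effortCurve θ p c (transfer v i' i ε) t - effortCurve θ p c v t)
        ≤ ε * (sweep θ p (binom N (i + 1)) t - sweep θ p (binom N (i' + 1)) t) := by
    intro t ht
    rw [← cost_effortCurve_transfer hθ hanti hp hs hc hv hw ht]
    have n1 := effortCurve_nonneg hθ hanti hp hs hc hv ht
    have n2 := effortCurve_nonneg hθ hanti hp hs hc hw ht
    rcases hx t ht with ⟨h1, h2⟩ | ⟨h1, h2⟩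
    · linarith [sub_le_mul_of_convexOn hcc hx₀.le hder n2 n1 h1 h2]
    · exact mul_sub_le_of_convexOn hcc hx₀.le hder n1 n2 h1 h2
  have hint := intervalIntegral.integral_mono_on (μ := volume) zero_le_one
    (hX.intervalIntegrable _ _)
    (hD.intervalIntegrable _ _) key
  rw [integral_mul_effortCurve_sub hc, intervalIntegral.integral_const_mul,
    integral_sweep_sub hp hs] at hint
  have := nonpos_of_mul_nonpos_right (hint.trans (mul_nonpos_of_nonneg_of_nonpos hε hα)) hd
  linarith

end Transfer

end Contest

/-! ### Derivatives within the set of contests. -/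

namespace Contest

open MeasureTheory Filter Topology

section Directions

variable {N : ℕ} {v : Fin N → ℝ}

lemma hasDerivWithinAt_line {f : (Fin N → ℝ) → ℝ} {S : Set (Fin N → ℝ)}
    {A : (Fin N → ℝ) →L[ℝ] ℝ} (h : HasFDerivWithinAt f A S v) {b : Fin N → ℝ}
    (hb : ∀ s ∈ Set.Ioc (0 : ℝ) 1, v + s • b ∈ S) :
    HasDerivWithinAt (fun s : ℝ => f (v + s • b)) (A b) (Set.Ioc 0 1) 0 := by
  have h1 : HasDerivWithinAt (fun s : ℝ => v + s • b) b (Set.Ioc 0 1) 0 := by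
    simpa using (((hasDerivAt_id (0 : ℝ)).smul_const b).const_add v).hasDerivWithinAt
  have h2 : HasFDerivWithinAt f A S (v + (0 : ℝ) • b) := by simpa using h
  exact h2.comp_hasDerivWithinAt (0 : ℝ) h1 hb

lemma neBot_nhdsWithin_Ioc : (𝓝[Set.Ioc (0 : ℝ) 1] 0).NeBot := by
  rw [nhdsWithin_Ioc_eq_nhdsGT zero_lt_one]
  infer_instance

/-- Along a segment contained in `S` any derivative within `S` is the limit of difference quotients
of `f`, so its value there is forced without unique differentiability of `S`. -/
lemma fderivWithin_apply_eq {f : (Fin N → ℝ) → ℝ} {S : Set (Fin N → ℝ)}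
    {A : (Fin N → ℝ) →L[ℝ] ℝ} (h : HasFDerivWithinAt f A S v) {b : Fin N → ℝ}
    (hb : ∀ s ∈ Set.Ioc (0 : ℝ) 1, v + s • b ∈ S) : fderivWithin ℝ f S v b = A b := by
  have := neBot_nhdsWithin_Ioc
  have h1 := hasDerivWithinAt_line
    h.differentiableWithinAt.hasFDerivWithinAt hb
  have h2 := hasDerivWithinAt_line h hb
  have h0 : (0 : ℝ) ∉ Set.Ioc (0 : ℝ) 1 := by simp
  exact tendsto_nhds_unique ((hasDerivWithinAt_iff_tendsto_slope' h0).1 h1)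
    ((hasDerivWithinAt_iff_tendsto_slope' h0).1 h2)

lemma fderivWithin_apply_le {f : (Fin N → ℝ) → ℝ} {S : Set (Fin N → ℝ)}
    (h : DifferentiableWithinAt ℝ f S v) {a b : Fin N → ℝ}
    (ha : ∀ s ∈ Set.Ioc (0 : ℝ) 1, v + s • a ∈ S) (hb : ∀ s ∈ Set.Ioc (0 : ℝ) 1, v + s • b ∈ S)
    (hle : ∀ s ∈ Set.Ioc (0 : ℝ) 1, f (v + s • b) ≤ f (v + s • a)) :
    fderivWithin ℝ f S v b ≤ fderivWithin ℝ f S v a := by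
  have := neBot_nhdsWithin_Ioc
  have h1 := hasDerivWithinAt_line h.hasFDerivWithinAt hb
  have h2 := hasDerivWithinAt_line h.hasFDerivWithinAt ha
  have h0 : (0 : ℝ) ∉ Set.Ioc (0 : ℝ) 1 := by simp
  refine le_of_tendsto_of_tendsto ((hasDerivWithinAt_iff_tendsto_slope' h0).1 h1)
    ((hasDerivWithinAt_iff_tendsto_slope' h0).1 h2) ?_
  filter_upwards [self_mem_nhdsWithin] with s hs
  rw [slope_def_field, slope_def_field]
  simp only [zero_smul, add_zero, sub_zero]
  exact div_le_div_of_nonneg_right (sub_le_sub_right (hle s hs) _) hs.1.le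

open Classical in
/-- The direction in which the prizes in the up-closed set `P` grow, with constant gaps. -/
noncomputable def spread (P : Fin N → Prop) : Fin N → ℝ :=
  fun j => if P j then 2 * ((j : ℝ) + 1) else 0

lemma spread_of_not {P : Fin N → Prop} {j : Fin N} (h : ¬ P j) : spread P j = 0 := by
  simp [spread, h]

/-- The entries of a transfer direction lie in `[-1, 1]`, so gaps and entries of at least `2` on `P`
absorb it: adding it to `spread P` destroys neither monotonicity nor nonnegativity. -/
lemma spread_gap {P : Fin N → Prop} {j k : Fin N} (hjk : j < k) (hk : P k) : spread P j + 2 ≤ spread P k := by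
  have h1 : ((j : ℕ) : ℝ) + 1 ≤ (k : ℕ) := by exact_mod_cast Fin.lt_def.1 hjk
  have h2 : (0 : ℝ) ≤ (j : ℕ) := Nat.cast_nonneg _
  by_cases hj : P j <;> simp only [spread, hj, hk, if_true, if_false] <;> linarith

lemma two_le_spread {P : Fin N → Prop} {j : Fin N} (h : P j) : 2 ≤ spread P j := by
  have h2 : (0 : ℝ) ≤ (j : ℕ) := Nat.cast_nonneg _
  simp only [spread, h, if_true]
  linarith

lemma spread_nonneg (P : Fin N → Prop) (j : Fin N) : 0 ≤ spread P j := by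
  by_cases h : P j
  · linarith [two_le_spread h]
  · rw [spread_of_not h]

lemma monotone_spread {P : Fin N → Prop} (hP : ∀ j k, j ≤ k → P j → P k) :
    Monotone (spread P) := by
  intro j k hjk
  rcases hjk.eq_or_lt with rfl | hlt
  · exact le_rfl
  by_cases hk : P k
  · linarith [spread_gap hlt hk]
  · rw [spread_of_not hk, spread_of_not fun hj => hk (hP j k hjk hj)]

lemma abs_single_sub_single_le {i' i : Fin N} (hi : i' ≠ i) (j : Fin N) :
    |(Pi.single i 1 - Pi.single i' 1 : Fin N → ℝ) j| ≤ 1 := by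
  simp only [Pi.sub_apply, Pi.single_apply]
  split_ifs with h1 h2
  · exact absurd (h2.symm.trans h1) hi
  all_goals norm_num

lemma spread_add_of_not {P : Fin N → Prop} {i' i j : Fin N} (h' : P i') (h : P i) (hj : ¬ P j) :
    (spread P + (Pi.single i 1 - Pi.single i' 1) : Fin N → ℝ) j = 0 := by
  have h1 : j ≠ i := fun e => hj (e ▸ h)
  have h2 : j ≠ i' := fun e => hj (e ▸ h')
  simp [spread_of_not hj, h1, h2]

lemma spread_add_nonneg {P : Fin N → Prop} {i' i : Fin N} (hi : i' ≠ i) (h' : P i') (h : P i)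
    (j : Fin N) : 0 ≤ (spread P + (Pi.single i 1 - Pi.single i' 1) : Fin N → ℝ) j := by
  by_cases hj : P j
  · rw [Pi.add_apply]
    linarith [two_le_spread hj, (abs_le.1 (abs_single_sub_single_le hi j)).1]
  · rw [spread_add_of_not h' h hj]

lemma monotone_spread_add {P : Fin N → Prop} (hP : ∀ j k, j ≤ k → P j → P k) {i' i : Fin N}
    (hi : i' ≠ i) (h' : P i') (h : P i) :
    Monotone (spread P + (Pi.single i 1 - Pi.single i' 1)) := by
  intro j k hjk
  rcases hjk.eq_or_lt with rfl | hlt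
  · exact le_rfl
  by_cases hk : P k
  · rw [Pi.add_apply, Pi.add_apply]
    linarith [spread_gap hlt hk, (abs_le.1 (abs_single_sub_single_le hi j)).2,
      (abs_le.1 (abs_single_sub_single_le hi k)).1]
  · rw [spread_add_of_not h' h hk, spread_add_of_not h' h fun hj => hk (hP j k hjk hj)]

lemma add_smul_mem_contests (hv : v ∈ contests N) {b : Fin N → ℝ} (h0 : ∀ j, 0 ≤ b j)
    (hb : Monotone b) {s : ℝ} (hs : 0 ≤ s) : v + s • b ∈ contests N := by
  obtain ⟨i, hi⟩ := hv.2.2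
  refine ⟨fun j => add_nonneg (hv.1 j) (mul_nonneg hs (h0 j)), fun j k hjk => ?_, i, ?_⟩
  · exact add_le_add (hv.2.1 hjk) (mul_le_mul_of_nonneg_left (hb hjk) hs)
  · exact add_pos_of_pos_of_nonneg hi (mul_nonneg hs (h0 i))

lemma add_smul_spread (v : Fin N → ℝ) (P : Fin N → Prop) (i' i : Fin N) (s : ℝ) :
    v + s • (spread P + (Pi.single i 1 - Pi.single i' 1))
      = transfer (v + s • spread P) i' i s := by
  rw [transfer, smul_add, add_assoc]

/-- The transfer direction need not point into the set of contests, for instance at tied prizes.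
Writing it as a difference of two directions that do makes difference quotients available. -/
lemma partialWithin_sub (f : (Fin N → ℝ) → ℝ) (S : Set (Fin N → ℝ)) (P : Fin N → Prop)
    (i' i : Fin N) : partialWithin f S v i - partialWithin f S v i'
      = fderivWithin ℝ f S v (spread P + (Pi.single i 1 - Pi.single i' 1))
        - fderivWithin ℝ f S v (spread P) := by
  simp only [partialWithin, map_add, map_sub]
  ring

lemma up_true : ∀ j k : Fin N, j ≤ k → (fun _ : Fin N => True) j → (fun _ : Fin N => True) k :=
  fun _ _ _ _ => trivial

lemma up_pos (hv : v ∈ contests N) : ∀ j k : Fin N, j ≤ k → 0 < v j → 0 < v k :=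
  fun _ _ hjk hj => hj.trans_le (hv.2.1 hjk)

lemma spread_mem_contests (hv : v ∈ contests N) {P : Fin N → Prop}
    (hP : ∀ j k, j ≤ k → P j → P k) {s : ℝ} (hs : 0 ≤ s) :
    v + s • spread P ∈ contests N :=
  add_smul_mem_contests hv (spread_nonneg P) (monotone_spread hP) hs

lemma spread_add_mem_contests (hv : v ∈ contests N) {P : Fin N → Prop}
    (hP : ∀ j k, j ≤ k → P j → P k) {i' i : Fin N} (hi : i' ≠ i) (h' : P i') (h : P i) {s : ℝ}
    (hs : 0 ≤ s) : v + s • (spread P + (Pi.single i 1 - Pi.single i' 1)) ∈ contests N :=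
  add_smul_mem_contests hv (spread_add_nonneg hi h' h) (monotone_spread_add hP hi h' h) hs

/-- If transfers from `i'` to `i` raise `f`, the difference of the partial derivatives is
nonnegative. -/
lemma partialWithin_sub_nonneg {f : (Fin N → ℝ) → ℝ} (hv : v ∈ contests N) {i' i : Fin N}
    (hi : i' ≠ i) (hd : DifferentiableWithinAt ℝ f (contests N) v)
    (hf : ∀ w ∈ contests N, ∀ ε, 0 ≤ ε → transfer w i' i ε ∈ contests N →
      f w ≤ f (transfer w i' i ε)) :
    0 ≤ partialWithin f (contests N) v i - partialWithin f (contests N) v i' := by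
  rw [partialWithin_sub f _ (fun _ => True), sub_nonneg]
  refine fderivWithin_apply_le hd
    (fun s hs => spread_add_mem_contests hv up_true hi trivial trivial hs.1.le)
    (fun s hs => spread_mem_contests hv up_true hs.1.le) fun s hs => ?_
  have := spread_add_mem_contests hv up_true hi trivial trivial hs.1.le
  rw [add_smul_spread] at this ⊢
  exact hf _ (spread_mem_contests hv up_true hs.1.le) s hs.1.le this

/-- If transfers from `i'` to `i` lower `f`, the difference of the partial derivatives is
nonpositive. -/
lemma partialWithin_sub_nonpos {f : (Fin N → ℝ) → ℝ} (hv : v ∈ contests N) {i' i : Fin N}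
    (hi : i' ≠ i) (hd : DifferentiableWithinAt ℝ f (contests N) v)
    (hf : ∀ w ∈ contests N, ∀ ε, 0 ≤ ε → transfer w i' i ε ∈ contests N →
      f (transfer w i' i ε) ≤ f w) :
    partialWithin f (contests N) v i - partialWithin f (contests N) v i' ≤ 0 := by
  rw [partialWithin_sub f _ (fun _ => True), sub_nonpos]
  refine fderivWithin_apply_le hd (fun s hs => spread_mem_contests hv up_true hs.1.le)
    (fun s hs => spread_add_mem_contests hv up_true hi trivial trivial hs.1.le) fun s hs => ?_
  have := spread_add_mem_contests hv up_true hi trivial trivial hs.1.le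
  rw [add_smul_spread] at this ⊢
  exact hf _ (spread_mem_contests hv up_true hs.1.le) s hs.1.le this

lemma partialWithin_zeroFace_sub_nonpos {f : (Fin N → ℝ) → ℝ} (hv : v ∈ contests N)
    {i' i : Fin N} (hi : i' ≠ i) (h' : 0 < v i') (h : 0 < v i)
    (hd : DifferentiableWithinAt ℝ f (zeroFace v) v)
    (hf : ∀ w ∈ contests N, ∀ ε, 0 ≤ ε → transfer w i' i ε ∈ contests N →
      f (transfer w i' i ε) ≤ f w) :
    partialWithin f (zeroFace v) v i - partialWithin f (zeroFace v) v i' ≤ 0 := by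
  have hP := up_pos hv
  -- Spreading only the positive prizes keeps both segments inside the face.
  rw [partialWithin_sub f _ (fun j => 0 < v j), sub_nonpos]
  refine fderivWithin_apply_le hd
    (fun s hs => ⟨spread_mem_contests hv hP hs.1.le, fun j hj => ?_⟩)
    (fun s hs => ⟨spread_add_mem_contests hv hP hi h' h hs.1.le, fun j hj => ?_⟩) fun s hs => ?_
  · rw [Pi.add_apply, Pi.smul_apply, spread_of_not hj.not_gt, hj, smul_zero, add_zero]
  · rw [Pi.add_apply, Pi.smul_apply,
      spread_add_of_not (P := fun j => 0 < v j) h' h hj.not_gt, hj, smul_zero, add_zero]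
  · have := spread_add_mem_contests hv hP hi h' h hs.1.le
    rw [add_smul_spread] at this ⊢
    exact hf _ (spread_mem_contests hv hP hs.1.le) s hs.1.le this

end Directions

section Differentiability

variable {N L : ℕ} {θ p : Fin (L + 1) → ℝ} {c : ℝ → ℝ} {v : Fin N → ℝ}

/-- The cost at the quantile `t` as a linear function of the contest. -/
noncomputable def costFunctional (N : ℕ) {L : ℕ} (θ p : Fin (L + 1) → ℝ) (t : ℝ) :
    (Fin N → ℝ) →L[ℝ] ℝ :=
  ∑ i : Fin N, sweep θ p (binom N (i + 1)) t • ContinuousLinearMap.proj i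

lemma costFunctional_apply (t : ℝ) (w : Fin N → ℝ) :
    costFunctional N θ p t w = costCurve θ p w t := by
  rw [costCurve_eq_sum, costFunctional]
  simp [mul_comm]

lemma continuous_costFunctional : Continuous (costFunctional N θ p) :=
  continuous_finsetSum _ fun _ _ =>
    (continuous_sweep (continuous_binom _ _)).smul continuous_const

/-- Differentiation of the expected effort under the integral sign. -/
lemma differentiableAt_integral_invCost (hθ : ∀ k, 0 < θ k) (hanti : StrictAnti θ)
    (hp : ∀ k, 0 < p k) (hs : ∑ k, p k = 1) (hc : IsCost c) (hv : v ∈ contests N)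
    (π : (Fin N → ℝ) →L[ℝ] (Fin N → ℝ)) (hπ : π v = v) {K r : ℝ} (hr : 0 < r)
    (h : ∀ w ∈ Metric.ball v r, ∀ t ∈ Set.Ioc (0 : ℝ) 1,
      |invCost c (max (costCurve θ p (π w) t) 0) - invCost c (max (costCurve θ p v t) 0)|
        ≤ K * ‖w - v‖) :
    DifferentiableAt ℝ
      (fun w => ∫ t in (0 : ℝ)..1, invCost c (max (costCurve θ p (π w) t) 0)) v := by
  -- Vectors near `v` need not be contests and may have negative costs; truncation at zero keeps the
  -- integrand within the range of the estimates.
  have hg : Continuous fun y : ℝ => invCost c (max y 0) :=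
    hc.continuous_invCost.comp (by fun_prop)
  have hF : ∀ w : Fin N → ℝ, Continuous fun t => invCost c (max (costCurve θ p w t) 0) :=
    fun w => hg.comp (continuous_costCurve w)
  have hder : ∀ y : ℝ, 0 < y →
      HasDerivAt (fun y : ℝ => invCost c (max y 0)) (deriv (invCost c) y) y := by
    intro y hy
    refine (hc.differentiableAt_invCost hy).hasDerivAt.congr_of_eventuallyEq ?_
    filter_upwards [lt_mem_nhds hy] with z hz
    rw [max_eq_left hz.le]
  -- This form of dominated differentiation needs the Lipschitz estimate only between `w` and the
  -- centre `v`.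
  have main := hasFDerivAt_integral_of_dominated_loc_of_lip' (𝕜 := ℝ)
    (μ := volume.restrict (Set.Ioc (0 : ℝ) 1)) (x₀ := v) (s := Metric.ball v r)
    (F := fun w t => invCost c (max (costCurve θ p (π w) t) 0)) (bound := fun _ => K)
    (F' := fun t => deriv (invCost c) (costCurve θ p v t) • (costFunctional N θ p t).comp π)
    (Metric.ball_mem_nhds v hr) (fun w _ => (hF (π w)).aestronglyMeasurable)
    ((hF (π v)).integrableOn_Ioc) ?_ ?_ (integrable_const K) ?_
  · simp only [intervalIntegral.integral_of_le zero_le_one]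
    exact main.2.differentiableAt
  · have h1 : Measurable fun t => deriv (invCost c) (costCurve θ p v t) :=
      (measurable_deriv _).comp (continuous_costCurve v).measurable
    have h2 : Continuous fun t => (costFunctional N θ p t).comp π :=
      continuous_costFunctional.clm_comp continuous_const
    exact h1.aestronglyMeasurable.smul h2.aestronglyMeasurable
  · filter_upwards [ae_restrict_mem measurableSet_Ioc] with t ht w hw
    rw [hπ, Real.norm_eq_abs]
    exact h w hw t ht
  · filter_upwards [ae_restrict_mem measurableSet_Ioc] with t ht
    have h1 : HasFDerivAt (fun w => costCurve θ p (π w) t) ((costFunctional N θ p t).comp π) v := by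
      have := ((costFunctional N θ p t).comp π).hasFDerivAt (x := v)
      refine this.congr_of_eventuallyEq (Eventually.of_forall fun w => ?_)
      simp [costFunctional_apply]
    have h2 := hder (costCurve θ p (π v) t) (by
      rw [hπ]
      exact costCurve_pos hθ hanti hp hs hv ht.1 ht.2)
    have h3 := h2.comp_hasFDerivAt v h1
    rw [hπ] at h3
    exact h3

/-- The right side makes sense on a full neighbourhood of `v`, where it can be differentiated. -/
lemma expectedEffort_eq_max (hθ : ∀ k, 0 < θ k) (hanti : StrictAnti θ)
    (hp : ∀ k, 0 < p k) (hs : ∑ k, p k = 1) (hc : IsCost c) (hv : v ∈ contests N) :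
    expectedEffort (fun k x => θ k * c x) p v
      = ∫ t in (0 : ℝ)..1, invCost c (max (costCurve θ p v t) 0) := by
  rw [expectedEffort_eq hθ hanti hp hs hc hv]
  refine intervalIntegral.integral_congr fun t ht => ?_
  rw [Set.uIcc_of_le zero_le_one] at ht
  simp only [effortCurve, max_eq_left (costCurve_nonneg hθ hanti hp hs hv ht)]

lemma exists_abs_sweep_binom_le_const (N : ℕ) (θ p : Fin (L + 1) → ℝ) :
    ∃ C, 0 ≤ C ∧ ∀ i : Fin N, ∀ t ∈ Set.Icc (0 : ℝ) 1, |sweep θ p (binom N (i + 1)) t| ≤ C := by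
  have h : ∀ i : Fin N, ∃ C, ∀ t ∈ Set.Icc (0 : ℝ) 1, ‖sweep θ p (binom N (i + 1)) t‖ ≤ C :=
    fun i => isCompact_Icc.exists_bound_of_continuousOn
      (continuous_sweep (continuous_binom _ _)).continuousOn
  choose C hC using h
  refine ⟨∑ i, |C i|, Finset.sum_nonneg fun i _ => abs_nonneg _, fun i t ht => ?_⟩
  exact (hC i t ht).trans ((le_abs_self _).trans
    (Finset.single_le_sum (f := fun i => |C i|) (fun i _ => abs_nonneg _) (Finset.mem_univ i)))

lemma abs_costCurve_sub_le {C : ℝ} {w : Fin N → ℝ} {t : ℝ}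
    (h : ∀ i, w i ≠ v i → |sweep θ p (binom N (i + 1)) t| ≤ C) :
    |costCurve θ p w t - costCurve θ p v t| ≤ ∑ i : Fin N, |w i - v i| * C := by
  rw [costCurve_eq_sum, costCurve_eq_sum, ← Finset.sum_sub_distrib]
  refine (Finset.abs_sum_le_sum_abs _ _).trans (Finset.sum_le_sum fun i _ => ?_)
  rw [← sub_mul, abs_mul]
  by_cases hi : w i = v i
  · simp [hi]
  · exact mul_le_mul_of_nonneg_left (h i hi) (abs_nonneg _)

lemma sum_abs_sub_le (v w : Fin N → ℝ) : ∑ i : Fin N, |w i - v i| ≤ N * ‖w - v‖ := by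
  have := Finset.sum_le_card_nsmul (Finset.univ : Finset (Fin N)) (fun i => |w i - v i|) ‖w - v‖
    fun i _ => norm_le_pi_norm (w - v) i
  simpa using this

lemma differentiableWithinAt_expectedEffort (hθ : ∀ k, 0 < θ k) (hanti : StrictAnti θ)
    (hp : ∀ k, 0 < p k) (hs : ∑ k, p k = 1) (hc : IsCost c) (hv : v ∈ contests N)
    (h : ∀ M : ℝ, ∃ K, 0 ≤ K ∧ ∀ y ∈ Set.Icc 0 M, ∀ z ∈ Set.Icc 0 M,
      |invCost c y - invCost c z| ≤ K * |y - z|) :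
    DifferentiableWithinAt ℝ (expectedEffort (fun k x => θ k * c x) p) (contests N) v := by
  obtain ⟨C, hC0, hC⟩ := exists_abs_sweep_binom_le_const N θ p
  have hbound : ∀ w ∈ Metric.ball v 1, ∀ t ∈ Set.Icc (0 : ℝ) 1,
      |costCurve θ p w t - costCurve θ p v t| ≤ N * C * ‖w - v‖ := by
    intro w _ t ht
    refine (abs_costCurve_sub_le fun i _ => hC i t ht).trans ?_
    rw [← Finset.sum_mul]
    linarith [mul_le_mul_of_nonneg_right (sum_abs_sub_le v w) hC0]
  -- An upper bound for the costs of all vectors in the unit ball around `v`.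
  set M := costCurve θ p v 1 + N * C with hM
  have hM0 : 0 ≤ (N : ℝ) * C := by positivity
  obtain ⟨K, hK0, hK⟩ := h M
  have hmem : ∀ w ∈ Metric.ball v 1, ∀ t ∈ Set.Icc (0 : ℝ) 1,
      max (costCurve θ p w t) 0 ∈ Set.Icc 0 M := by
    intro w hw t ht
    have h1 := (abs_le.1 (hbound w hw t ht)).2
    have h2 := (strictMonoOn_costCurve (θ := θ) hθ hanti hp hs hv).monotoneOn ht
      ⟨zero_le_one, le_rfl⟩ ht.2
    have h3 : ‖w - v‖ ≤ 1 := (mem_ball_iff_norm.1 hw).le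
    have h4 := mul_le_mul_of_nonneg_left h3 hM0
    have h5 := costCurve_nonneg hθ hanti hp hs hv (θ := θ) ⟨zero_le_one, le_rfl⟩
    exact ⟨le_max_right _ _, max_le (by linarith) (by linarith)⟩
  have hd := differentiableAt_integral_invCost hθ hanti hp hs hc hv
    (ContinuousLinearMap.id ℝ (Fin N → ℝ)) rfl (K := K * (N * C)) one_pos (by
      intro w hw t ht
      have ht' : t ∈ Set.Icc (0 : ℝ) 1 := ⟨ht.1.le, ht.2⟩
      refine (hK _ (hmem w hw t ht') _ (hmem v (Metric.mem_ball_self one_pos) t ht')).trans ?_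
      rw [mul_assoc]
      refine mul_le_mul_of_nonneg_left ?_ hK0
      exact (abs_max_sub_max_le_abs _ _ _).trans (hbound w hw t ht'))
  exact hd.differentiableWithinAt.congr (fun w hw => expectedEffort_eq_max hθ hanti hp hs hc hw)
    (expectedEffort_eq_max hθ hanti hp hs hc hv)

open Classical in
/-- The projection of contests that sets the prizes which are zero in `v` to zero. -/
noncomputable def supportProj (v : Fin N → ℝ) : (Fin N → ℝ) →L[ℝ] (Fin N → ℝ) :=
  ContinuousLinearMap.pi fun j => if v j = 0 then 0 else ContinuousLinearMap.proj j

lemma supportProj_of_eq_zero {v w : Fin N → ℝ} {j : Fin N} (h : v j = 0) :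
    supportProj v w j = 0 := by
  simp [supportProj, h]

lemma supportProj_of_ne_zero {v w : Fin N → ℝ} {j : Fin N} (h : v j ≠ 0) :
    supportProj v w j = w j := by
  simp [supportProj, h]

lemma supportProj_eq {v w : Fin N → ℝ} (h : ∀ j, v j = 0 → w j = 0) : supportProj v w = w := by
  funext j
  by_cases hj : v j = 0
  · rw [supportProj_of_eq_zero hj, h j hj]
  · exact supportProj_of_ne_zero hj

/-- On the face, a perturbation changes the cost `y` at each quantile by at most `D * ‖w - v‖ * y`.
Above `y / 2` the inverse cost has Lipschitz constant `invCost c (y / 2) / (y / 2)`, so the factor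
`y` cancels and the bound is uniform in the quantile. -/
lemma differentiableWithinAt_zeroFace (hθ : ∀ k, 0 < θ k) (hanti : StrictAnti θ)
    (hp : ∀ k, 0 < p k) (hs : ∑ k, p k = 1) (hc : IsCost c) (hcc : ConvexOn ℝ (Set.Ici 0) c)
    (hv : v ∈ contests N) :
    DifferentiableWithinAt ℝ (expectedEffort (fun k x => θ k * c x) p) (zeroFace v) v := by
  have hex : ∀ i : Fin N, ∃ C, 0 ≤ C ∧ (v i ≠ 0 → ∀ t ∈ Set.Icc (0 : ℝ) 1,
      |sweep θ p (binom N (i + 1)) t| ≤ C * costCurve θ p v t) := by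
    intro i
    by_cases hi : v i = 0
    · exact ⟨0, le_rfl, fun h => absurd hi h⟩
    · obtain ⟨C, hC0, hC⟩ := exists_abs_sweep_binom_le hθ hanti hp hs hv
        (lt_of_le_of_ne (hv.1 i) (Ne.symm hi))
      exact ⟨C, hC0, fun _ => hC⟩
  choose C hC0 hC using hex
  set B := ∑ i, C i with hB
  have hB0 : 0 ≤ B := Finset.sum_nonneg fun i _ => hC0 i
  have hπ : supportProj v v = v := supportProj_eq fun _ h => h
  set D := (N : ℝ) * B with hD
  have hD0 : 0 ≤ D := by positivity
  have hbound : ∀ w : Fin N → ℝ, ∀ t ∈ Set.Icc (0 : ℝ) 1,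
      |costCurve θ p (supportProj v w) t - costCurve θ p v t|
        ≤ D * ‖w - v‖ * costCurve θ p v t := by
    intro w t ht
    have h0 := costCurve_nonneg (θ := θ) hθ hanti hp hs hv ht
    refine (abs_costCurve_sub_le (C := B * costCurve θ p v t) fun i hi => ?_).trans ?_
    · have hvi : v i ≠ 0 := fun h => hi (by rw [supportProj_of_eq_zero h, h])
      exact (hC i hvi t ht).trans (mul_le_mul_of_nonneg_right
        (Finset.single_le_sum (fun i _ => hC0 i) (Finset.mem_univ i)) h0)
    · have h1 : ∑ i : Fin N, |supportProj v w i - v i| ≤ ∑ i : Fin N, |w i - v i| := by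
        refine Finset.sum_le_sum fun i _ => ?_
        by_cases hi : v i = 0
        · rw [supportProj_of_eq_zero hi, hi, sub_zero, abs_zero]
          exact abs_nonneg _
        · rw [supportProj_of_ne_zero hi]
      rw [← Finset.sum_mul]
      have h2 := mul_le_mul_of_nonneg_right (h1.trans (sum_abs_sub_le v w)) (mul_nonneg hB0 h0)
      rw [hD]
      linarith
  -- This radius makes the relative change of cost at most `1 / 2`, so perturbed costs stay above
  -- half the original ones.
  have hr : 0 < 1 / (2 * D + 1) := by positivity
  have hd := differentiableAt_integral_invCost (θ := θ) hθ hanti hp hs hc hv (supportProj v) hπ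
    (K := 2 * D * invCost c (costCurve θ p v 1)) hr (by
      intro w hw t ht
      have ht' : t ∈ Set.Icc (0 : ℝ) 1 := ⟨ht.1.le, ht.2⟩
      have hpos := costCurve_pos (θ := θ) hθ hanti hp hs hv ht.1 ht.2
      have hw1 : ‖w - v‖ < 1 / (2 * D + 1) := mem_ball_iff_norm.1 hw
      have hw2 : D * ‖w - v‖ ≤ 1 / 2 := by
        rw [lt_div_iff₀ (by positivity)] at hw1
        linarith [norm_nonneg (w - v)]
      have h1 := hbound w t ht'
      have h2 : D * ‖w - v‖ * costCurve θ p v t ≤ 1 / 2 * costCurve θ p v t :=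
        mul_le_mul_of_nonneg_right hw2 hpos.le
      have h3 := (abs_le.1 h1).1
      have h4 : costCurve θ p v t / 2 ≤ costCurve θ p (supportProj v w) t := by linarith
      have h5 : 0 < costCurve θ p v t / 2 := by linarith
      rw [max_eq_left hpos.le, max_eq_left (h5.le.trans h4)]
      have hmono := (strictMonoOn_costCurve (θ := θ) hθ hanti hp hs hv).monotoneOn ht'
        ⟨zero_le_one, le_rfl⟩ ht.2
      have h6 : invCost c (costCurve θ p v t / 2) ≤ invCost c (costCurve θ p v 1) :=
        hc.strictMono_invCost.monotone (by linarith)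
      have h7 := hc.invCost_nonneg h5.le
      calc _ ≤ invCost c (costCurve θ p v t / 2) / (costCurve θ p v t / 2)
            * |costCurve θ p (supportProj v w) t - costCurve θ p v t| :=
            hc.abs_invCost_sub_le_of_convexOn hcc h5 h4 (by linarith)
        _ ≤ invCost c (costCurve θ p v t / 2) / (costCurve θ p v t / 2)
            * (D * ‖w - v‖ * costCurve θ p v t) :=
            mul_le_mul_of_nonneg_left h1 (div_nonneg h7 h5.le)
        _ = 2 * D * invCost c (costCurve θ p v t / 2) * ‖w - v‖ := by
            field_simp
        _ ≤ _ := mul_le_mul_of_nonneg_right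
            (mul_le_mul_of_nonneg_left h6 (by positivity)) (norm_nonneg _))
  refine hd.differentiableWithinAt.congr (fun w hw => ?_) ?_
  · rw [supportProj_eq hw.2]
    exact expectedEffort_eq_max hθ hanti hp hs hc hw.1
  · rw [hπ]
    exact expectedEffort_eq_max hθ hanti hp hs hc hv

/-- The equilibrium utility of the most efficient type as a linear function of the contest. -/
noncomputable def utilityFunctional (N : ℕ) {L : ℕ} (θ p : Fin (L + 1) → ℝ) :
    (Fin N → ℝ) →L[ℝ] ℝ :=
  ∑ i : Fin N, (θ (Fin.last L) * ∑ k : Fin L, binom N (i + 1) (cumProb p k.castSucc)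
    * (1 / θ k.succ - 1 / θ k.castSucc)) • ContinuousLinearMap.proj i

lemma utilityFunctional_apply (θ p : Fin (L + 1) → ℝ) (w : Fin N → ℝ) :
    utilityFunctional N θ p w
      = ∑ i : Fin N, w i * (θ (Fin.last L) * ∑ k : Fin L, binom N (i + 1) (cumProb p k.castSucc)
          * (1 / θ k.succ - 1 / θ k.castSucc)) := by
  simp [utilityFunctional, mul_comm]

lemma hasFDerivWithinAt_equilibriumUtility (hθ : ∀ k, 0 < θ k) (hanti : StrictAnti θ)
    (hp : ∀ k, 0 < p k) (hs : ∑ k, p k = 1) (hc : IsCost c) (hv : v ∈ contests N) :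
    HasFDerivWithinAt (equilibriumUtility (fun k x => θ k * c x) p (Fin.last L))
      (utilityFunctional N θ p) (contests N) v := by
  have h : ∀ w ∈ contests N, equilibriumUtility (fun k x => θ k * c x) p (Fin.last L) w
      = utilityFunctional N θ p w := fun w hw => by
    rw [equilibriumUtility_last hθ hanti hp hs hc hw, curve_one_sub hθ hp hs,
      utilityFunctional_apply]
  exact (ContinuousLinearMap.hasFDerivWithinAt _).congr h (h v hv)

lemma partialWithin_equilibriumUtility_sub (hθ : ∀ k, 0 < θ k) (hanti : StrictAnti θ)
    (hp : ∀ k, 0 < p k) (hs : ∑ k, p k = 1) (hc : IsCost c) (hv : v ∈ contests N)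
    {i' i : Fin N} (hi : i' ≠ i) :
    partialWithin (equilibriumUtility (fun k x => θ k * c x) p (Fin.last L)) (contests N) v i
      - partialWithin (equilibriumUtility (fun k x => θ k * c x) p (Fin.last L)) (contests N) v i'
      = θ (Fin.last L) * utilityShift N θ p (i' + 1) (i + 1) := by
  have h := hasFDerivWithinAt_equilibriumUtility hθ hanti hp hs hc hv
  rw [partialWithin_sub _ _ (fun _ => True),
    fderivWithin_apply_eq h
      fun s hs => spread_add_mem_contests hv up_true hi trivial trivial hs.1.le,
    fderivWithin_apply_eq h fun s hs => spread_mem_contests hv up_true hs.1.le, ← map_sub,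
    add_sub_cancel_left, map_sub]
  simp only [utilityFunctional_apply, Pi.single_apply, ite_mul, one_mul, zero_mul,
    Finset.sum_ite_eq', Finset.mem_univ, if_true, ← mul_sub, ← Finset.sum_sub_distrib, ← sub_mul,
    utilityShift]

end Differentiability

end Contest

/-- There are `N + 1` agents and `L + 1` types. The indices `i' < i` in `Fin N` stand for the prizes
`m' = i' + 1 < m = i + 1`. -/
theorem mainTheorem1 (N L : ℕ) (θ p : Fin (L + 1) → ℝ) (c : ℝ → ℝ)
    (hθ_anti : StrictAnti θ) (hθ_pos : ∀ k, 0 < θ k)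
    (hp_pos : ∀ k, 0 < p k) (hp_sum : ∑ k, p k = 1)
    (hc : Contest.IsCost c) (i' i : Fin N) (hi : i' < i) :
    let cost : Fin (L + 1) → ℝ → ℝ := fun k x => θ k * c x
    let EX : (Fin N → ℝ) → ℝ := Contest.expectedEffort cost p
    let uK : (Fin N → ℝ) → ℝ := Contest.equilibriumUtility cost p (Fin.last L)
    let V : Set (Fin N → ℝ) := Contest.contests N
    let m : ℕ := i + 1
    let m' : ℕ := i' + 1
    -- every contest has exactly one symmetric equilibrium
    (∀ v ∈ V, ∃! σ, Contest.IsSymmetricEquilibrium cost p v σ) ∧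
    -- the two forms of the condition on the utility of the most efficient type agree
    (∀ v ∈ V, DifferentiableWithinAt ℝ uK V v ∧
      (Contest.partialWithin uK V v i - Contest.partialWithin uK V v i' ≤ 0 ↔
        Contest.utilityShift N θ p m' m ≤ 0)) ∧
    (m = N ∨ Contest.utilityShift N θ p m' m ≤ 0 →
      -- concave costs
      (0 ≤ Contest.alpha N θ p m - Contest.alpha N θ p m' → ConcaveOn ℝ (Set.Ici 0) c →
        ∀ v ∈ V,
          DifferentiableWithinAt ℝ EX V v ∧
          0 ≤ Contest.partialWithin EX V v i - Contest.partialWithin EX V v i' ∧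
          (∀ ε, 0 ≤ ε → Contest.transfer v i' i ε ∈ V →
            EX v ≤ EX (Contest.transfer v i' i ε))) ∧
      -- convex costs; here a partial derivative may be infinite where low prizes are zero
      (Contest.alpha N θ p m - Contest.alpha N θ p m' ≤ 0 → ConvexOn ℝ (Set.Ici 0) c →
        ∀ v ∈ V,
          (0 < derivWithin c (Set.Ici 0) 0 → DifferentiableWithinAt ℝ EX V v) ∧
          (DifferentiableWithinAt ℝ EX V v →
            Contest.partialWithin EX V v i - Contest.partialWithin EX V v i' ≤ 0) ∧
          (0 < v i' →
            DifferentiableWithinAt ℝ EX (Contest.zeroFace v) v ∧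
            Contest.partialWithin EX (Contest.zeroFace v) v i
              - Contest.partialWithin EX (Contest.zeroFace v) v i' ≤ 0) ∧
          (∀ ε, 0 ≤ ε → Contest.transfer v i' i ε ∈ V →
            EX (Contest.transfer v i' i ε) ≤ EX v))) := by
  intro cost EX uK V m m'
  have hne : i' ≠ i := hi.ne
  have hEX : ∀ w ∈ V, EX w = ∫ t in (0 : ℝ)..1, Contest.effortCurve θ p c w t := fun w hw =>
    Contest.expectedEffort_eq hθ_pos hθ_anti hp_pos hp_sum hc hw
  refine ⟨fun v hv => ?_, fun v hv => ⟨?_, ?_⟩, fun hcond => ⟨fun hα hcc => ?_, fun hα hcc => ?_⟩⟩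
  · have h := Contest.isSymmetricEquilibrium_strategy hθ_pos hθ_anti hp_pos hp_sum hc hv
    exact ⟨_, h, fun τ hτ => Contest.IsSymmetricEquilibrium.unique hθ_pos hθ_anti hp_pos hp_sum
      hc hv hτ h⟩
  · exact (Contest.hasFDerivWithinAt_equilibriumUtility hθ_pos hθ_anti hp_pos hp_sum hc
      hv).differentiableWithinAt
  · have h := Contest.partialWithin_equilibriumUtility_sub hθ_pos hθ_anti hp_pos hp_sum hc hv hne
    rw [h]
    exact mul_nonpos_iff_pos_imp_nonpos.trans
      ⟨fun h => h.1 (hθ_pos _), fun h => ⟨fun _ => h, fun _ => (hθ_pos _).le⟩⟩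
  · have hmono : ∀ w ∈ V, ∀ ε, 0 ≤ ε → Contest.transfer w i' i ε ∈ V →
        EX w ≤ EX (Contest.transfer w i' i ε) := fun w hw ε hε hw' => by
      rw [hEX w hw, hEX _ hw']
      exact Contest.integral_effortCurve_le_transfer hθ_pos hθ_anti hp_pos hp_sum hc hcc hw hi hε
        hw' hcond hα
    intro v hv
    have hd : DifferentiableWithinAt ℝ EX V v :=
      Contest.differentiableWithinAt_expectedEffort hθ_pos hθ_anti hp_pos hp_sum hc hv
        (hc.exists_lipschitz_of_concaveOn hcc)
    exact ⟨hd, Contest.partialWithin_sub_nonneg hv hne hd hmono, hmono v hv⟩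
  · have hmono : ∀ w ∈ V, ∀ ε, 0 ≤ ε → Contest.transfer w i' i ε ∈ V →
        EX (Contest.transfer w i' i ε) ≤ EX w := fun w hw ε hε hw' => by
      rw [hEX w hw, hEX _ hw']
      exact Contest.transfer_le_integral_effortCurve hθ_pos hθ_anti hp_pos hp_sum hc hcc hw hi hε
        hw' hcond hα
    intro v hv
    refine ⟨fun h0 => ?_, fun hd => ?_, fun hpos => ?_, hmono v hv⟩
    · exact Contest.differentiableWithinAt_expectedEffort hθ_pos hθ_anti hp_pos hp_sum hc hv
        (hc.exists_lipschitz_of_convexOn hcc h0)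
    · exact Contest.partialWithin_sub_nonpos hv hne hd hmono
    · have hd : DifferentiableWithinAt ℝ EX (Contest.zeroFace v) v :=
        Contest.differentiableWithinAt_zeroFace hθ_pos hθ_anti hp_pos hp_sum hc hcc hv
      exact ⟨hd, Contest.partialWithin_zeroFace_sub_nonpos hv hne hpos
        (hpos.trans_le (hv.2.1 hi.le)) hd hmono⟩
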